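/- Write $(x_1,x_2)^\perp=(-x_2,x_1)$, $e_2=(0,1)$, $\mathrm{Tr}_2(x_1,x_2)=(x_1+2\pi,x_2)$. Let $T>0$, $\rho^1,\rho^2>0$, $\sigma,g\ge 0$. Let $z=(z_1,z_2)\in C^4(\mathbb R\times[0,T];\mathbb R^2)$ be such that, for every $t\in[0,T]$, $z(\cdot,t)$ is injective, $z_\alpha(\cdot,t)$ does not vanish and $z(\alpha+2\pi,t)=\mathrm{Tr}_2(z(\alpha,t))$. Let $\Gamma_t=\{z(\alpha,t):\alpha\in\mathbb R\}$ and assume that, for every $t\in[0,T]$, the plane is the disjoint union $\Omega^1(t)\cup\Omega^2(t)\cup\Gamma_t$, where $\Omega^1(t),\Omega^2(t)$ are open, connected and simply connected, $\partial\Omega^1(t)=\partial\Omega^2(t)=\Gamma_t$ and $\mathrm{Tr}_2(\Omega^j(t))=\Omega^j(t)$. Assume also that there is $a\ge1$ with $\mathbb R\times(-\infty,-a]\subseteq\Omega^1(t)$ and $\mathbb R\times[a,\infty)\subseteq\Omega^2(t)$ for all $t\in[0,T]$. For $j\in\{1,2\}$ let the velocity $u^j$ be $C^2$ on the closed space-time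 region $\{(x,t):t\in[0,T],\,x\in\overline{\Omega^j(t)}\}$, with values in $\mathbb R^2$, and let the pressure $P^j(\cdot,t)$ be $C^1$ on $\overline{\Omega^j(t)}$ for each $t\in[0,T]$. Assume that for all $t\in[0,T]$ $$\rho^j(\partial_tu^j+[u^j\cdot\nabla]u^j)=-\nabla P^j-g\rho^je_2,\qquad \mathrm{div}\,u^j=0,\qquad \mathrm{curl}\,u^j=0\qquad\text{in }\Omega^j(t),$$ $$(\partial_tz-u^j|_{\Gamma_t})\cdot(z_\alpha)^\perp=0,\qquad (P^2-P^1)|_{\Gamma_t}=-\sigma\,\frac{\partial_\alpha z_1\partial_\alpha^2z_2-\partial_\alpha z_2\partial_\alpha^2z_1}{[(\partial_\alpha z_1)^2+(\partial_\alpha z_2)^2]^{3/2}},$$ $$u^j(\mathrm{Tr}_2(x),t)=u^j(x,t)\ \text{ for }x\in\Omega^j(t),\qquad u^j(\cdot,t)\in L^2\big(\Omega^j(t)\cap([0,2\pi]\times\mathbb R)\big).$$ (Time derivatives at $t=0$ and $t=T$ are one-sided.) Let $v^j(\alpha,t)=u^j(z(\alpha,t),t)$ and $\widetilde P^j(\alpha,t)=P^j(z(\alpha,t),t)$.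 **Proposition.** There is a function $\omega\in C^2(\mathbb R\times[0,T];\mathbb R)$, $2\pi$-periodic in $\alpha$, such that for all $(\alpha,t)\in\mathbb R\times[0,T]$ the principal value $$BR(z,\omega)(\alpha,t):=\frac1{2\pi}\,\mathrm{p.v.}\!\int_{\mathbb R}\frac{(z(\alpha,t)-z(\beta,t))^\perp}{|z(\alpha,t)-z(\beta,t)|^2}\,\omega(\beta,t)\,d\beta$$ (the limit of the integrals over $\varepsilon\le|\alpha-\beta|\le R$ as $\varepsilon\to0^+$ and $R\to\infty$ independently) exists, and $$v^1=BR(z,\omega)+\frac{\omega}{2}\frac{z_\alpha}{|z_\alpha|^2},\qquad v^2=BR(z,\omega)-\frac{\omega}{2}\frac{z_\alpha}{|z_\alpha|^2}.$$ Moreover, on $\mathbb R\times[0,T]$, $$[z_t-BR(z,\omega)]\cdot(z_\alpha)^\perp=0,$$ and for $j\in\{1,2\}$ all derivatives in the following identity exist and $$\partial_t(v^j\cdot z_\alpha)-\partial_\alpha(v^j\cdot z_t)+\tfrac12\partial_\alpha(|v^j|^2)+\tfrac1{\rho^j}\partial_\alpha\widetilde P^j+g\,\partial_\alpha z_2=0.$$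 -/

import Mathlib

open Set Filter Topology MeasureTheory

namespace TwoFluid

noncomputable section

/-- The Euclidean plane. -/
abbrev Plane := EuclideanSpace ℝ (Fin 2)

/-- The rotation `(x₁, x₂)^⊥ = (-x₂, x₁)`. -/
def perp (x : Plane) : Plane := !₂[-x 1, x 0]

/-- The translation `Tr₂ (x₁, x₂) = (x₁ + 2π, x₂)`. -/
def tr (x : Plane) : Plane := !₂[x 0 + 2 * Real.pi, x 1]

/-- The standard basis vectors (`stdVec 1` is the upward vertical vector `e₂`). -/
def stdVec (i : Fin 2) : Plane := EuclideanSpace.single i 1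

/-- Divergence of a planar vector field. -/
def divergence (w : Plane → Plane) (x : Plane) : ℝ :=
  fderiv ℝ w x (stdVec 0) 0 + fderiv ℝ w x (stdVec 1) 1

/-- Scalar curl `∂₁w₂ - ∂₂w₁` of a planar vector field. -/
def curl (w : Plane → Plane) (x : Plane) : ℝ :=
  fderiv ℝ w x (stdVec 0) 1 - fderiv ℝ w x (stdVec 1) 0

/-- Partial derivative in the curve parameter `α` of a function of `(α, t)`. -/
def dAlpha {F : Type*} [NormedAddCommGroup F] [NormedSpace ℝ F]
    (f : ℝ → ℝ → F) (α t : ℝ) : F :=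
  deriv (fun a => f a t) α

/-- Partial derivative in time on the time interval `[0, T]` (one-sided at the end points) of a
function whose last argument is the time. -/
def dTime {X F : Type*} [NormedAddCommGroup F] [NormedSpace ℝ F]
    (T : ℝ) (f : X → ℝ → F) (x : X) (t : ℝ) : F :=
  derivWithin (fun s => f x s) (Icc 0 T) t

/-- The interface `Γ_t`. -/
def interfaceCurve (z : ℝ → ℝ → Plane) (t : ℝ) : Set Plane := range fun α => z α t

/-- The closed space-time region `{(x, t) : t ∈ [0, T], x ∈ closure Ω(t)}`. -/
def spaceTime (T : ℝ) (Ω : ℝ → Set Plane) : Set (Plane × ℝ) :=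
  {p | p.2 ∈ Icc 0 T ∧ p.1 ∈ closure (Ω p.2)}

/-- The curvature of the interface. -/
def curvature (z : ℝ → ℝ → Plane) (α t : ℝ) : ℝ :=
  (dAlpha z α t 0 * dAlpha (dAlpha z) α t 1 - dAlpha z α t 1 * dAlpha (dAlpha z) α t 0) /
    ((dAlpha z α t 0) ^ 2 + (dAlpha z α t 1) ^ 2) ^ (3 / 2 : ℝ)

/-- The geometry of the moving interface on `[0, T]`, in the periodic setting: a regular embedded
`C⁴` curve which separates the plane into a lower region `Ω 0` and an upper region `Ω 1`. -/
structure PeriodicInterface (T : ℝ) (z : ℝ → ℝ → Plane) (Ω : Fin 2 → ℝ → Set Plane) :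
    Prop where
  contDiff_z : ContDiffOn ℝ 4 (fun p : ℝ × ℝ => z p.1 p.2) (univ ×ˢ Icc 0 T)
  regular : ∀ t ∈ Icc 0 T, ∀ α, dAlpha z α t ≠ 0
  injective : ∀ t ∈ Icc 0 T, Function.Injective fun α => z α t
  periodic_z : ∀ t ∈ Icc 0 T, ∀ α, z (α + 2 * Real.pi) t = tr (z α t)
  isOpen : ∀ t ∈ Icc 0 T, ∀ j, IsOpen (Ω j t)
  isConnected : ∀ t ∈ Icc 0 T, ∀ j, IsConnected (Ω j t)
  simplyConnected : ∀ t ∈ Icc 0 T, ∀ j, IsSimplyConnected (Ω j t)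
  disjoint_domains : ∀ t ∈ Icc 0 T, Disjoint (Ω 0 t) (Ω 1 t)
  disjoint_curve : ∀ t ∈ Icc 0 T, ∀ j, Disjoint (Ω j t) (interfaceCurve z t)
  cover : ∀ t ∈ Icc 0 T, Ω 0 t ∪ Ω 1 t ∪ interfaceCurve z t = univ
  frontier_eq : ∀ t ∈ Icc 0 T, ∀ j, frontier (Ω j t) = interfaceCurve z t
  position : ∃ a : ℝ, 1 ≤ a ∧ ∀ t ∈ Icc 0 T,
    {x : Plane | x 1 ≤ -a} ⊆ Ω 0 t ∧ {x : Plane | a ≤ x 1} ⊆ Ω 1 t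
  periodic_domains : ∀ t ∈ Icc 0 T, ∀ j, tr '' Ω j t = Ω j t

/-- `(z, u, P)` is a classical irrotational solution on `[0, T]` of the periodic two-fluid
interface system, with densities `ρ j`, surface tension `σ` and gravity `g`. The lower fluid has
the index `0`, the upper fluid the index `1`; `u j x t` and `P j x t` only matter for
`t ∈ [0, T]` and `x ∈ closure (Ω j t)`. -/
structure IsTwoFluidSolution (T σ g : ℝ) (ρ : Fin 2 → ℝ) (z : ℝ → ℝ → Plane)
    (Ω : Fin 2 → ℝ → Set Plane) (u : Fin 2 → Plane → ℝ → Plane) (P : Fin 2 → Plane → ℝ → ℝ) :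
    Prop extends PeriodicInterface T z Ω where
  contDiff_u : ∀ j, ContDiffOn ℝ 2 (fun p : Plane × ℝ => u j p.1 p.2) (spaceTime T (Ω j))
  contDiff_P : ∀ t ∈ Icc 0 T, ∀ j, ContDiffOn ℝ 1 (fun x => P j x t) (closure (Ω j t))
  euler : ∀ t ∈ Icc 0 T, ∀ j, ∀ x ∈ Ω j t,
    ρ j • (dTime T (u j) x t + fderiv ℝ (fun y => u j y t) x (u j x t)) =
      -gradient (fun y => P j y t) x - (g * ρ j) • stdVec 1
  kinematic : ∀ t ∈ Icc 0 T, ∀ j, ∀ α,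
    inner ℝ (dTime T z α t - u j (z α t) t) (perp (dAlpha z α t)) = 0
  pressure_jump : ∀ t ∈ Icc 0 T, ∀ α,
    P 1 (z α t) t - P 0 (z α t) t = -(σ * curvature z α t)
  div_free : ∀ t ∈ Icc 0 T, ∀ j, ∀ x ∈ Ω j t, divergence (fun y => u j y t) x = 0
  curl_free : ∀ t ∈ Icc 0 T, ∀ j, ∀ x ∈ Ω j t, curl (fun y => u j y t) x = 0
  periodic_u : ∀ t ∈ Icc 0 T, ∀ j, ∀ x ∈ Ω j t, u j (tr x) t = u j x t
  finite_energy : ∀ t ∈ Icc 0 T, ∀ j, MemLp (fun x => u j x t) 2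
    (volume.restrict (Ω j t ∩ {x : Plane | x 0 ∈ Icc 0 (2 * Real.pi)}))

/-- The boundary velocity `v(α, t) = u(z(α, t), t)`; also used for the boundary pressure. -/
def trace {F : Type*} (z : ℝ → ℝ → Plane) (w : Plane → ℝ → F) (α t : ℝ) : F := w (z α t) t

/-- The set `{β : ε ≤ |α - β| ≤ R}`. -/
def truncation (α ε R : ℝ) : Set ℝ := {β | ε ≤ |α - β| ∧ |α - β| ≤ R}

/-- `v` is the principal value of `∫_ℝ f(β) dβ`, with symmetric truncations both at `β = α` and at
infinity: the truncated integrals exist and converge to `v` as `ε → 0+` and `R → ∞`,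
independently. -/
def HasPrincipalValue (f : ℝ → Plane) (α : ℝ) (v : Plane) : Prop :=
  (∀ ε R : ℝ, 0 < ε → IntegrableOn f (truncation α ε R)) ∧
    Tendsto (fun q : ℝ × ℝ => ∫ β in truncation α q.1 q.2, f β) (𝓝[>] 0 ×ˢ atTop) (𝓝 v)

/-- The integrand of the Birkhoff-Rott integral. -/
def birkhoffRottKernel (z : ℝ → ℝ → Plane) (ω : ℝ → ℝ → ℝ) (α t β : ℝ) : Plane :=
  (ω β t / ‖z α t - z β t‖ ^ 2) • perp (z α t - z β t)

/-- `v = BR(z, ω)(α, t)`: the principal value that defines the Birkhoff-Rott integral exists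
and `v` is its value, divided by `2π`. -/
def IsBirkhoffRott (z : ℝ → ℝ → Plane) (ω : ℝ → ℝ → ℝ) (α t : ℝ) (v : Plane) : Prop :=
  HasPrincipalValue (birkhoffRottKernel z ω α t) α ((2 * Real.pi) • v)

/-- The tangential Euler identity
`∂_t(v · z_α) - ∂_α(v · z_t) + ½ ∂_α|v|² + (1/ρ) ∂_α p + g ∂_α z₂ = 0` at `(α, t)` for a boundary
velocity `v` and a boundary pressure `p`, including the existence of the derivatives in it. -/
def TangentialEuler (T g ρ : ℝ) (z v : ℝ → ℝ → Plane) (p : ℝ → ℝ → ℝ) (α t : ℝ) : Prop :=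
  DifferentiableWithinAt ℝ (fun s => inner ℝ (v α s) (dAlpha z α s)) (Icc 0 T) t ∧
  DifferentiableAt ℝ (fun a => inner ℝ (v a t) (dTime T z a t)) α ∧
  DifferentiableAt ℝ (fun a => ‖v a t‖ ^ 2) α ∧
  DifferentiableAt ℝ (fun a => p a t) α ∧
  dTime T (fun a s => inner ℝ (v a s) (dAlpha z a s)) α t
    - dAlpha (fun a s => inner ℝ (v a s) (dTime T z a s)) α t
    + 1 / 2 * dAlpha (fun a s => ‖v a s‖ ^ 2) α t
    + 1 / ρ * dAlpha p α t
    + g * dAlpha (fun a s => z a s 1) α t = 0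

end

end TwoFluid

namespace TwoFluid

/-- A copy of `ℂ` with the discrete topology, the fibre of the covering space of local
primitives. -/
structure DiscreteComplex where
  /-- the underlying complex number -/
  val : ℂ

instance : TopologicalSpace DiscreteComplex := ⊥

instance : DiscreteTopology DiscreteComplex := ⟨rfl⟩

theorem eventually_sub_eq_of_hasDerivAt {g₁ g₂ f : ℂ → ℂ} {c₁ c₂ x₀ : ℂ} {r₁ r₂ : ℝ}
    (h₁ : ∀ x ∈ Metric.ball c₁ r₁, HasDerivAt g₁ (f x) x)
    (h₂ : ∀ x ∈ Metric.ball c₂ r₂, HasDerivAt g₂ (f x) x)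
    {x : ℂ} (hx₁ : x₀ ∈ Metric.ball c₁ r₁) (hx₂ : x₀ ∈ Metric.ball c₂ r₂)
    (hy₁ : x ∈ Metric.ball c₁ r₁) (hy₂ : x ∈ Metric.ball c₂ r₂) :
    g₁ x - g₂ x = g₁ x₀ - g₂ x₀ := by
  have hconv : Convex ℝ (Metric.ball c₁ r₁ ∩ Metric.ball c₂ r₂) :=
    (convex_ball _ _).inter (convex_ball _ _)
  have ho : IsOpen (Metric.ball c₁ r₁ ∩ Metric.ball c₂ r₂) :=
    Metric.isOpen_ball.inter Metric.isOpen_ball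
  have hd : ∀ y ∈ Metric.ball c₁ r₁ ∩ Metric.ball c₂ r₂, HasDerivAt (g₁ - g₂) 0 y := by
    intro y hy
    simpa using (h₁ y hy.1).sub (h₂ y hy.2)
  exact ho.is_const_of_deriv_eq_zero hconv.isPreconnected
    (fun y hy => (hd y hy).differentiableAt.differentiableWithinAt)
    (fun y hy => (hd y hy).deriv) ⟨hy₁, hy₂⟩ ⟨hx₁, hx₂⟩

/-- The covering space of the local primitives of a function. -/
noncomputable def primitiveCore (U : Set ℂ) (f : ℂ → ℂ) (r : U → ℝ) (g : U → ℂ → ℂ)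
    (hr : ∀ i, 0 < r i)
    (hg : ∀ i : U, ∀ x ∈ Metric.ball (i : ℂ) (r i), HasDerivAt (g i) (f x) x) :
    FiberBundleCore U U DiscreteComplex where
  baseSet i := {x | (x : ℂ) ∈ Metric.ball (i : ℂ) (r i)}
  isOpen_baseSet i := Metric.isOpen_ball.preimage continuous_subtype_val
  indexAt x := x
  mem_baseSet_at x := Metric.mem_ball_self (hr x)
  coordChange i j x v := ⟨v.val + g i x - g j x⟩
  coordChange_self i x _ v := by simp
  continuousOn_coordChange i j := by
    rintro ⟨x₀, v₀⟩ ⟨⟨h₁, h₂⟩, -⟩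
    refine ContinuousAt.continuousWithinAt ?_
    refine (continuousAt_const (y := (⟨v₀.val + g i x₀ - g j x₀⟩ : DiscreteComplex))).congr ?_
    have hb : ∀ᶠ x : U in 𝓝 x₀, (x : ℂ) ∈ Metric.ball (i : ℂ) (r i) ∧
        (x : ℂ) ∈ Metric.ball (j : ℂ) (r j) :=
      (((Metric.isOpen_ball.preimage continuous_subtype_val).inter
        (Metric.isOpen_ball.preimage continuous_subtype_val)).mem_nhds ⟨h₁, h₂⟩)
    have hv : ∀ᶠ v in 𝓝 v₀, v = v₀ := by simp [nhds_discrete]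
    rw [nhds_prod_eq]
    filter_upwards [hb.prod_mk hv] with p hp
    obtain ⟨⟨hp₁, hp₂⟩, hp₃⟩ := hp
    have := eventually_sub_eq_of_hasDerivAt (hg i) (hg j) h₁ h₂ hp₁ hp₂
    rw [hp₃]
    congr 1
    linear_combination -this
  coordChange_comp i j k x _ v := by
    congr 1
    simp

/-- A holomorphic function on a simply connected open set has a primitive. -/
theorem exists_primitive_of_isSimplyConnected {U : Set ℂ} (hU : IsOpen U)
    (hs : IsSimplyConnected U) {f : ℂ → ℂ} (hf : DifferentiableOn ℂ f U) :
    ∃ g : ℂ → ℂ, ∀ x ∈ U, HasDerivAt g (f x) x := by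
  have hloc : ∀ i : U, ∃ r : ℝ, 0 < r ∧ Metric.ball (i : ℂ) r ⊆ U ∧
      ∃ g : ℂ → ℂ, ∀ x ∈ Metric.ball (i : ℂ) r, HasDerivAt g (f x) x := by
    intro i
    obtain ⟨r, hr, hrU⟩ := Metric.isOpen_iff.1 hU i i.2
    exact ⟨r, hr, hrU, (hf.mono hrU).isExactOn_ball⟩
  choose r hr hrU g hg using hloc
  let Z := primitiveCore U f r g hr hg
  have := hs.simplyConnectedSpace
  have := hU.locallyPathConnectedSpace
  obtain ⟨a, ha⟩ := hs.nonempty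
  have hcov : IsCoveringMap Z.proj := by
    refine IsCoveringMap.mk _ (fun _ => DiscreteComplex) (fun x => Z.localTrivAt x)
      (fun x => Z.mem_localTrivAt_baseSet x)
  obtain ⟨s, ⟨-, hs'⟩, -⟩ := hcov.existsUnique_continuousMap_lifts
    (ContinuousMap.id U) ⟨a, ha⟩ (⟨⟨a, ha⟩, (⟨0⟩ : DiscreteComplex)⟩ : Z.TotalSpace) rfl
  have hproj : ∀ x : U, (s x).1 = x := fun x => congrFun hs' x
  classical
  let G : ℂ → ℂ := fun x => if hx : x ∈ U then g ⟨x, hx⟩ x + DiscreteComplex.val (s ⟨x, hx⟩).2 else 0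
  refine ⟨G, fun x hx => ?_⟩
  let x₀ : U := ⟨x, hx⟩
  have hcont : ContinuousAt (fun y : U => (Z.localTriv x₀ (s y)).2) x₀ := by
    have h1 : ContinuousAt (Z.localTriv x₀) (s x₀) := by
      apply (Z.localTriv x₀).continuousAt
      rw [Bundle.Trivialization.mem_source]
      show (s x₀).1 ∈ _
      rw [hproj]
      exact Z.mem_localTrivAt_baseSet x₀
    exact (continuous_snd.continuousAt.comp (h1.comp (s.continuous.continuousAt)))
  have hev : ∀ᶠ y in 𝓝 x₀, (Z.localTriv x₀ (s y)).2 = (Z.localTriv x₀ (s x₀)).2 := by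
    have := hcont.tendsto
    rw [nhds_discrete DiscreteComplex, tendsto_pure] at this
    exact this
  set v₀ : DiscreteComplex := (Z.localTriv x₀ (s x₀)).2 with hv₀
  have hG : ∀ᶠ y in 𝓝 x, G y = g x₀ y + v₀.val := by
    have hmap : Filter.map (Subtype.val : U → ℂ) (𝓝 x₀) = 𝓝 x := hU.isOpenEmbedding_subtypeVal.map_nhds_eq x₀
    rw [← hmap, Filter.eventually_map]
    filter_upwards [hev] with y hy
    have hy' : (Z.localTriv x₀ (s y)).2
        = (⟨DiscreteComplex.val (s y).2 + g (s y).1 (s y).1 - g x₀ (s y).1⟩ : DiscreteComplex) := rfl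
    rw [hy', hproj] at hy
    simp only [G, y.2, dif_pos, Subtype.coe_eta]
    rw [← hy]
    ring
  exact (((hg x₀ x (Metric.mem_ball_self (hr x₀))).add_const v₀.val).congr_of_eventuallyEq hG)

/-- The `2π`-periodic Cauchy kernel `½ cot (x / 2)`. -/
noncomputable def cotKernel (x : ℂ) : ℂ := Complex.cot (x / 2) / 2

/-- The terms of the Mittag-Leffler expansion of the periodic Cauchy kernel. -/
noncomputable def cotKernelTerm (n : ℕ) (x : ℂ) : ℂ :=
  1 / (x - 2 * Real.pi * (n + 1)) + 1 / (x + 2 * Real.pi * (n + 1))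

/-- The periodic Cauchy kernel without its pole at the origin. -/
noncomputable def cotKernelRem (x : ℂ) : ℂ := ∑' n, cotKernelTerm n x

/-- The complement of the poles of the periodic Cauchy kernel. -/
def cotDomain : Set ℂ := {x | ∀ n : ℤ, x ≠ 2 * Real.pi * n}

theorem mem_cotDomain_iff {x : ℂ} : x ∈ cotDomain ↔ Complex.sin (x / 2) ≠ 0 := by
  rw [cotDomain, mem_ofPred_eq, ne_eq, Complex.sin_eq_zero_iff, not_exists]
  refine forall_congr' fun n => not_congr ⟨fun h => ?_, fun h => ?_⟩
  · rw [h]; ring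
  · linear_combination 2 * h

theorem isOpen_cotDomain : IsOpen cotDomain := by
  have : cotDomain = {x : ℂ | Complex.sin (x / 2) ≠ 0} := by
    ext x; exact mem_cotDomain_iff
  rw [this]
  exact isOpen_ne_fun (by fun_prop) continuous_const

theorem differentiableOn_cotKernel : DifferentiableOn ℂ cotKernel cotDomain := by
  intro x hx
  have := mem_cotDomain_iff.1 hx
  unfold cotKernel Complex.cot
  refine DifferentiableAt.differentiableWithinAt ?_
  have hc : DifferentiableAt ℂ (fun y : ℂ => Complex.cos (y / 2)) x := by fun_prop
  have hs : DifferentiableAt ℂ (fun y : ℂ => Complex.sin (y / 2)) x := by fun_prop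
  exact (hc.div hs this).div_const 2

theorem continuousOn_cotKernel : ContinuousOn cotKernel cotDomain :=
  differentiableOn_cotKernel.continuousOn

theorem cotKernel_add_two_pi (x : ℂ) : cotKernel (x + 2 * Real.pi) = cotKernel x := by
  unfold cotKernel Complex.cot
  rw [show (x + 2 * Real.pi) / 2 = x / 2 + Real.pi by ring, Complex.sin_add_pi,
    Complex.cos_add_pi, neg_div_neg_eq]

theorem cotKernel_neg (x : ℂ) : cotKernel (-x) = -cotKernel x := by
  unfold cotKernel Complex.cot
  rw [neg_div, Complex.sin_neg, Complex.cos_neg, div_neg, neg_div]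

theorem cotKernel_eq (x : ℂ) (hx : x ∈ cotDomain) : cotKernel x = 1 / x + cotKernelRem x := by
  have hpi : (Real.pi : ℂ) ≠ 0 := Complex.ofReal_ne_zero.2 Real.pi_ne_zero
  have hx' : x / (2 * Real.pi) ∈ Complex.integerComplement := by
    rintro ⟨n, hn⟩
    apply hx n
    rw [hn]
    field_simp
  have h := cot_series_rep' hx'
  have h2 : cotKernel x = 1 / (2 * Real.pi) *
      (Real.pi * Complex.cot (Real.pi * (x / (2 * Real.pi)))) := by
    unfold cotKernel
    rw [show (Real.pi : ℂ) * (x / (2 * Real.pi)) = x / 2 by field_simp]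
    field_simp
  have h3 : ∀ n : ℕ, cotKernelTerm n x = 1 / (2 * Real.pi) *
      (1 / (x / (2 * Real.pi) - (n + 1)) + 1 / (x / (2 * Real.pi) + (n + 1))) := by
    intro n
    have e1 : x - 2 * Real.pi * (n + 1) = 2 * Real.pi * (x / (2 * Real.pi) - (n + 1)) := by
      field_simp
    have e2 : x + 2 * Real.pi * (n + 1) = 2 * Real.pi * (x / (2 * Real.pi) + (n + 1)) := by
      field_simp
    simp only [cotKernelTerm, e1, e2, one_div, mul_inv]
    ring
  rw [cotKernelRem, tsum_congr h3, tsum_mul_left, ← h, h2]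
  have hx0 : x ≠ 0 := by simpa using hx 0
  field_simp
  ring

theorem norm_cotKernelTerm_le {n : ℕ} {x : ℂ} {R : ℝ} (hx : ‖x‖ ≤ R) (hR : R ≤ n + 1) :
    ‖cotKernelTerm n x‖ ≤ R / ((n : ℝ) + 1) ^ 2 := by
  set a : ℝ := 2 * Real.pi * (n + 1) with ha
  have hn : (0 : ℝ) < n + 1 := by positivity
  have hpi := Real.pi_gt_three
  have ha6 : 6 * ((n : ℝ) + 1) ≤ a := by rw [ha]; nlinarith
  have h0 : 0 ≤ ‖x‖ := norm_nonneg x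
  have hna : ‖(a : ℂ)‖ = a := by
    rw [Complex.norm_real, Real.norm_of_nonneg (by linarith)]
  have h1 : x - a ≠ 0 := by
    intro h
    have : ‖x‖ = a := by rw [sub_eq_zero.1 h, hna]
    linarith
  have h2 : x + a ≠ 0 := by
    intro h
    have : ‖x‖ = a := by rw [eq_neg_of_add_eq_zero_left h, norm_neg, hna]
    linarith
  have h3 : cotKernelTerm n x = 2 * x / (x ^ 2 - (a : ℂ) ^ 2) := by
    have ha' : (2 * Real.pi * (n + 1) : ℂ) = a := by rw [ha]; push_cast; ring
    rw [cotKernelTerm, ha', show x ^ 2 - (a : ℂ) ^ 2 = (x - a) * (x + a) by ring]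
    field_simp
    ring
  have h4 : a ^ 2 - R ^ 2 ≤ ‖x ^ 2 - (a : ℂ) ^ 2‖ := by
    have := norm_sub_norm_le ((a : ℂ) ^ 2) (x ^ 2)
    rw [norm_sub_rev, norm_pow, norm_pow, hna] at this
    nlinarith
  have h5 : 2 * ((n : ℝ) + 1) ^ 2 ≤ a ^ 2 - R ^ 2 := by nlinarith
  rw [h3, norm_div, norm_mul, Complex.norm_ofNat]
  have hR0 : 0 ≤ R := h0.trans hx
  rw [div_le_div_iff₀ (by nlinarith) (by positivity)]
  nlinarith [mul_le_mul hx (le_refl (((n : ℝ) + 1) ^ 2)) (by positivity) hR0,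
    mul_le_mul_of_nonneg_left (h5.trans h4) hR0]

theorem tendstoUniformlyOn_cotKernelRem {K : Set ℂ} (hK : Bornology.IsBounded K) :
    TendstoUniformlyOn (fun N x => ∑ n ∈ Finset.range N, cotKernelTerm n x) cotKernelRem
      atTop K := by
  obtain ⟨R, hR⟩ := hK.exists_norm_le
  have hs : Summable fun n : ℕ => R / ((n : ℝ) + 1) ^ 2 := by
    have := (summable_nat_add_iff 1).2 (Real.summable_one_div_nat_pow.2 one_lt_two)
    simpa [div_eq_mul_inv] using this.mul_left R
  refine tendstoUniformlyOn_tsum_nat_eventually hs ?_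
  filter_upwards [eventually_ge_atTop ⌈R⌉₊] with n hn x hx
  refine norm_cotKernelTerm_le (hR x hx) ?_
  have := (Nat.le_ceil R).trans (Nat.cast_le.2 hn)
  linarith

/-- The complement of the nonzero poles of the periodic Cauchy kernel. -/
def cotRemDomain : Set ℂ := {x | ∀ n : ℤ, n ≠ 0 → x ≠ 2 * Real.pi * n}

theorem continuousOn_cotKernelTerm (n : ℕ) : ContinuousOn (cotKernelTerm n) cotRemDomain := by
  unfold cotKernelTerm
  refine ContinuousOn.add (continuousOn_const.div (by fun_prop) fun x hx => ?_)
    (continuousOn_const.div (by fun_prop) fun x hx => ?_)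
  · have := hx (n + 1) (by omega)
    push_cast at this
    exact sub_ne_zero.2 this
  · have := hx (-(n + 1)) (by omega)
    push_cast at this
    intro h
    exact this (by linear_combination h)

theorem continuousOn_cotKernelRem {K : Set ℂ} (hK : Bornology.IsBounded K)
    (hK' : K ⊆ cotRemDomain) : ContinuousOn cotKernelRem K :=
  (tendstoUniformlyOn_cotKernelRem hK).continuousOn (Frequently.of_forall fun _ =>
    continuousOn_finsetSum _ fun n _ => (continuousOn_cotKernelTerm n).mono hK')

theorem norm_cotKernel_sub_le {x : ℂ} (hx : x.im ≤ -1) :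
    ‖cotKernel x - Complex.I / 2‖ ≤ 2 * Real.exp x.im := by
  set e := Complex.exp (Complex.I * x) with he
  have hne : ‖e‖ = Real.exp (-x.im) := by rw [he, Complex.norm_exp]; simp
  have h2 : 2 ≤ ‖e‖ := by
    rw [hne]
    have := Real.add_one_le_exp (-x.im)
    linarith
  have h1 : 1 - e ≠ 0 := by
    intro h
    rw [← sub_eq_zero.1 h] at h2
    norm_num at h2
  have h3 : cotKernel x - Complex.I / 2 = 1 / (Complex.I * (1 - e)) := by
    rw [cotKernel, Complex.cot_eq_exp_ratio, show 2 * Complex.I * (x / 2) = Complex.I * x by ring,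
      ← he]
    have := Complex.I_ne_zero
    field_simp
    linear_combination -(1 - e) * Complex.I_sq
  have h4 : ‖e‖ / 2 ≤ ‖1 - e‖ := by
    have := norm_sub_norm_le e 1
    rw [norm_sub_rev, norm_one] at this
    linarith
  rw [h3, norm_div, norm_mul, Complex.norm_I, norm_one, one_mul]
  calc 1 / ‖1 - e‖ ≤ 1 / (‖e‖ / 2) := by gcongr
    _ = 2 * Real.exp x.im := by rw [hne, Real.exp_neg]; field_simp

theorem norm_cotKernel_add_le {x : ℂ} (hx : 1 ≤ x.im) :
    ‖cotKernel x + Complex.I / 2‖ ≤ 2 * Real.exp (-x.im) := by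
  have := norm_cotKernel_sub_le (x := -x) (by simpa using hx)
  rw [cotKernel_neg, ← norm_neg] at this
  simpa [add_comm] using this

theorem norm_cotKernel_le {x : ℂ} (hx : 1 ≤ |x.im|) : ‖cotKernel x‖ ≤ 3 := by
  have hI : ‖Complex.I / 2‖ = 1 / 2 := by simp
  rcases le_abs.1 hx with h | h
  · have h1 := norm_cotKernel_add_le h
    have h2 : Real.exp (-x.im) ≤ 1 := Real.exp_le_one_iff.2 (by linarith)
    have h3 := norm_sub_le (cotKernel x + Complex.I / 2) (Complex.I / 2)
    rw [add_sub_cancel_right, hI] at h3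
    linarith
  · have h1 := norm_cotKernel_sub_le (x := x) (by linarith)
    have h2 : Real.exp (x.im) ≤ 1 := Real.exp_le_one_iff.2 (by linarith)
    have h3 := norm_add_le (cotKernel x - Complex.I / 2) (Complex.I / 2)
    rw [sub_add_cancel, hI] at h3
    linarith

/-- A regular injective `C²` curve in the complex plane, `2π`-periodic in the horizontal
direction, with its first two derivatives. -/
structure PeriodicCurve (ζ dζ ddζ : ℝ → ℂ) : Prop where
  hasDerivAt : ∀ β, HasDerivAt ζ (dζ β) β
  hasDerivAt_deriv : ∀ β, HasDerivAt dζ (ddζ β) β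
  continuous_deriv2 : Continuous ddζ
  add_two_pi : ∀ β, ζ (β + 2 * Real.pi) = ζ β + 2 * Real.pi
  injective : Function.Injective ζ
  deriv_ne_zero : ∀ β, dζ β ≠ 0

theorem exists_bound_of_periodic {f : ℝ → ℂ} (hf : Continuous f)
    (hp : Function.Periodic f (2 * Real.pi)) : ∃ M : ℝ, 0 < M ∧ ∀ β, ‖f β‖ ≤ M := by
  obtain ⟨M, hM⟩ := (isCompact_Icc (a := (0 : ℝ)) (b := 2 * Real.pi)).exists_bound_of_continuousOn
    hf.continuousOn
  refine ⟨max M 1, by positivity, fun β => ?_⟩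
  obtain ⟨y, hy, h⟩ := hp.exists_mem_Ico₀ Real.two_pi_pos β
  rw [h]
  exact (hM y (Ico_subset_Icc_self hy)).trans (le_max_left _ _)

namespace PeriodicCurve

variable {ζ dζ ddζ : ℝ → ℂ} (h : PeriodicCurve ζ dζ ddζ)
include h

theorem continuous : Continuous ζ :=
  continuous_iff_continuousAt.2 fun β => (h.hasDerivAt β).continuousAt

theorem continuous_deriv : Continuous dζ :=
  continuous_iff_continuousAt.2 fun β => (h.hasDerivAt_deriv β).continuousAt

theorem periodic_deriv : Function.Periodic dζ (2 * Real.pi) := by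
  intro β
  have h1 := (h.hasDerivAt (β + 2 * Real.pi)).comp_add_const β (2 * Real.pi)
  have h2 := (h.hasDerivAt β).add_const (2 * Real.pi : ℂ)
  simp_rw [h.add_two_pi] at h1
  exact h1.unique h2

theorem periodic_deriv2 : Function.Periodic ddζ (2 * Real.pi) := by
  intro β
  have h1 := (h.hasDerivAt_deriv (β + 2 * Real.pi)).comp_add_const β (2 * Real.pi)
  have h2 := (h.hasDerivAt_deriv β)
  have h3 := h.periodic_deriv
  simp_rw [h3 _] at h1
  exact h1.unique h2

theorem add_int_mul_two_pi (β : ℝ) (n : ℤ) :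
    ζ (β + 2 * Real.pi * n) = ζ β + 2 * Real.pi * n := by
  have hp : Function.Periodic (fun β => ζ β - β) (2 * Real.pi) := by
    intro β
    simp only [h.add_two_pi]
    push_cast
    ring
  have := hp.int_mul n β
  simp only [sub_eq_iff_eq_add] at this
  rw [show β + 2 * Real.pi * n = β + n * (2 * Real.pi) by ring, this]
  push_cast
  ring

theorem exists_deriv2_bound : ∃ M : ℝ, 0 < M ∧ ∀ β, ‖ddζ β‖ ≤ M :=
  exists_bound_of_periodic h.continuous_deriv2 h.periodic_deriv2

theorem exists_deriv_bound : ∃ M : ℝ, 0 < M ∧ ∀ β, ‖dζ β‖ ≤ M :=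
  exists_bound_of_periodic h.continuous_deriv h.periodic_deriv

theorem exists_le_norm_deriv : ∃ m : ℝ, 0 < m ∧ ∀ β, m ≤ ‖dζ β‖ := by
  obtain ⟨m, hm, hm'⟩ := (isCompact_Icc (a := (0 : ℝ)) (b := 2 * Real.pi)).exists_forall_le'
    (f := fun β => ‖dζ β‖) h.continuous_deriv.norm.continuousOn (a := 0)
    (fun β _ => norm_pos_iff.2 (h.deriv_ne_zero β))
  refine ⟨m, hm, fun β => ?_⟩
  obtain ⟨y, hy, e⟩ := h.periodic_deriv.exists_mem_Ico₀ Real.two_pi_pos β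
  rw [e]
  exact hm' y (Ico_subset_Icc_self hy)

theorem exists_norm_sub_id_le : ∃ B : ℝ, 0 < B ∧ ∀ β : ℝ, ‖ζ β - β‖ ≤ B := by
  refine exists_bound_of_periodic (h.continuous.sub Complex.continuous_ofReal) fun β => ?_
  rw [h.add_two_pi]
  push_cast
  ring

theorem norm_deriv_sub_le {M : ℝ} (hM : ∀ β, ‖ddζ β‖ ≤ M) (β τ : ℝ) :
    ‖dζ (β + τ) - dζ β‖ ≤ M * |τ| := by
  have := convex_univ.norm_image_sub_le_of_norm_hasDerivWithin_le (f := dζ) (f' := ddζ)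
    (fun x _ => (h.hasDerivAt_deriv x).hasDerivWithinAt) (fun x _ => hM x) (mem_univ β)
    (mem_univ (β + τ))
  simpa using this

theorem norm_sub_linear_le {M : ℝ} (hM : ∀ β, ‖ddζ β‖ ≤ M) (β τ : ℝ) :
    ‖ζ (β + τ) - ζ β - dζ β * τ‖ ≤ M * τ ^ 2 := by
  have hM0 : 0 ≤ M := (norm_nonneg _).trans (hM 0)
  have hd : ∀ x ∈ uIcc 0 τ, HasDerivWithinAt (fun x : ℝ => ζ (β + x) - dζ β * x)
      (dζ (β + x) - dζ β) (uIcc 0 τ) x := by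
    intro x _
    have h1 : HasDerivAt (fun x : ℝ => ζ (β + x)) (dζ (β + x)) x :=
      (h.hasDerivAt (β + x)).comp_const_add β x
    have h2 : HasDerivAt (fun x : ℝ => dζ β * (x : ℂ)) (dζ β) x := by
      simpa using (Complex.ofRealCLM.hasDerivAt (x := x)).const_mul (dζ β)
    exact (h1.sub h2).hasDerivWithinAt
  have := (convex_uIcc (0 : ℝ) τ).norm_image_sub_le_of_norm_hasDerivWithin_le hd
    (C := M * |τ|) (fun x hx => (h.norm_deriv_sub_le hM β x).trans (by
      have : |x| ≤ |τ| := by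
        rcases le_total 0 τ with h0 | h0
        · rw [uIcc_of_le h0] at hx
          rw [abs_of_nonneg hx.1, abs_of_nonneg h0]; exact hx.2
        · rw [uIcc_of_ge h0] at hx
          rw [abs_of_nonpos hx.2, abs_of_nonpos h0]; linarith [hx.1]
      gcongr)) left_mem_uIcc right_mem_uIcc
  simp only [Complex.ofReal_zero, mul_zero, add_zero, sub_zero, Real.norm_eq_abs] at this
  calc _ = ‖ζ (β + τ) - dζ β * τ - ζ β‖ := by congr 1; ring
    _ ≤ M * |τ| * |τ| := this
    _ = M * τ ^ 2 := by rw [mul_assoc, abs_mul_abs_self]; ring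

theorem exists_chord_bound {τ₀ : ℝ} (hτ₀ : 0 < τ₀) :
    ∃ c : ℝ, 0 < c ∧ ∀ β τ : ℝ, τ₀ ≤ |τ| → c * |τ| ≤ ‖ζ (β + τ) - ζ β‖ := by
  obtain ⟨B, hB, hB'⟩ := h.exists_norm_sub_id_le
  have hK : IsCompact (Icc 0 (2 * Real.pi) ×ˢ (Icc (-(4 * B)) (4 * B) ∩ {τ : ℝ | τ₀ ≤ |τ|})) :=
    isCompact_Icc.prod (isCompact_Icc.inter_right (isClosed_le continuous_const continuous_abs))
  obtain ⟨m, hm, hm'⟩ := hK.exists_forall_le'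
    (f := fun p : ℝ × ℝ => ‖ζ (p.1 + p.2) - ζ p.1‖)
    (((h.continuous.comp (continuous_fst.add continuous_snd)).sub
      (h.continuous.comp continuous_fst)).norm.continuousOn) (a := 0) (by
      rintro ⟨β, τ⟩ ⟨-, -, hτ⟩
      refine norm_pos_iff.2 (sub_ne_zero.2 fun e => ?_)
      have := h.injective e
      have h0 : τ = 0 := by simpa using this
      rw [mem_ofPred_eq, h0, abs_zero] at hτ
      linarith)
  refine ⟨min (1 / 2) (m / (4 * B)), by positivity, fun β τ hτ => ?_⟩
  rcases le_total |τ| (4 * B) with h1 | h1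
  · have hp : Function.Periodic (fun β => ζ (β + τ) - ζ β) (2 * Real.pi) := by
      intro β
      simp only [show β + 2 * Real.pi + τ = β + τ + 2 * Real.pi by ring, h.add_two_pi]
      ring
    obtain ⟨y, hy, e⟩ := hp.exists_mem_Ico₀ Real.two_pi_pos β
    rw [e]
    have := hm' (y, τ) ⟨Ico_subset_Icc_self hy, abs_le.1 h1, hτ⟩
    calc _ ≤ m / (4 * B) * (4 * B) := by gcongr; exact min_le_right _ _
      _ = m := by field_simp
      _ ≤ _ := this
  · have h2 := hB' (β + τ)
    have h3 := hB' β
    have h4 : |τ| ≤ ‖ζ (β + τ) - ζ β‖ + (B + B) := by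
      have : (τ : ℂ) = (ζ (β + τ) - ζ β) - ((ζ (β + τ) - (β + τ : ℝ)) - (ζ β - β)) := by
        push_cast; ring
      calc |τ| = ‖(τ : ℂ)‖ := (Complex.norm_real τ).symm
        _ ≤ _ := by
          rw [this]
          exact (norm_sub_le _ _).trans (by gcongr; exact (norm_sub_le _ _).trans (by gcongr))
    have h5 : min (1 / 2) (m / (4 * B)) * |τ| ≤ 1 / 2 * |τ| := by
      gcongr; exact min_le_left _ _
    linarith

/-- Points displaced from the curve in the normal direction at `ζ β` stay away from the curve. -/
theorem exists_tube : ∃ δ c : ℝ, 0 < δ ∧ 0 < c ∧ ∀ β τ s : ℝ, |s| ≤ δ →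
    c * |τ| ≤ ‖ζ (β + τ) - ζ β - Complex.I * s * dζ β‖ := by
  obtain ⟨M, hM, hM'⟩ := h.exists_deriv2_bound
  obtain ⟨M₁, hM₁, hM₁'⟩ := h.exists_deriv_bound
  obtain ⟨m, hm, hm'⟩ := h.exists_le_norm_deriv
  obtain ⟨c, hc, hc'⟩ := h.exists_chord_bound (τ₀ := m / (2 * M)) (by positivity)
  refine ⟨c * (m / (2 * M)) / (2 * M₁), min (m / 2) (c / 2), by positivity, by positivity,
    fun β τ s hs => ?_⟩
  rcases le_total |τ| (m / (2 * M)) with h1 | h1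
  · have h2 := h.norm_sub_linear_le hM' β τ
    have h3 : dζ β * (τ - Complex.I * s) = (ζ (β + τ) - ζ β - Complex.I * s * dζ β) -
        (ζ (β + τ) - ζ β - dζ β * τ) := by ring
    have h4 : |τ| ≤ ‖(τ : ℂ) - Complex.I * s‖ := by
      have := Complex.abs_re_le_norm ((τ : ℂ) - Complex.I * s)
      simpa using this
    have h5 : m * |τ| ≤ ‖dζ β * (τ - Complex.I * s)‖ := by
      rw [norm_mul]
      gcongr
      exact hm' β
    rw [h3] at h5
    have h6 := h5.trans (norm_sub_le _ _)
    have h7 : M * τ ^ 2 ≤ m / 2 * |τ| := by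
      rw [← sq_abs]
      calc M * |τ| ^ 2 = M * |τ| * |τ| := by ring
        _ ≤ M * (m / (2 * M)) * |τ| := by gcongr
        _ = m / 2 * |τ| := by field_simp
    have h8 : min (m / 2) (c / 2) * |τ| ≤ m / 2 * |τ| := by gcongr; exact min_le_left _ _
    linarith
  · have h2 := hc' β τ h1
    have h3 : ‖Complex.I * s * dζ β‖ ≤ c / 2 * |τ| := by
      rw [norm_mul, norm_mul, Complex.norm_I, one_mul, Complex.norm_real, Real.norm_eq_abs]
      calc |s| * ‖dζ β‖ ≤ c * (m / (2 * M)) / (2 * M₁) * M₁ := by gcongr; exact hM₁' β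
        _ = c / 2 * (m / (2 * M)) := by field_simp
        _ ≤ c / 2 * |τ| := by gcongr
    have h4 := norm_sub_norm_le (ζ (β + τ) - ζ β) (Complex.I * s * dζ β)
    have h5 : min (m / 2) (c / 2) * |τ| ≤ c / 2 * |τ| := by gcongr; exact min_le_right _ _
    linarith

end PeriodicCurve

theorem ne_int_mul_two_pi {τ : ℝ} (h1 : |τ| ≤ Real.pi) {n : ℤ} (hn : n ≠ 0) :
    τ ≠ 2 * Real.pi * n := by
  rintro rfl
  rw [abs_mul, abs_of_pos Real.two_pi_pos] at h1
  have : (1 : ℝ) ≤ |(n : ℝ)| := by exact_mod_cast Int.one_le_abs hn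
  nlinarith [Real.pi_pos]

theorem integral_inv_sub_I_mul {s : ℝ} (hs : s ≠ 0) :
    ∫ τ in -Real.pi..Real.pi, ((τ : ℂ) - Complex.I * s)⁻¹ =
      Complex.log (Real.pi - Complex.I * s) - Complex.log (-Real.pi - Complex.I * s) := by
  have him : ∀ τ : ℝ, ((τ : ℂ) - Complex.I * s).im ≠ 0 := fun τ => by simpa using hs
  have hne : ∀ τ : ℝ, (τ : ℂ) - Complex.I * s ≠ 0 := fun τ e => him τ (by rw [e]; rfl)
  have hd : ∀ τ ∈ uIcc (-Real.pi) Real.pi, HasDerivAt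
      (fun τ : ℝ => Complex.log ((τ : ℂ) - Complex.I * s)) ((τ : ℂ) - Complex.I * s)⁻¹ τ := by
    intro τ _
    have h1 : HasDerivAt (fun τ : ℝ => (τ : ℂ) - Complex.I * s) 1 τ :=
      (Complex.ofRealCLM.hasDerivAt (x := τ)).sub_const _
    simpa using h1.clog_real (Or.inr (him τ))
  rw [intervalIntegral.integral_eq_sub_of_hasDerivAt hd]
  · push_cast; rfl
  · refine Continuous.intervalIntegrable ?_ _ _
    exact Continuous.inv₀ (by fun_prop) hne

theorem tendsto_log_pi_sub (l : Filter ℝ) (hl : l ≤ 𝓝 0) :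
    Tendsto (fun s : ℝ => Complex.log (Real.pi - Complex.I * s)) l (𝓝 (Real.log Real.pi)) := by
  have h1 : Tendsto (fun s : ℝ => (Real.pi : ℂ) - Complex.I * s) (𝓝 0) (𝓝 (Real.pi : ℂ)) := by
    have : Continuous fun s : ℝ => (Real.pi : ℂ) - Complex.I * s := by fun_prop
    simpa using this.tendsto 0
  have h2 := (continuousAt_clog (x := (Real.pi : ℂ)) (Or.inl (by simpa using Real.pi_pos))).tendsto
  rw [Complex.ofReal_log Real.pi_pos.le]
  exact (h2.comp h1).mono_left hl

theorem tendsto_neg_pi_sub (l : Filter ℝ) (hl : l ≤ 𝓝 0) :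
    Tendsto (fun s : ℝ => -(Real.pi : ℂ) - Complex.I * s) l (𝓝 (-Real.pi : ℂ)) := by
  have : Continuous fun s : ℝ => -(Real.pi : ℂ) - Complex.I * s := by fun_prop
  simpa using (this.tendsto 0).mono_left hl

theorem tendsto_integral_inv_sub_right :
    Tendsto (fun s : ℝ => ∫ τ in -Real.pi..Real.pi, ((τ : ℂ) - Complex.I * s)⁻¹) (𝓝[>] 0)
      (𝓝 (Real.pi * Complex.I)) := by
  have h1 : Tendsto (fun s : ℝ => Complex.log (-Real.pi - Complex.I * s)) (𝓝[>] 0)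
      (𝓝 (Real.log ‖(-Real.pi : ℂ)‖ - Real.pi * Complex.I)) := by
    refine (Complex.tendsto_log_nhdsWithin_im_neg_of_re_neg_of_im_zero
      (by simpa using Real.pi_pos) (by simp)).comp ?_
    refine tendsto_nhdsWithin_iff.2 ⟨tendsto_neg_pi_sub _ nhdsWithin_le_nhds, ?_⟩
    filter_upwards [self_mem_nhdsWithin] with s hs
    simpa using hs
  have h2 := (tendsto_log_pi_sub (𝓝[>] 0) nhdsWithin_le_nhds).sub h1
  have h3 : ‖(-Real.pi : ℂ)‖ = Real.pi := by
    rw [norm_neg, Complex.norm_real, Real.norm_of_nonneg Real.pi_pos.le]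
  rw [h3, sub_sub_cancel] at h2
  refine h2.congr' ?_
  filter_upwards [self_mem_nhdsWithin] with s hs
  exact (integral_inv_sub_I_mul (ne_of_gt hs)).symm

theorem tendsto_integral_inv_sub_left :
    Tendsto (fun s : ℝ => ∫ τ in -Real.pi..Real.pi, ((τ : ℂ) - Complex.I * s)⁻¹) (𝓝[<] 0)
      (𝓝 (-(Real.pi * Complex.I))) := by
  have h1 : Tendsto (fun s : ℝ => Complex.log (-Real.pi - Complex.I * s)) (𝓝[<] 0)
      (𝓝 (Real.log ‖(-Real.pi : ℂ)‖ + Real.pi * Complex.I)) := by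
    refine (Complex.tendsto_log_nhdsWithin_im_nonneg_of_re_neg_of_im_zero
      (by simpa using Real.pi_pos) (by simp)).comp ?_
    refine tendsto_nhdsWithin_iff.2 ⟨tendsto_neg_pi_sub _ nhdsWithin_le_nhds, ?_⟩
    filter_upwards [self_mem_nhdsWithin] with s hs
    simpa using le_of_lt (mem_Iio.1 hs)
  have h2 := (tendsto_log_pi_sub (𝓝[<] 0) nhdsWithin_le_nhds).sub h1
  have h3 : ‖(-Real.pi : ℂ)‖ = Real.pi := by
    rw [norm_neg, Complex.norm_real, Real.norm_of_nonneg Real.pi_pos.le]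
  rw [h3, sub_add_cancel_left] at h2
  refine h2.congr' ?_
  filter_upwards [self_mem_nhdsWithin] with s hs
  exact (integral_inv_sub_I_mul (ne_of_lt hs)).symm

/-- The chord from the point displaced from `ζ α` by `s` in the normal direction. -/
noncomputable def chord (ζ dζ : ℝ → ℂ) (α s τ : ℝ) : ℂ :=
  ζ (α + τ) - ζ α - Complex.I * s * dζ α

/-- The desingularized integrand of the periodic Cauchy integral. -/
noncomputable def desingularized (ζ dζ f : ℝ → ℂ) (α s τ : ℝ) : ℂ :=
  f (α + τ) * cotKernel (chord ζ dζ α s τ) - f α / dζ α * ((τ : ℂ) - Complex.I * s)⁻¹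

/-- The finite part of the periodic Cauchy integral. -/
noncomputable def finitePart (ζ dζ f : ℝ → ℂ) (α : ℝ) : ℂ :=
  ∫ τ in -Real.pi..Real.pi, desingularized ζ dζ f α 0 τ

theorem aestronglyMeasurable_of_continuousOn_diff {g : ℝ → ℂ} {a b : ℝ}
    (hg : ContinuousOn g (Ioc a b \ {0})) :
    AEStronglyMeasurable g (volume.restrict (Ioc a b)) := by
  have h1 : (Ioc a b \ {0} : Set ℝ) =ᵐ[volume] Ioc a b :=
    sdiff_null_ae_eq_self (by simp)
  rw [← Measure.restrict_congr_set h1]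
  exact hg.aestronglyMeasurable (measurableSet_Ioc.diff (measurableSet_singleton 0))

theorem tendsto_truncated_of_intervalIntegrable {g : ℝ → ℂ} {a : ℝ} (ha : 0 < a)
    (hint : IntervalIntegrable g volume (-a) a) :
    Tendsto (fun ε => (∫ τ in -a..-ε, g τ) + ∫ τ in ε..a, g τ) (𝓝[>] 0)
      (𝓝 (∫ τ in -a..a, g τ)) := by
  have hprim := intervalIntegral.continuousOn_primitive_interval' hint left_mem_uIcc
  have hct : ContinuousAt (fun x => ∫ τ in -a..x, g τ) 0 :=
    hprim.continuousAt (by rw [uIcc_of_le (by linarith)]; exact Icc_mem_nhds (by linarith) ha)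
  have hneg : Tendsto (fun ε : ℝ => -ε) (𝓝[>] 0) (𝓝 0) := by
    simpa using (continuous_neg.tendsto (0 : ℝ)).mono_left nhdsWithin_le_nhds
  have hlim := ((hct.tendsto.comp hneg).add (tendsto_const_nhds (x := ∫ τ in -a..a, g τ))).sub
    (hct.tendsto.mono_left (nhdsWithin_le_nhds (s := Ioi (0 : ℝ))))
  rw [add_sub_cancel_left] at hlim
  refine hlim.congr' ?_
  filter_upwards [Ioo_mem_nhdsGT ha] with ε hε
  have hsub : ∀ {b : ℝ}, b ∈ Icc (-a) a → IntervalIntegrable g volume (-a) b := fun hb =>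
    hint.mono_set (by
      rw [uIcc_of_le (a := -a) (b := a) (by linarith)]
      exact uIcc_subset_Icc ⟨le_rfl, by linarith⟩ hb)
  rw [Function.comp_apply, add_sub_assoc, intervalIntegral.integral_interval_sub_left
    (hsub ⟨by linarith, le_rfl⟩) (hsub ⟨by linarith [hε.1], hε.2.le⟩)]

theorem inv_sub_I_mul_norm_le (τ s : ℝ) : |τ| ≤ ‖(τ : ℂ) - Complex.I * s‖ := by
  have := Complex.abs_re_le_norm ((τ : ℂ) - Complex.I * s)
  simpa using this

namespace PeriodicCurve

variable {ζ dζ ddζ : ℝ → ℂ} (h : PeriodicCurve ζ dζ ddζ)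
include h

theorem chord_add_int (α s τ : ℝ) (n : ℤ) :
    chord ζ dζ α s (τ + 2 * Real.pi * n) = chord ζ dζ α s τ + 2 * Real.pi * n := by
  rw [chord, ← add_assoc, h.add_int_mul_two_pi, chord]
  ring

theorem continuous_chord (α : ℝ) : Continuous fun p : ℝ × ℝ => chord ζ dζ α p.1 p.2 := by
  have := h.continuous
  unfold chord
  fun_prop

theorem exists_chord_tube : ∃ δ c : ℝ, 0 < δ ∧ 0 < c ∧
    (∀ α τ s : ℝ, |s| ≤ δ → c * |τ| ≤ ‖chord ζ dζ α s τ‖) ∧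
    (∀ α τ s : ℝ, |s| ≤ δ → |τ| ≤ Real.pi → chord ζ dζ α s τ ∈ cotRemDomain) ∧
    (∀ α τ s : ℝ, |s| ≤ δ → |τ| ≤ Real.pi → τ ≠ 0 → chord ζ dζ α s τ ∈ cotDomain) ∧
    (∀ α τ s : ℝ, |s| ≤ δ → s ≠ 0 → chord ζ dζ α s τ ∈ cotDomain) := by
  obtain ⟨δ, c, hδ, hc, H⟩ := h.exists_tube
  have key : ∀ α τ s : ℝ, |s| ≤ δ → ∀ n : ℤ, τ ≠ 2 * Real.pi * n →
      chord ζ dζ α s τ ≠ 2 * Real.pi * n := by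
    intro α τ s hs n hn e
    have h1 := h.chord_add_int α s τ (-n)
    rw [e] at h1
    push_cast at h1
    have h1 : chord ζ dζ α s (τ + 2 * Real.pi * -n) = 0 := by rw [h1]; ring
    have h2 := H α (τ + 2 * Real.pi * -n) s hs
    rw [← chord, h1, norm_zero] at h2
    have h3 : 0 < |τ + 2 * Real.pi * -n| := abs_pos.2 fun e => hn (by linarith)
    nlinarith
  refine ⟨δ, c, hδ, hc, fun α τ s hs => H α τ s hs, fun α τ s hs hτ n hn => ?_,
    fun α τ s hs hτ h0 n => ?_, fun α τ s hs h0 n => ?_⟩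
  · exact key α τ s hs n (ne_int_mul_two_pi hτ hn)
  · refine key α τ s hs n ?_
    by_cases hn : n = 0
    · simpa [hn] using h0
    · exact ne_int_mul_two_pi hτ hn
  · by_cases hn : τ = 2 * Real.pi * n
    · intro e
      have h1 := h.chord_add_int α s 0 n
      rw [zero_add, ← hn, e] at h1
      have h2 : chord ζ dζ α s 0 = 0 := by linear_combination -h1
      rw [chord, add_zero, sub_self, zero_sub, neg_eq_zero] at h2
      simp [h0, h.deriv_ne_zero] at h2
    · exact key α τ s hs n hn

/-- The desingularized integrand is bounded uniformly in the displacement. -/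
theorem exists_desingularized_bound {f : ℝ → ℂ} (hf : Continuous f) {α K : ℝ}
    (hK : ∀ τ : ℝ, |τ| ≤ Real.pi → ‖f (α + τ) - f α‖ ≤ K * |τ|) :
    ∃ δ C : ℝ, 0 < δ ∧ ∀ s τ : ℝ, |s| ≤ δ → |τ| ≤ Real.pi → τ ≠ 0 →
      ‖desingularized ζ dζ f α s τ‖ ≤ C := by
  obtain ⟨δ, c, hδ, hc, h1, h2, h3, -⟩ := h.exists_chord_tube
  obtain ⟨M, hM, hM'⟩ := h.exists_deriv2_bound
  have hcpt : IsCompact (Icc (-δ) δ ×ˢ Icc (-Real.pi) Real.pi) := isCompact_Icc.prod isCompact_Icc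
  have himg := hcpt.image (h.continuous_chord α)
  have hrem : ContinuousOn (fun p : ℝ × ℝ => f (α + p.2) * cotKernelRem (chord ζ dζ α p.1 p.2))
      (Icc (-δ) δ ×ˢ Icc (-Real.pi) Real.pi) := by
    refine ContinuousOn.mul (by fun_prop) ?_
    refine (continuousOn_cotKernelRem himg.isBounded ?_).comp
      (h.continuous_chord α).continuousOn (mapsTo_image _ _)
    rintro _ ⟨⟨s, τ⟩, ⟨hs, hτ⟩, rfl⟩
    exact h2 α τ s (abs_le.2 hs) (abs_le.2 hτ)
  obtain ⟨C₁, hC₁⟩ := hcpt.exists_bound_of_continuousOn hrem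
  have hd := norm_pos_iff.2 (h.deriv_ne_zero α)
  refine ⟨δ, C₁ + (K / c + ‖f α‖ * M / (c * ‖dζ α‖)), hδ, fun s τ hs hτ hτ0 => ?_⟩
  have hx := h1 α τ s hs
  have hτ1 : 0 < |τ| := abs_pos.2 hτ0
  have hx1 : 0 < ‖chord ζ dζ α s τ‖ := lt_of_lt_of_le (by positivity) hx
  have hx0 : chord ζ dζ α s τ ≠ 0 := norm_pos_iff.1 hx1
  have hy := inv_sub_I_mul_norm_le τ s
  have hy1 : 0 < ‖(τ : ℂ) - Complex.I * s‖ := lt_of_lt_of_le hτ1 hy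
  have hy0 := norm_pos_iff.1 hy1
  have hd0 := h.deriv_ne_zero α
  have e : desingularized ζ dζ f α s τ =
      f (α + τ) * cotKernelRem (chord ζ dζ α s τ) + ((f (α + τ) - f α) / chord ζ dζ α s τ +
      f α * (-(ζ (α + τ) - ζ α - dζ α * τ)) /
        (chord ζ dζ α s τ * (dζ α * ((τ : ℂ) - Complex.I * s)))) := by
    have e1 : -(ζ (α + τ) - ζ α - dζ α * τ) =
      dζ α * ((τ : ℂ) - Complex.I * s) - chord ζ dζ α s τ := by rw [chord]; ring
    rw [e1, desingularized, cotKernel_eq _ (h3 α τ s hs hτ hτ0)]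
    field_simp
    ring
  rw [e]
  refine (norm_add_le _ _).trans (add_le_add ?_ ((norm_add_le _ _).trans (add_le_add ?_ ?_)))
  · exact hC₁ (s, τ) ⟨abs_le.1 hs, abs_le.1 hτ⟩
  · have hK0 : 0 ≤ K := by
      have := (norm_nonneg _).trans (hK τ hτ)
      exact nonneg_of_mul_nonneg_left this hτ1
    rw [norm_div]
    calc _ ≤ K * |τ| / (c * |τ|) := by gcongr; exact hK τ hτ
      _ = K / c := by field_simp
  · rw [norm_div, norm_mul, norm_neg, norm_mul, norm_mul]
    have := h.norm_sub_linear_le hM' α τ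
    calc _ ≤ ‖f α‖ * (M * τ ^ 2) / (c * |τ| * (‖dζ α‖ * |τ|)) := by gcongr
      _ = ‖f α‖ * M / (c * ‖dζ α‖) := by
        rw [← sq_abs τ]
        field_simp

theorem continuousOn_desingularized {f : ℝ → ℂ} (hf : Continuous f) {α s : ℝ} {S : Set ℝ}
    (hS : ∀ τ ∈ S, chord ζ dζ α s τ ∈ cotDomain) (h0 : ∀ τ ∈ S, τ ≠ 0) :
    ContinuousOn (desingularized ζ dζ f α s) S := by
  unfold desingularized
  refine ContinuousOn.sub (ContinuousOn.mul (by fun_prop) ?_) (continuousOn_const.mul ?_)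
  · refine continuousOn_cotKernel.comp ?_ hS
    exact ((h.continuous_chord α).comp (by fun_prop : Continuous fun τ : ℝ => (s, τ))).continuousOn
  · refine ContinuousOn.inv₀ (by fun_prop) fun τ hτ => ?_
    exact norm_pos_iff.1 (lt_of_lt_of_le (abs_pos.2 (h0 τ hτ)) (inv_sub_I_mul_norm_le τ s))

theorem tendsto_integral_desingularized {f : ℝ → ℂ} (hf : Continuous f) {α K : ℝ}
    (hK : ∀ τ : ℝ, |τ| ≤ Real.pi → ‖f (α + τ) - f α‖ ≤ K * |τ|) :
    Tendsto (fun s => ∫ τ in -Real.pi..Real.pi, desingularized ζ dζ f α s τ) (𝓝 0)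
      (𝓝 (finitePart ζ dζ f α)) := by
  obtain ⟨δ, C, hδ, hC⟩ := h.exists_desingularized_bound hf hK
  obtain ⟨δ', c, hδ', hc, h1, h2, h3, -⟩ := h.exists_chord_tube
  have hIoc : uIoc (-Real.pi) Real.pi = Ioc (-Real.pi) Real.pi :=
    uIoc_of_le (by linarith [Real.pi_pos])
  have hne : ∀ᵐ τ : ℝ, τ ≠ 0 := by simp [ae_iff]
  have habs : ∀ τ ∈ Ioc (-Real.pi) Real.pi, |τ| ≤ Real.pi := fun τ hτ => abs_le.2 ⟨hτ.1.le, hτ.2⟩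
  have hsmall : ∀ {d : ℝ}, 0 < d → ∀ᶠ s : ℝ in 𝓝 0, |s| ≤ d := by
    intro d hd
    filter_upwards [Metric.closedBall_mem_nhds (0 : ℝ) hd] with s hs
    simpa using hs
  refine intervalIntegral.tendsto_integral_filter_of_dominated_convergence (fun _ => C) ?_ ?_
    (by simp) ?_
  · filter_upwards [hsmall hδ'] with s hs
    rw [hIoc]
    refine aestronglyMeasurable_of_continuousOn_diff (h.continuousOn_desingularized hf ?_ ?_)
    · exact fun τ hτ => h3 α τ s hs (habs τ hτ.1) hτ.2
    · exact fun τ hτ => hτ.2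
  · filter_upwards [hsmall hδ] with s hs
    filter_upwards [hne] with τ hτ hτ'
    exact hC s τ hs (habs τ (hIoc ▸ hτ')) hτ
  · filter_upwards [hne] with τ hτ hτ'
    have hmem := h3 α τ 0 (by simpa using hδ'.le) (habs τ (hIoc ▸ hτ')) hτ
    have hk : ContinuousAt cotKernel (chord ζ dζ α 0 τ) :=
      continuousOn_cotKernel.continuousAt (isOpen_cotDomain.mem_nhds hmem)
    have hch : ContinuousAt (fun s => chord ζ dζ α s τ) 0 :=
      ((h.continuous_chord α).comp (by fun_prop : Continuous fun s : ℝ => (s, τ))).continuousAt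
    have hinv : ContinuousAt (fun s : ℝ => ((τ : ℂ) - Complex.I * s)⁻¹) 0 := by
      refine ContinuousAt.inv₀ (by fun_prop) ?_
      exact norm_pos_iff.1 (lt_of_lt_of_le (abs_pos.2 hτ) (inv_sub_I_mul_norm_le τ 0))
    exact ((continuousAt_const.mul (ContinuousAt.comp (f := fun s => chord ζ dζ α s τ) hk hch)).sub
      (continuousAt_const.mul hinv)).tendsto

theorem tendsto_cauchyIntegral {f : ℝ → ℂ} (hf : Continuous f) {α K : ℝ}
    (hK : ∀ τ : ℝ, |τ| ≤ Real.pi → ‖f (α + τ) - f α‖ ≤ K * |τ|) {l : Filter ℝ}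
    (hl : l ≤ 𝓝[≠] 0) {v : ℂ}
    (hv : Tendsto (fun s : ℝ => ∫ τ in -Real.pi..Real.pi, ((τ : ℂ) - Complex.I * s)⁻¹) l (𝓝 v)) :
    Tendsto (fun s => ∫ τ in -Real.pi..Real.pi, f (α + τ) * cotKernel (chord ζ dζ α s τ)) l
      (𝓝 (finitePart ζ dζ f α + f α / dζ α * v)) := by
  obtain ⟨δ, c, hδ, hc, -, -, -, h4⟩ := h.exists_chord_tube
  have hsmall : ∀ᶠ s : ℝ in l, |s| ≤ δ ∧ s ≠ 0 := by
    refine hl ?_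
    filter_upwards [nhdsWithin_le_nhds (Metric.closedBall_mem_nhds (0 : ℝ) hδ),
      self_mem_nhdsWithin] with s hs hs'
    exact ⟨by simpa using hs, hs'⟩
  refine (((h.tendsto_integral_desingularized hf hK).mono_left
    (hl.trans nhdsWithin_le_nhds)).add (hv.const_mul (f α / dζ α))).congr' ?_
  filter_upwards [hsmall] with s ⟨hs, hs0⟩
  have hi1 : Continuous fun τ => f (α + τ) * cotKernel (chord ζ dζ α s τ) := by
    refine Continuous.mul (by fun_prop) ?_
    exact continuousOn_cotKernel.comp_continuous
      ((h.continuous_chord α).comp (by fun_prop : Continuous fun τ : ℝ => (s, τ)))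
      fun τ => h4 α τ s hs hs0
  have hi2 : Continuous fun τ : ℝ => f α / dζ α * ((τ : ℂ) - Complex.I * s)⁻¹ := by
    refine continuous_const.mul (Continuous.inv₀ (by fun_prop) fun τ e => ?_)
    have := congrArg Complex.im e
    simp [hs0] at this
  unfold desingularized
  rw [intervalIntegral.integral_sub (hi1.intervalIntegrable _ _) (hi2.intervalIntegrable _ _),
    intervalIntegral.integral_const_mul]
  ring

theorem intervalIntegrable_desingularized {f : ℝ → ℂ} (hf : Continuous f) {α K : ℝ}
    (hK : ∀ τ : ℝ, |τ| ≤ Real.pi → ‖f (α + τ) - f α‖ ≤ K * |τ|) :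
    IntervalIntegrable (desingularized ζ dζ f α 0) volume (-Real.pi) Real.pi := by
  obtain ⟨δ, C, hδ, hC⟩ := h.exists_desingularized_bound hf hK
  obtain ⟨δ', c, hδ', hc, h1, h2, h3, -⟩ := h.exists_chord_tube
  have hpi : -Real.pi ≤ Real.pi := by linarith [Real.pi_pos]
  have habs : ∀ τ ∈ Ioc (-Real.pi) Real.pi, |τ| ≤ Real.pi := fun τ hτ => abs_le.2 ⟨hτ.1.le, hτ.2⟩
  have hne : ∀ᵐ τ : ℝ, τ ≠ 0 := by simp [ae_iff]
  rw [intervalIntegrable_iff_integrableOn_Ioc_of_le hpi]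
  refine Integrable.of_bound (C := C) ?_ ?_
  · refine aestronglyMeasurable_of_continuousOn_diff (h.continuousOn_desingularized hf ?_ ?_)
    · exact fun τ hτ => h3 α τ 0 (by simpa using hδ'.le) (habs τ hτ.1) hτ.2
    · exact fun τ hτ => hτ.2
  · filter_upwards [ae_restrict_of_ae hne, ae_restrict_mem measurableSet_Ioc] with τ hτ hτ'
    exact hC 0 τ (by simpa using hδ.le) (habs τ hτ') hτ

theorem tendsto_truncated_cotKernel {f : ℝ → ℂ} (hf : Continuous f) {α K : ℝ}
    (hK : ∀ τ : ℝ, |τ| ≤ Real.pi → ‖f (α + τ) - f α‖ ≤ K * |τ|) :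
    Tendsto (fun ε => (∫ τ in -Real.pi..-ε, f (α + τ) * cotKernel (chord ζ dζ α 0 τ)) +
      ∫ τ in ε..Real.pi, f (α + τ) * cotKernel (chord ζ dζ α 0 τ)) (𝓝[>] 0)
      (𝓝 (finitePart ζ dζ f α)) := by
  obtain ⟨δ', c, hδ', hc, h1, h2, h3, -⟩ := h.exists_chord_tube
  have hpi := Real.pi_pos
  have hint := h.intervalIntegrable_desingularized hf hK
  set g := desingularized ζ dζ f α 0 with hg
  refine (tendsto_truncated_of_intervalIntegrable hpi hint).congr' ?_
  filter_upwards [Ioo_mem_nhdsGT hpi] with ε hε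
  have hm1 : -Real.pi ∈ Icc (-Real.pi) Real.pi := ⟨le_rfl, by linarith⟩
  have hm2 : Real.pi ∈ Icc (-Real.pi) Real.pi := ⟨by linarith, le_rfl⟩
  have hm3 : ε ∈ Icc (-Real.pi) Real.pi := ⟨by linarith [hε.1], hε.2.le⟩
  have hm4 : -ε ∈ Icc (-Real.pi) Real.pi := ⟨by linarith [hε.2], by linarith [hε.1]⟩
  have hk : ∀ {a b : ℝ}, a ∈ Icc (-Real.pi) Real.pi → b ∈ Icc (-Real.pi) Real.pi →
      (0 : ℝ) ∉ uIcc a b → IntervalIntegrable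
        (fun τ => f (α + τ) * cotKernel (chord ζ dζ α 0 τ)) volume a b := by
    intro a b ha hb h0
    refine ContinuousOn.intervalIntegrable (ContinuousOn.mul (by fun_prop) ?_)
    refine continuousOn_cotKernel.comp ((h.continuous_chord α).comp
      (by fun_prop : Continuous fun τ : ℝ => ((0 : ℝ), τ))).continuousOn fun τ hτ => ?_
    refine h3 α τ 0 (by simpa using hδ'.le) (abs_le.2 ((uIcc_subset_Icc ha hb) hτ)) ?_
    rintro rfl
    exact h0 hτ
  have hi : ∀ {a b : ℝ}, (0 : ℝ) ∉ uIcc a b → IntervalIntegrable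
        (fun τ : ℝ => f α / dζ α * ((τ : ℂ) - Complex.I * (0 : ℝ))⁻¹) volume a b := by
    intro a b h0
    refine ContinuousOn.intervalIntegrable (continuousOn_const.mul
      (ContinuousOn.inv₀ (by fun_prop) fun τ hτ => ?_))
    refine norm_pos_iff.1 (lt_of_lt_of_le (abs_pos.2 ?_) (inv_sub_I_mul_norm_le τ 0))
    rintro rfl
    exact h0 hτ
  have hn1 : (0 : ℝ) ∉ uIcc (-Real.pi) (-ε) := by
    rw [uIcc_of_le (by linarith [hε.2])]
    exact fun hx => by linarith [hx.2, hε.1]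
  have hn2 : (0 : ℝ) ∉ uIcc ε Real.pi := by
    rw [uIcc_of_le hε.2.le]
    exact fun hx => by linarith [hx.1, hε.1]
  have hodd : (∫ τ in -Real.pi..-ε, f α / dζ α * ((τ : ℂ) - Complex.I * (0 : ℝ))⁻¹) =
      -∫ τ in ε..Real.pi, f α / dζ α * ((τ : ℂ) - Complex.I * (0 : ℝ))⁻¹ := by
    rw [← intervalIntegral.integral_neg, ← intervalIntegral.integral_comp_neg]
    refine intervalIntegral.integral_congr fun τ _ => ?_
    simp [inv_neg]
  simp only [hg, desingularized]
  rw [intervalIntegral.integral_sub (hk hm1 hm4 hn1) (hi hn1),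
    intervalIntegral.integral_sub (hk hm3 hm2 hn2) (hi hn2), hodd]
  ring

/-- The principal value at the origin of the Cauchy integral over one period. -/
theorem tendsto_truncated_inv {f : ℝ → ℂ} (hf : Continuous f) {α K : ℝ}
    (hK : ∀ τ : ℝ, |τ| ≤ Real.pi → ‖f (α + τ) - f α‖ ≤ K * |τ|) :
    Tendsto (fun ε => (∫ τ in -Real.pi..-ε, f (α + τ) / (ζ (α + τ) - ζ α)) +
      ∫ τ in ε..Real.pi, f (α + τ) / (ζ (α + τ) - ζ α)) (𝓝[>] 0)
      (𝓝 (finitePart ζ dζ f α -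
        ∫ τ in -Real.pi..Real.pi, f (α + τ) * cotKernelRem (ζ (α + τ) - ζ α))) := by
  obtain ⟨δ', c, hδ', hc, h1, h2, h3, -⟩ := h.exists_chord_tube
  have hpi := Real.pi_pos
  have hch : ∀ τ, chord ζ dζ α 0 τ = ζ (α + τ) - ζ α := fun τ => by simp [chord]
  have hcont : Continuous fun τ => ζ (α + τ) - ζ α := by
    have := h.continuous
    fun_prop
  set g : ℝ → ℂ := fun τ => f (α + τ) * cotKernelRem (ζ (α + τ) - ζ α) with hg
  have hgc : ContinuousOn g (Icc (-Real.pi) Real.pi) := by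
    refine ContinuousOn.mul (by fun_prop) ?_
    refine (continuousOn_cotKernelRem (isCompact_Icc.image hcont).isBounded ?_).comp
      hcont.continuousOn (mapsTo_image _ _)
    rintro _ ⟨τ, hτ, rfl⟩
    simp only [← hch]
    exact h2 α τ 0 (by simpa using hδ'.le) (abs_le.2 hτ)
  have hsub : ∀ {a b : ℝ}, a ∈ Icc (-Real.pi) Real.pi → b ∈ Icc (-Real.pi) Real.pi →
      IntervalIntegrable g volume a b := fun ha hb =>
    (hgc.mono (uIcc_subset_Icc ha hb)).intervalIntegrable
  have hm1 : -Real.pi ∈ Icc (-Real.pi) Real.pi := ⟨le_rfl, by linarith⟩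
  have hm2 : Real.pi ∈ Icc (-Real.pi) Real.pi := ⟨by linarith, le_rfl⟩
  refine ((h.tendsto_truncated_cotKernel hf hK).sub
    (tendsto_truncated_of_intervalIntegrable hpi (hsub hm1 hm2))).congr' ?_
  filter_upwards [Ioo_mem_nhdsGT hpi] with ε hε
  have hm3 : ε ∈ Icc (-Real.pi) Real.pi := ⟨by linarith [hε.1], hε.2.le⟩
  have hm4 : -ε ∈ Icc (-Real.pi) Real.pi := ⟨by linarith [hε.2], by linarith [hε.1]⟩
  have hk : ∀ {a b : ℝ}, a ∈ Icc (-Real.pi) Real.pi → b ∈ Icc (-Real.pi) Real.pi →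
      (0 : ℝ) ∉ uIcc a b →
      ∫ τ in a..b, f (α + τ) / (ζ (α + τ) - ζ α) =
      (∫ τ in a..b, f (α + τ) * cotKernel (chord ζ dζ α 0 τ)) - ∫ τ in a..b, g τ := by
    intro a b ha hb h0
    have hmem : ∀ τ ∈ uIcc a b, chord ζ dζ α 0 τ ∈ cotDomain := by
      intro τ hτ
      refine h3 α τ 0 (by simpa using hδ'.le) (abs_le.2 ((uIcc_subset_Icc ha hb) hτ)) ?_
      rintro rfl
      exact h0 hτ
    rw [← intervalIntegral.integral_sub _ (hsub ha hb)]
    · refine intervalIntegral.integral_congr fun τ hτ => ?_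
      simp only [hg]
      rw [cotKernel_eq _ (hmem τ hτ), hch]
      ring
    · refine ContinuousOn.intervalIntegrable (ContinuousOn.mul (by fun_prop) ?_)
      exact continuousOn_cotKernel.comp ((h.continuous_chord α).comp
        (by fun_prop : Continuous fun τ : ℝ => ((0 : ℝ), τ))).continuousOn hmem
  have hn1 : (0 : ℝ) ∉ uIcc (-Real.pi) (-ε) := by
    rw [uIcc_of_le (by linarith [hε.2])]
    exact fun hx => by linarith [hx.2, hε.1]
  have hn2 : (0 : ℝ) ∉ uIcc ε Real.pi := by
    rw [uIcc_of_le hε.2.le]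
    exact fun hx => by linarith [hx.1, hε.1]
  rw [hk hm1 hm4 hn1, hk hm3 hm2 hn2]
  ring

end PeriodicCurve

namespace PeriodicCurve

variable {ζ dζ ddζ : ℝ → ℂ} (h : PeriodicCurve ζ dζ ddζ)
include h

theorem sub_ne_zero {α τ : ℝ} (hτ : τ ≠ 0) : ζ (α + τ) - ζ α ≠ 0 :=
  _root_.sub_ne_zero.2 fun e => hτ (by simpa using h.injective e)

theorem intervalIntegrable_div_sub {f : ℝ → ℂ} (hf : Continuous f) {α a b : ℝ}
    (h0 : (0 : ℝ) ∉ uIcc a b) :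
    IntervalIntegrable (fun τ => f (α + τ) / (ζ (α + τ) - ζ α)) volume a b := by
  have := h.continuous
  refine ContinuousOn.intervalIntegrable (ContinuousOn.div (by fun_prop) (by fun_prop)
    fun τ hτ => h.sub_ne_zero ?_)
  rintro rfl
  exact h0 hτ

theorem intervalIntegrable_div_sub_of_pos {f : ℝ → ℂ} (hf : Continuous f) {α a b : ℝ}
    (ha : 0 < a) (hb : 0 < b) :
    IntervalIntegrable (fun τ => f (α + τ) / (ζ (α + τ) - ζ α)) volume a b :=
  h.intervalIntegrable_div_sub hf fun h0 => (lt_min ha hb).not_ge h0.1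

theorem intervalIntegrable_div_sub_of_neg {f : ℝ → ℂ} (hf : Continuous f) {α a b : ℝ}
    (ha : a < 0) (hb : b < 0) :
    IntervalIntegrable (fun τ => f (α + τ) / (ζ (α + τ) - ζ α)) volume a b :=
  h.intervalIntegrable_div_sub hf fun h0 => (max_lt ha hb).not_ge h0.2

theorem intervalIntegrable_mul_cotKernelTerm {f : ℝ → ℂ} (hf : Continuous f) (α : ℝ) (n : ℕ) :
    IntervalIntegrable (fun τ => f (α + τ) * cotKernelTerm n (ζ (α + τ) - ζ α)) volume
      (-Real.pi) Real.pi := by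
  have := h.continuous
  obtain ⟨δ', c, hδ', hc, h1, h2, h3, -⟩ := h.exists_chord_tube
  refine ContinuousOn.intervalIntegrable (ContinuousOn.mul (by fun_prop) ?_)
  refine (continuousOn_cotKernelTerm n).comp (by fun_prop) fun τ hτ => ?_
  have := h2 α τ 0 (by simpa using hδ'.le)
    (abs_le.2 (by rwa [uIcc_of_le (by linarith [Real.pi_pos])] at hτ))
  simpa [chord] using this

theorem integral_periods {f : ℝ → ℂ} (hf : Continuous f)
    (hfp : Function.Periodic f (2 * Real.pi)) (α : ℝ) (N : ℕ) :
    (∫ τ in -((2 * N + 1) * Real.pi)..-Real.pi, f (α + τ) / (ζ (α + τ) - ζ α)) +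
      ∫ τ in Real.pi..(2 * N + 1) * Real.pi, f (α + τ) / (ζ (α + τ) - ζ α) =
    ∫ τ in -Real.pi..Real.pi, f (α + τ) *
      ∑ n ∈ Finset.range N, cotKernelTerm n (ζ (α + τ) - ζ α) := by
  have hpi := Real.pi_pos
  simp_rw [Finset.mul_sum]
  rw [intervalIntegral.integral_finsetSum fun n _ => h.intervalIntegrable_mul_cotKernelTerm hf α n]
  set q : ℝ → ℂ := fun τ => f (α + τ) / (ζ (α + τ) - ζ α) with hq
  have hshift : ∀ (m : ℤ) (τ : ℝ), q (τ + 2 * Real.pi * m) =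
      f (α + τ) * (1 / (ζ (α + τ) - ζ α + 2 * Real.pi * m)) := by
    intro m τ
    have e1 : f (α + τ + 2 * Real.pi * m) = f (α + τ) := by
      rw [show α + τ + 2 * Real.pi * m = α + τ + m * (2 * Real.pi) by ring]
      exact hfp.int_mul m (α + τ)
    simp only [hq, ← add_assoc]
    rw [e1, h.add_int_mul_two_pi, div_eq_mul_one_div]
    congr 2
    ring
  induction N with
  | zero => simp
  | succ N ih =>
    rw [Finset.sum_range_succ, ← ih]
    have hN : (0 : ℝ) ≤ N := Nat.cast_nonneg N
    have h1 : (0 : ℝ) < (2 * N + 1) * Real.pi := by positivity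
    have hint : ∀ {a b : ℝ}, 0 < a → 0 < b → IntervalIntegrable q volume a b :=
      h.intervalIntegrable_div_sub_of_pos hf
    have hint' : ∀ {a b : ℝ}, a < 0 → b < 0 → IntervalIntegrable q volume a b :=
      h.intervalIntegrable_div_sub_of_neg hf
    have h2 : (0 : ℝ) < (2 * (N + 1 : ℕ) + 1) * Real.pi := by positivity
    rw [← intervalIntegral.integral_add_adjacent_intervals (hint hpi h1) (hint h1 h2),
      ← intervalIntegral.integral_add_adjacent_intervals
        (hint' (by linarith) (by linarith : -((2 * N + 1) * Real.pi) < 0))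
        (hint' (by linarith) (by linarith : -Real.pi < 0))]
    have e1 : ∫ τ in (2 * N + 1) * Real.pi..(2 * (N + 1 : ℕ) + 1) * Real.pi, q τ =
        ∫ τ in -Real.pi..Real.pi, q (τ + 2 * Real.pi * ((N + 1 : ℕ) : ℤ)) := by
      rw [intervalIntegral.integral_comp_add_right]
      congr 1 <;> push_cast <;> ring
    have e2 : ∫ τ in -((2 * (N + 1 : ℕ) + 1) * Real.pi)..-((2 * N + 1) * Real.pi), q τ =
        ∫ τ in -Real.pi..Real.pi, q (τ + 2 * Real.pi * (-((N + 1 : ℕ) : ℤ) : ℤ)) := by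
      rw [intervalIntegral.integral_comp_add_right]
      congr 1 <;> push_cast <;> ring
    have hs : ∀ m : ℤ, IntervalIntegrable q volume (-Real.pi + 2 * Real.pi * m)
        (Real.pi + 2 * Real.pi * m) → IntervalIntegrable (fun τ => q (τ + 2 * Real.pi * m)) volume
          (-Real.pi) Real.pi := fun m hm => by
      have := hm.comp_add_right (2 * Real.pi * m)
      simpa using this
    have e3 : ∫ τ in -Real.pi..Real.pi, f (α + τ) * cotKernelTerm N (ζ (α + τ) - ζ α) =
        (∫ τ in -Real.pi..Real.pi, q (τ + 2 * Real.pi * (-((N + 1 : ℕ) : ℤ) : ℤ))) +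
        ∫ τ in -Real.pi..Real.pi, q (τ + 2 * Real.pi * ((N + 1 : ℕ) : ℤ)) := by
      rw [← intervalIntegral.integral_add]
      · refine intervalIntegral.integral_congr fun τ _ => ?_
        simp only [hshift, cotKernelTerm]
        push_cast
        ring
      · refine hs _ (hint' ?_ ?_) <;> push_cast <;> nlinarith
      · refine hs _ (hint ?_ ?_) <;> push_cast <;> nlinarith
    rw [e3, e1, e2]
    ring

/-- The part of the Cauchy integral away from the origin, summed symmetrically at infinity. -/
theorem tendsto_tail {f : ℝ → ℂ} (hf : Continuous f)
    (hfp : Function.Periodic f (2 * Real.pi)) (α : ℝ) :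
    Tendsto (fun R => (∫ τ in -R..-Real.pi, f (α + τ) / (ζ (α + τ) - ζ α)) +
      ∫ τ in Real.pi..R, f (α + τ) / (ζ (α + τ) - ζ α)) atTop
      (𝓝 (∫ τ in -Real.pi..Real.pi, f (α + τ) * cotKernelRem (ζ (α + τ) - ζ α))) := by
  have hpi := Real.pi_pos
  have hcont := h.continuous
  obtain ⟨δ', c, hδ', hc, h1, h2, h3, -⟩ := h.exists_chord_tube
  obtain ⟨C, hC, hC'⟩ := exists_bound_of_periodic hf hfp
  have hch : ∀ τ, chord ζ dζ α 0 τ = ζ (α + τ) - ζ α := fun τ => by simp [chord]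
  have hchord : Continuous fun τ => ζ (α + τ) - ζ α := by fun_prop
  have hK := (isCompact_Icc (a := -Real.pi) (b := Real.pi)).image hchord
  have hKr : (fun τ => ζ (α + τ) - ζ α) '' Icc (-Real.pi) Real.pi ⊆ cotRemDomain := by
    rintro _ ⟨τ, hτ, rfl⟩
    simp only [← hch]
    exact h2 α τ 0 (by simpa using hδ'.le) (abs_le.2 hτ)
  have hu := tendstoUniformlyOn_cotKernelRem hK.isBounded
  have hIoc : ∀ τ ∈ uIoc (-Real.pi) Real.pi, τ ∈ Icc (-Real.pi) Real.pi := fun τ hτ =>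
    Ioc_subset_Icc_self (by rwa [uIoc_of_le (by linarith)] at hτ)
  obtain ⟨C₁, hC₁⟩ := hK.exists_bound_of_continuousOn (continuousOn_cotKernelRem hK.isBounded hKr)
  have hsum : Tendsto (fun N : ℕ => ∫ τ in -Real.pi..Real.pi, f (α + τ) *
      ∑ n ∈ Finset.range N, cotKernelTerm n (ζ (α + τ) - ζ α)) atTop
      (𝓝 (∫ τ in -Real.pi..Real.pi, f (α + τ) * cotKernelRem (ζ (α + τ) - ζ α))) := by
    refine intervalIntegral.tendsto_integral_filter_of_dominated_convergence
      (fun _ => C * (C₁ + 1)) (Eventually.of_forall fun N => ?_) ?_ (by simp) ?_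
    · refine ContinuousOn.aestronglyMeasurable (ContinuousOn.mul (by fun_prop) ?_)
        measurableSet_uIoc
      refine (continuousOn_finsetSum _ fun n _ => continuousOn_cotKernelTerm n).comp
        hchord.continuousOn fun τ hτ => hKr ⟨τ, hIoc τ hτ, rfl⟩
    · filter_upwards [Metric.tendstoUniformlyOn_iff.1 hu 1 one_pos] with N hN
      refine Eventually.of_forall fun τ hτ => ?_
      have hm := mem_image_of_mem (fun τ => ζ (α + τ) - ζ α) (hIoc τ hτ)
      have h4 := hN _ hm
      have h5 := hC₁ _ hm
      rw [norm_mul]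
      gcongr
      · exact hC' _
      · rw [dist_comm, dist_eq_norm] at h4
        calc _ = ‖((∑ n ∈ Finset.range N, cotKernelTerm n (ζ (α + τ) - ζ α)) -
            cotKernelRem (ζ (α + τ) - ζ α)) + cotKernelRem (ζ (α + τ) - ζ α)‖ := by
              rw [sub_add_cancel]
          _ ≤ _ := norm_add_le _ _
          _ ≤ _ := by linarith
    · refine Eventually.of_forall fun τ hτ => ?_
      exact (hu.tendsto_at (mem_image_of_mem _ (hIoc τ hτ))).const_mul _
  simp_rw [← h.integral_periods hf hfp] at hsum
  set q : ℝ → ℂ := fun τ => f (α + τ) / (ζ (α + τ) - ζ α) with hq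
  have hfloor : Tendsto (fun R : ℝ => ⌊(R - Real.pi) / (2 * Real.pi)⌋₊) atTop atTop :=
    tendsto_nat_floor_atTop.comp
      ((tendsto_atTop_add_const_right _ _ tendsto_id).atTop_div_const Real.two_pi_pos)
  have hmain := hsum.comp hfloor
  set a : ℝ → ℝ := fun R => (2 * (⌊(R - Real.pi) / (2 * Real.pi)⌋₊ : ℝ) + 1) * Real.pi with ha
  have hbound : ∀ τ : ℝ, 0 < |τ| → ‖q τ‖ ≤ C / (c * |τ|) := by
    intro τ hτ
    have := h1 α τ 0 (by simpa using hδ'.le)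
    rw [hch] at this
    rw [hq, norm_div]
    gcongr
    exact hC' _
  have herr : Tendsto (fun R => (∫ τ in -R..-(a R), q τ) + ∫ τ in a R..R, q τ) atTop (𝓝 0) := by
    have hz : Tendsto (fun R : ℝ => C / (c * (R + -(2 * Real.pi))) * (2 * Real.pi) +
        C / (c * (R + -(2 * Real.pi))) * (2 * Real.pi)) atTop (𝓝 0) := by
      have h6 : Tendsto (fun R : ℝ => C / (c * (R + -(2 * Real.pi)))) atTop (𝓝 0) :=
        tendsto_const_nhds.div_atTop
          ((tendsto_atTop_add_const_right _ _ tendsto_id).const_mul_atTop hc)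
      simpa using (h6.mul_const (2 * Real.pi)).add (h6.mul_const (2 * Real.pi))
    refine squeeze_zero_norm' ?_ hz
    filter_upwards [eventually_gt_atTop (2 * Real.pi)] with R hR
    have hr0 : 0 ≤ (R - Real.pi) / (2 * Real.pi) := by
      apply div_nonneg <;> linarith
    have hf1 := Nat.floor_le hr0
    have hf2 := Nat.lt_floor_add_one ((R - Real.pi) / (2 * Real.pi))
    rw [le_div_iff₀ Real.two_pi_pos] at hf1
    rw [div_lt_iff₀ Real.two_pi_pos] at hf2
    have ha1 : a R ≤ R := by simp only [ha]; linarith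
    have ha2 : R - 2 * Real.pi ≤ a R := by simp only [ha]; linarith
    have hpos : 0 < R + -(2 * Real.pi) := by linarith
    have hb : ∀ τ : ℝ, R + -(2 * Real.pi) ≤ |τ| → ‖q τ‖ ≤ C / (c * (R + -(2 * Real.pi))) :=
      fun τ hτ => (hbound τ (hpos.trans_le hτ)).trans (by gcongr)
    refine (norm_add_le _ _).trans (add_le_add ?_ ?_)
    · refine (intervalIntegral.norm_integral_le_of_norm_le_const fun τ hτ => hb τ ?_).trans ?_
      · rw [uIoc_of_le (by linarith)] at hτ
        exact le_trans (by linarith [hτ.2]) (neg_le_abs τ)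
      · gcongr
        rw [abs_of_nonneg (by linarith)]
        linarith
    · refine (intervalIntegral.norm_integral_le_of_norm_le_const fun τ hτ => hb τ ?_).trans ?_
      · rw [uIoc_of_le (by linarith)] at hτ
        exact le_trans (by linarith [hτ.1]) (le_abs_self τ)
      · gcongr
        rw [abs_of_nonneg (by linarith)]
        linarith
  have htot := hmain.add herr
  rw [add_zero] at htot
  refine htot.congr' ?_
  filter_upwards [eventually_gt_atTop (2 * Real.pi)] with R hR
  have ha0 : 0 < a R := by positivity
  have hpos : ∀ {x y : ℝ}, 0 < x → 0 < y → IntervalIntegrable q volume x y :=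
    h.intervalIntegrable_div_sub_of_pos hf
  have hneg : ∀ {x y : ℝ}, x < 0 → y < 0 → IntervalIntegrable q volume x y :=
    h.intervalIntegrable_div_sub_of_neg hf
  rw [← intervalIntegral.integral_add_adjacent_intervals (hpos hpi ha0)
    (hpos ha0 (by linarith : (0 : ℝ) < R)),
    ← intervalIntegral.integral_add_adjacent_intervals
    (hneg (by linarith : -R < 0) (by linarith : -(a R) < 0))
    (hneg (by linarith : -(a R) < 0) (by linarith : -Real.pi < 0))]
  simp only [Function.comp_apply, ha]
  ring

end PeriodicCurve

/-- A lower domain `U₀` and an upper domain `U₁` in the complex plane, separated by a periodic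
curve. -/
structure SeparatedDomains (ζ : ℝ → ℂ) (U₀ U₁ : Set ℂ) : Prop where
  isOpen_lower : IsOpen U₀
  isOpen_upper : IsOpen U₁
  isSimplyConnected_lower : IsSimplyConnected U₀
  isSimplyConnected_upper : IsSimplyConnected U₁
  disjoint : Disjoint U₀ U₁
  notMem_lower : ∀ β, ζ β ∉ U₀
  notMem_upper : ∀ β, ζ β ∉ U₁
  cover : ∀ x, x ∈ U₀ ∨ x ∈ U₁ ∨ x ∈ range ζ
  periodic_lower : ∀ x : ℂ, x + 2 * Real.pi ∈ U₀ ↔ x ∈ U₀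
  periodic_upper : ∀ x : ℂ, x + 2 * Real.pi ∈ U₁ ↔ x ∈ U₁
  position : ∃ a : ℝ, (∀ x : ℂ, x.im ≤ -a → x ∈ U₀) ∧ ∀ x : ℂ, a ≤ x.im → x ∈ U₁

theorem mem_of_add_int_mul {U : Set ℂ} (hU : ∀ x : ℂ, x + 2 * Real.pi ∈ U ↔ x ∈ U) (x : ℂ) (n : ℤ) :
    x + 2 * Real.pi * n ∈ U ↔ x ∈ U := by
  have : Function.Periodic (fun x => x ∈ U) (2 * Real.pi : ℂ) := fun x => propext (hU x)
  have := this.int_mul n x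
  rw [show x + 2 * Real.pi * n = x + n * (2 * Real.pi) by ring]
  exact this.to_iff

/-- The points displaced by `s` in the normal direction from a curve. -/
noncomputable def displaced (ζ dζ : ℝ → ℂ) (s β : ℝ) : ℂ := ζ β + Complex.I * s * dζ β

namespace PeriodicCurve

variable {ζ dζ ddζ : ℝ → ℂ} (h : PeriodicCurve ζ dζ ddζ)
include h

theorem sub_mem_cotDomain {w : ℂ} (hw : ∀ β, ζ β ≠ w) (β : ℝ) : ζ β - w ∈ cotDomain := by
  intro n e
  have h1 := h.add_int_mul_two_pi β (-n)
  push_cast at h1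
  exact hw _ (h1.trans (by linear_combination e))

/-- The circulation of the periodic Cauchy kernel is locally constant off the curve. -/
theorem hasDerivAt_circulation {U : Set ℂ} (hU : IsOpen U) (hζ : ∀ β, ζ β ∉ U) {w₀ : ℂ}
    (hw₀ : w₀ ∈ U) :
    HasDerivAt (fun w => ∫ β in -Real.pi..Real.pi, dζ β * cotKernel (ζ β - w)) 0 w₀ := by
  have hcont := h.continuous
  have hcont' := h.continuous_deriv
  obtain ⟨r, hr, hrU⟩ := Metric.nhds_basis_closedBall.mem_iff.1 (hU.mem_nhds hw₀)
  have hdk : ContinuousOn (deriv cotKernel) cotDomain :=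
    (differentiableOn_cotKernel.deriv isOpen_cotDomain).continuousOn
  have hmem : ∀ w ∈ U, ∀ β, ζ β - w ∈ cotDomain := fun w hw =>
    h.sub_mem_cotDomain fun β e => hζ β (e ▸ hw)
  have hc2 : ContinuousOn (fun p : ℝ × ℂ => dζ p.1 * -deriv cotKernel (ζ p.1 - p.2))
      (Icc (-Real.pi) Real.pi ×ˢ Metric.closedBall w₀ r) := by
    refine ContinuousOn.mul (by fun_prop) (ContinuousOn.neg (hdk.comp (by fun_prop) ?_))
    rintro ⟨β, w⟩ ⟨-, hw⟩
    exact hmem w (hrU hw) β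
  obtain ⟨C, hC⟩ := (isCompact_Icc.prod (isCompact_closedBall w₀ r)).exists_bound_of_continuousOn hc2
  have hF : ∀ w ∈ U, Continuous fun β => dζ β * cotKernel (ζ β - w) := fun w hw =>
    hcont'.mul (continuousOn_cotKernel.comp_continuous (by fun_prop) (hmem w hw))
  have hF' : ∀ w ∈ U, Continuous fun β => dζ β * -deriv cotKernel (ζ β - w) := fun w hw =>
    hcont'.mul (hdk.comp_continuous (by fun_prop) (hmem w hw)).neg
  have hIoc : ∀ τ ∈ uIoc (-Real.pi) Real.pi, τ ∈ Icc (-Real.pi) Real.pi := fun τ hτ =>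
    Ioc_subset_Icc_self (by rwa [uIoc_of_le (by linarith [Real.pi_pos])] at hτ)
  have hdiff : ∀ w ∈ U, ∀ β, HasDerivAt cotKernel (deriv cotKernel (ζ β - w)) (ζ β - w) :=
    fun w hw β => (differentiableOn_cotKernel.differentiableAt
      (isOpen_cotDomain.mem_nhds (hmem w hw β))).hasDerivAt
  have key := intervalIntegral.hasDerivAt_integral_of_dominated_loc_of_deriv_le (𝕜 := ℂ)
    (μ := volume) (a := -Real.pi) (b := Real.pi)
    (F := fun w β => dζ β * cotKernel (ζ β - w)) (F' := fun w β => dζ β * -deriv cotKernel (ζ β - w))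
    (x₀ := w₀) (s := Metric.closedBall w₀ r) (bound := fun _ => C)
    (Metric.closedBall_mem_nhds w₀ hr)
    (by
      filter_upwards [hU.mem_nhds hw₀] with w hw
      exact (hF w hw).aestronglyMeasurable)
    ((hF w₀ hw₀).intervalIntegrable _ _) (hF' w₀ hw₀).aestronglyMeasurable
    (Eventually.of_forall fun β hβ w hw => hC (β, w) ⟨hIoc β hβ, hw⟩)
    (by simp)
    (Eventually.of_forall fun β _ w hw => by
      have h1 : HasDerivAt (fun w : ℂ => ζ β - w) (-1) w := (hasDerivAt_id w).const_sub (ζ β)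
      have h2 := ((hdiff w (hrU hw) β).comp w h1).const_mul (dζ β)
      simpa using h2)
  have hzero : ∫ β in -Real.pi..Real.pi, dζ β * -deriv cotKernel (ζ β - w₀) = 0 := by
    have h3 : ∀ β ∈ uIcc (-Real.pi) Real.pi, HasDerivAt (fun β => -cotKernel (ζ β - w₀))
        (dζ β * -deriv cotKernel (ζ β - w₀)) β := by
      intro β _
      have h4 := ((hdiff w₀ hw₀ β).scomp β ((h.hasDerivAt β).sub_const w₀)).neg
      refine h4.congr_deriv ?_
      simp
    rw [intervalIntegral.integral_eq_sub_of_hasDerivAt h3 ((hF' w₀ hw₀).intervalIntegrable _ _)]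
    have h5 := h.add_two_pi (-Real.pi)
    rw [show -Real.pi + 2 * Real.pi = Real.pi by ring] at h5
    rw [h5, show ζ (-Real.pi) + 2 * Real.pi - w₀ = ζ (-Real.pi) - w₀ + 2 * Real.pi by ring,
      cotKernel_add_two_pi, sub_self]
  rw [hzero] at key
  exact key.2

theorem circulation_eq {U : Set ℂ} (hU : IsOpen U) (hc : IsPreconnected U) (hζ : ∀ β, ζ β ∉ U)
    {e : ℂ} {p : ℝ → ℂ} {C : ℝ} (hp : ∀ᶠ Y in atTop, p Y ∈ U ∧
      ∀ β ∈ Icc (-Real.pi) Real.pi, ‖cotKernel (ζ β - p Y) - e‖ ≤ C * Real.exp (-Y)) {w : ℂ}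
    (hw : w ∈ U) :
    ∫ β in -Real.pi..Real.pi, dζ β * cotKernel (ζ β - w) = 2 * Real.pi * e := by
  obtain ⟨M, hM, hM'⟩ := h.exists_deriv_bound
  have hcont := h.continuous
  have hcont' := h.continuous_deriv
  have hI : ∫ β in -Real.pi..Real.pi, dζ β * e = 2 * Real.pi * e := by
    rw [intervalIntegral.integral_mul_const, intervalIntegral.integral_eq_sub_of_hasDerivAt
      (fun β _ => h.hasDerivAt β) (hcont'.intervalIntegrable _ _)]
    have h5 := h.add_two_pi (-Real.pi)
    rw [show -Real.pi + 2 * Real.pi = Real.pi by ring] at h5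
    rw [h5, add_sub_cancel_left]
  have hlim : Tendsto (fun Y => M * (C * Real.exp (-Y)) * |Real.pi - -Real.pi|) atTop (𝓝 0) := by
    have := (Real.tendsto_exp_atBot.comp tendsto_neg_atTop_atBot).const_mul C
    simpa using (this.const_mul M).mul_const |Real.pi - -Real.pi|
  have hle : ‖(∫ β in -Real.pi..Real.pi, dζ β * cotKernel (ζ β - w)) - 2 * Real.pi * e‖ ≤ 0 := by
    refine ge_of_tendsto hlim ?_
    filter_upwards [hp] with Y ⟨hY, hb⟩
    have hconst := hU.is_const_of_deriv_eq_zero hc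
      (fun x hx => (h.hasDerivAt_circulation hU hζ hx).differentiableAt.differentiableWithinAt)
      (fun x hx => (h.hasDerivAt_circulation hU hζ hx).deriv) hw hY
    have hmem := h.sub_mem_cotDomain (w := p Y) fun β e => hζ β (e ▸ hY)
    rw [hconst, ← hI, ← intervalIntegral.integral_sub]
    · refine intervalIntegral.norm_integral_le_of_norm_le_const fun β hβ => ?_
      rw [← mul_sub, norm_mul]
      gcongr
      · exact hM' β
      · exact hb β (Ioc_subset_Icc_self (by rwa [uIoc_of_le (by linarith [Real.pi_pos])] at hβ))
    · exact (hcont'.mul (continuousOn_cotKernel.comp_continuous (by fun_prop)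
        hmem)).intervalIntegrable _ _
    · exact (hcont'.mul continuous_const).intervalIntegrable _ _
  exact sub_eq_zero.1 (norm_le_zero_iff.1 hle)

theorem circulation_eq_upper {U₀ U₁ : Set ℂ} (hs : SeparatedDomains ζ U₀ U₁) {w : ℂ}
    (hw : w ∈ U₁) :
    ∫ β in -Real.pi..Real.pi, dζ β * cotKernel (ζ β - w) = Real.pi * Complex.I := by
  obtain ⟨a, -, ha⟩ := hs.position
  obtain ⟨B, hB⟩ := isCompact_Icc.exists_bound_of_continuousOn
    (s := Icc (-Real.pi) Real.pi) h.continuous.continuousOn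
  have hB0 : 0 ≤ B := (norm_nonneg _).trans (hB 0 ⟨by linarith [Real.pi_pos], Real.pi_pos.le⟩)
  have := h.circulation_eq hs.isOpen_upper hs.isSimplyConnected_upper.isPathConnected.isConnected.isPreconnected
    hs.notMem_upper (e := Complex.I / 2) (p := fun Y => Y * Complex.I) (C := 2 * Real.exp B) (by
      filter_upwards [eventually_ge_atTop a, eventually_ge_atTop (B + 1)] with Y h1 h2
      refine ⟨ha _ (by simpa using h1), fun β hβ => ?_⟩
      have h3 := (Complex.abs_im_le_norm (ζ β)).trans (hB β hβ)
      have h4 : (ζ β - Y * Complex.I).im = (ζ β).im - Y := by simp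
      have h5 := (le_abs_self _).trans h3
      refine (norm_cotKernel_sub_le (by rw [h4]; linarith)).trans ?_
      rw [h4, mul_assoc, ← Real.exp_add]
      gcongr
      linarith) hw
  rw [this]
  ring

theorem circulation_eq_lower {U₀ U₁ : Set ℂ} (hs : SeparatedDomains ζ U₀ U₁) {w : ℂ}
    (hw : w ∈ U₀) :
    ∫ β in -Real.pi..Real.pi, dζ β * cotKernel (ζ β - w) = -(Real.pi * Complex.I) := by
  obtain ⟨a, ha, -⟩ := hs.position
  obtain ⟨B, hB⟩ := isCompact_Icc.exists_bound_of_continuousOn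
    (s := Icc (-Real.pi) Real.pi) h.continuous.continuousOn
  have := h.circulation_eq hs.isOpen_lower hs.isSimplyConnected_lower.isPathConnected.isConnected.isPreconnected
    hs.notMem_lower (e := -(Complex.I / 2)) (p := fun Y => -(Y * Complex.I))
    (C := 2 * Real.exp B) (by
      filter_upwards [eventually_ge_atTop a, eventually_ge_atTop (B + 1)] with Y h1 h2
      refine ⟨ha _ (by simpa using h1), fun β hβ => ?_⟩
      have h3 := (Complex.abs_im_le_norm (ζ β)).trans (hB β hβ)
      have h4 : (ζ β - -(Y * Complex.I)).im = (ζ β).im + Y := by simp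
      have h5 := (neg_le_abs _).trans h3
      rw [sub_neg_eq_add (cotKernel _)]
      refine (norm_cotKernel_add_le (by rw [h4]; linarith)).trans ?_
      rw [h4, mul_assoc, ← Real.exp_add]
      gcongr
      linarith) hw
  rw [this]
  ring

/-- The upper domain lies on the left of the curve, the lower domain on its right. -/
theorem exists_displaced_mem {U₀ U₁ : Set ℂ} (hs : SeparatedDomains ζ U₀ U₁) :
    ∃ δ : ℝ, 0 < δ ∧ ∀ s β : ℝ, 0 < s → s ≤ δ →
      displaced ζ dζ s β ∈ U₁ ∧ displaced ζ dζ (-s) β ∈ U₀ := by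
  obtain ⟨δ, c, hδ, hc, -, -, -, h4⟩ := h.exists_chord_tube
  have hcont := h.continuous
  have hcont' := h.continuous_deriv
  have hoff : ∀ s β : ℝ, |s| ≤ δ → s ≠ 0 → displaced ζ dζ s β ∈ U₀ ∪ U₁ := by
    intro s β hs1 hs2
    rcases hs.cover (displaced ζ dζ s β) with h1 | h1 | ⟨γ, h1⟩
    · exact Or.inl h1
    · exact Or.inr h1
    · exfalso
      have := h4 β (γ - β) s hs1 hs2 0
      apply this
      rw [chord, add_sub_cancel, h1, displaced]
      push_cast
      ring
  have hcd : Continuous fun p : ℝ × ℝ => displaced ζ dζ p.1 p.2 := by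
    unfold displaced
    fun_prop
  have hside : ∀ S : Set ℝ, IsPreconnected S → (∀ s ∈ S, |s| ≤ δ ∧ s ≠ 0) →
      (∀ s ∈ S, ∀ β, displaced ζ dζ s β ∈ U₀) ∨ ∀ s ∈ S, ∀ β, displaced ζ dζ s β ∈ U₁ := by
    intro S hS hS'
    have hpre : IsPreconnected ((fun p : ℝ × ℝ => displaced ζ dζ p.1 p.2) '' (S ×ˢ univ)) :=
      (hS.prod isPreconnected_univ).image _ hcd.continuousOn
    have hsub : ((fun p : ℝ × ℝ => displaced ζ dζ p.1 p.2) '' (S ×ˢ univ)) ⊆ U₀ ∪ U₁ := by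
      rintro _ ⟨⟨s, β⟩, ⟨h1, -⟩, rfl⟩
      exact hoff s β (hS' s h1).1 (hS' s h1).2
    refine (hpre.subset_or_subset hs.isOpen_lower hs.isOpen_upper hs.disjoint hsub).imp ?_ ?_ <;>
    exact fun h1 s h2 β => h1 ⟨(s, β), ⟨h2, mem_univ _⟩, rfl⟩
  obtain ⟨M, hM, hM'⟩ := h.exists_deriv2_bound
  have hval : ∀ s : ℝ, ∫ τ in -Real.pi..Real.pi, dζ (0 + τ) * cotKernel (chord ζ dζ 0 s τ) =
      ∫ β in -Real.pi..Real.pi, dζ β * cotKernel (ζ β - displaced ζ dζ s 0) := by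
    intro s
    refine intervalIntegral.integral_congr fun τ _ => ?_
    simp only [zero_add, chord, displaced]
    congr 2
    ring
  have hr := h.tendsto_cauchyIntegral hcont' (α := 0) (K := M)
    (fun τ _ => h.norm_deriv_sub_le hM' 0 τ) (nhdsGT_le_nhdsNE 0) tendsto_integral_inv_sub_right
  have hl := h.tendsto_cauchyIntegral hcont' (α := 0) (K := M)
    (fun τ _ => h.norm_deriv_sub_le hM' 0 τ) (nhdsLT_le_nhdsNE 0) tendsto_integral_inv_sub_left
  simp only [hval] at hr hl
  rw [div_self (h.deriv_ne_zero 0), one_mul] at hr hl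
  have hlim : ∀ {l : Filter ℝ} [l.NeBot] {v v' : ℂ} {U : Set ℂ} {S : Set ℝ}, S ∈ l →
      (∀ s ∈ S, ∀ β, displaced ζ dζ s β ∈ U) →
      (∀ w ∈ U, ∫ β in -Real.pi..Real.pi, dζ β * cotKernel (ζ β - w) = v) →
      Tendsto (fun s => ∫ β in -Real.pi..Real.pi, dζ β * cotKernel (ζ β - displaced ζ dζ s 0)) l
        (𝓝 v') → v' = v := by
    intro l _ v v' U S hS h1 h2 h3
    refine tendsto_nhds_unique h3 (tendsto_const_nhds.congr' ?_)
    filter_upwards [hS] with s hs'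
    exact (h2 _ (h1 s hs' 0)).symm
  have hpi : (Real.pi : ℂ) * Complex.I ≠ 0 :=
    mul_ne_zero (Complex.ofReal_ne_zero.2 Real.pi_ne_zero) Complex.I_ne_zero
  have hR := hside (Ioc 0 δ) isPreconnected_Ioc fun s hs' =>
    ⟨by rw [abs_of_pos hs'.1]; exact hs'.2, hs'.1.ne'⟩
  have hL := hside (Ico (-δ) 0) isPreconnected_Ico fun s hs' =>
    ⟨by rw [abs_of_neg hs'.2]; linarith [hs'.1], hs'.2.ne⟩
  have hSr : Ioc 0 δ ∈ 𝓝[>] (0 : ℝ) := Ioc_mem_nhdsGT hδ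
  have hSl : Ico (-δ) 0 ∈ 𝓝[<] (0 : ℝ) := Ico_mem_nhdsLT (by linarith)
  have hu := fun w hw => h.circulation_eq_upper hs (w := w) hw
  have hd := fun w hw => h.circulation_eq_lower hs (w := w) hw
  refine ⟨δ, hδ, ?_⟩
  rcases hR with hR | hR <;> rcases hL with hL | hL
  · have e1 := hlim hSr hR hd hr
    have e2 := hlim hSl hL hd hl
    exact absurd (by linear_combination (e1 - e2) / 2) hpi
  · have e1 := hlim hSr hR hd hr
    have e2 := hlim hSl hL hu hl
    exact absurd (by linear_combination (e1 - e2) / 4) hpi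
  · exact fun s β h1 h2 => ⟨hR s ⟨h1, h2⟩ β, hL (-s) ⟨by linarith, by linarith⟩ β⟩
  · have e1 := hlim hSr hR hu hr
    have e2 := hlim hSl hL hu hl
    exact absurd (by linear_combination (e1 - e2) / 2) hpi

end PeriodicCurve

/-- A constant which is the integral of `F k` over all horizontal segments of a half-plane vanishes
if `k` is bounded and `F` is square integrable. -/
theorem eq_zero_of_forall_horizontal_integral_eq {F k : ℂ → ℂ} {S : Set ℝ} (hS : MeasurableSet S)
    (hS' : volume S = ⊤) {c : ℂ}
    (hF : ∀ y ∈ S, Continuous fun x : ℝ => F (x + y * Complex.I))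
    (hk : ∀ y ∈ S, ∀ x : ℝ, ‖k (x + y * Complex.I)‖ ≤ 3)
    (hc : ∀ y ∈ S, ∫ x in (0 : ℝ)..2 * Real.pi,
      F (x + y * Complex.I) * k (x + y * Complex.I) = c)
    (hfin : ∫⁻ y in S, ∫⁻ x in Ioc 0 (2 * Real.pi),
      ENNReal.ofReal (‖F ((x : ℝ) + (y : ℝ) * Complex.I)‖ ^ 2) < ⊤) : c = 0 := by
  by_contra hc0
  have hpi := Real.pi_pos
  have hn : 0 < ‖c‖ := norm_pos_iff.2 hc0
  set l : ℝ := ‖c‖ / (6 * Real.pi) with hl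
  have hl0 : 0 < l := by positivity
  have hlow : ∀ y ∈ S, ENNReal.ofReal (‖c‖ * l / 3) ≤ ∫⁻ x in Ioc 0 (2 * Real.pi),
      ENNReal.ofReal (‖F ((x : ℝ) + (y : ℝ) * Complex.I)‖ ^ 2) := by
    intro y hy
    have hF2 : Continuous fun x : ℝ => ‖F (x + y * Complex.I)‖ ^ 2 := (hF y hy).norm.pow 2
    rw [← ofReal_integral_eq_lintegral_ofReal
      ((hF2.intervalIntegrable 0 (2 * Real.pi)).1) (Eventually.of_forall fun x => by positivity),
      ← intervalIntegral.integral_of_le Real.two_pi_pos.le]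
    refine ENNReal.ofReal_le_ofReal ?_
    have h1 : ‖c‖ ≤ ∫ x in (0 : ℝ)..2 * Real.pi,
        3 * (l / 2 + (2 * l)⁻¹ * ‖F (x + y * Complex.I)‖ ^ 2) := by
      rw [← hc y hy]
      refine intervalIntegral.norm_integral_le_of_norm_le Real.two_pi_pos.le
        (Eventually.of_forall fun x _ => ?_) ?_
      · rw [norm_mul, mul_comm]
        have h2 : ‖F (x + y * Complex.I)‖ ≤ l / 2 + (2 * l)⁻¹ * ‖F (x + y * Complex.I)‖ ^ 2 := by
          have h3 : l / 2 + (2 * l)⁻¹ * ‖F (x + y * Complex.I)‖ ^ 2 - ‖F (x + y * Complex.I)‖ =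
              (2 * l)⁻¹ * (l - ‖F (x + y * Complex.I)‖) ^ 2 := by
            field_simp
            ring
          have h4 : 0 ≤ (2 * l)⁻¹ * (l - ‖F (x + y * Complex.I)‖) ^ 2 := by positivity
          linarith
        exact mul_le_mul (hk y hy x) h2 (norm_nonneg _) (by norm_num)
      · exact Continuous.intervalIntegrable (by fun_prop) _ _
    rw [intervalIntegral.integral_const_mul, intervalIntegral.integral_add (by simp)
      ((hF2.intervalIntegrable _ _).const_mul _), intervalIntegral.integral_const,
      intervalIntegral.integral_const_mul, sub_zero, smul_eq_mul] at h1
    set J := ∫ x in (0 : ℝ)..2 * Real.pi, ‖F (x + y * Complex.I)‖ ^ 2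
    have h5 : 3 * (2 * Real.pi * (l / 2)) = ‖c‖ / 2 := by rw [hl]; field_simp; norm_num
    have h6 : ‖c‖ / 2 ≤ 3 * ((2 * l)⁻¹ * J) := by linarith
    have h7 : 3 * ((2 * l)⁻¹ * J) = J * (3 / (2 * l)) := by field_simp
    rw [h7, ← div_le_iff₀ (by positivity)] at h6
    calc ‖c‖ * l / 3 = ‖c‖ / 2 / (3 / (2 * l)) := by field_simp
      _ ≤ J := h6
  have htop : ∫⁻ _ in S, ENNReal.ofReal (‖c‖ * l / 3) = ⊤ := by
    rw [setLIntegral_const, hS', ENNReal.mul_top]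
    rw [ne_eq, ENNReal.ofReal_eq_zero, not_le]
    positivity
  exact absurd (htop ▸ setLIntegral_mono' hS hlow) (not_le.2 hfin)

/-- The fluid velocity of one of the two domains, as a holomorphic function which is periodic and
square integrable on a period. -/
structure IsPeriodicFlow (ζ : ℝ → ℂ) (U : Set ℂ) (F : ℂ → ℂ) : Prop where
  differentiableOn : DifferentiableOn ℂ F U
  continuousOn : ContinuousOn F (U ∪ range ζ)
  periodic : ∀ x ∈ U, F (x + 2 * Real.pi) = F x

namespace PeriodicCurve

variable {ζ dζ ddζ : ℝ → ℂ} (h : PeriodicCurve ζ dζ ddζ)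
include h

theorem continuous_displaced : Continuous fun p : ℝ × ℝ => displaced ζ dζ p.1 p.2 := by
  have := h.continuous
  have := h.continuous_deriv
  unfold displaced
  fun_prop

theorem displaced_add_two_pi (s β : ℝ) :
    displaced ζ dζ s (β + 2 * Real.pi) = displaced ζ dζ s β + 2 * Real.pi := by
  rw [displaced, h.add_two_pi, h.periodic_deriv, displaced]
  ring

theorem integral_eq_zero_of_periodic_primitive {U : Set ℂ} {G Ψ : ℂ → ℂ} {σ δ : ℝ} (hδ : 0 < δ)
    (hΨ : ∀ x ∈ U, HasDerivAt Ψ (G x) x) (hper : ∀ x ∈ U, Ψ (x + 2 * Real.pi) = Ψ x)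
    (hG : ContinuousOn G (U ∪ range ζ))
    (hside : ∀ s β : ℝ, 0 < s → s ≤ δ → displaced ζ dζ (σ * s) β ∈ U) :
    ∫ β in -Real.pi..Real.pi, G (ζ β) * dζ β = 0 := by
  have hcont := h.continuous
  have hcont' := h.continuous_deriv
  have hcont2 := h.continuous_deriv2
  have hIoc : ∀ τ ∈ uIoc (-Real.pi) Real.pi, τ ∈ Icc (-Real.pi) Real.pi := fun τ hτ =>
    Ioc_subset_Icc_self (by rwa [uIoc_of_le (by linarith [Real.pi_pos])] at hτ)
  set g : ℝ → ℝ → ℂ := fun s β =>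
    G (displaced ζ dζ (σ * s) β) * (dζ β + Complex.I * (σ * s : ℝ) * ddζ β) with hg
  have hgc : ContinuousOn (fun p : ℝ × ℝ => g p.1 p.2) (Icc 0 δ ×ˢ univ) := by
    refine ContinuousOn.mul (hG.comp ?_ ?_) (by fun_prop)
    · exact (h.continuous_displaced.comp
        (by fun_prop : Continuous fun p : ℝ × ℝ => (σ * p.1, p.2))).continuousOn
    · rintro ⟨s, β⟩ ⟨hs, -⟩
      rcases eq_or_lt_of_le hs.1 with h0 | h0
      · right
        simp only at h0
        rw [← h0]
        exact ⟨β, by simp [displaced]⟩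
      · exact Or.inl (hside s β h0 hs.2)
  obtain ⟨C, hC⟩ := (isCompact_Icc.prod isCompact_Icc).exists_bound_of_continuousOn
    (hgc.mono (prod_mono_right (subset_univ (Icc (-Real.pi) Real.pi))))
  have hslice : ∀ s ∈ Icc 0 δ, Continuous (g s) := fun s hs =>
    hgc.comp_continuous (by fun_prop : Continuous fun β : ℝ => (s, β)) fun β => ⟨hs, mem_univ _⟩
  have hzero : ∀ s ∈ Ioc 0 δ, ∫ β in -Real.pi..Real.pi, g s β = 0 := by
    intro s hs
    have hd : ∀ β ∈ uIcc (-Real.pi) Real.pi,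
        HasDerivAt (fun β => Ψ (displaced ζ dζ (σ * s) β)) (g s β) β := by
      intro β _
      have h1 : HasDerivAt (displaced ζ dζ (σ * s)) (dζ β + Complex.I * (σ * s : ℝ) * ddζ β) β :=
        (h.hasDerivAt β).add ((h.hasDerivAt_deriv β).const_mul _)
      exact (hΨ _ (hside s β hs.1 hs.2)).comp β h1
    rw [intervalIntegral.integral_eq_sub_of_hasDerivAt hd
      ((hslice s (Ioc_subset_Icc_self hs)).intervalIntegrable _ _)]
    have h5 := h.displaced_add_two_pi (σ * s) (-Real.pi)
    rw [show -Real.pi + 2 * Real.pi = Real.pi by ring] at h5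
    rw [h5, hper _ (hside s _ hs.1 hs.2), sub_self]
  have hlim : Tendsto (fun s => ∫ β in -Real.pi..Real.pi, g s β) (𝓝[>] 0)
      (𝓝 (∫ β in -Real.pi..Real.pi, g 0 β)) := by
    refine intervalIntegral.tendsto_integral_filter_of_dominated_convergence (fun _ => C) ?_ ?_
      (by simp) ?_
    · filter_upwards [Ioc_mem_nhdsGT hδ] with s hs
      exact (hslice s (Ioc_subset_Icc_self hs)).aestronglyMeasurable
    · filter_upwards [Ioc_mem_nhdsGT hδ] with s hs
      exact Eventually.of_forall fun β hβ => hC (s, β) ⟨Ioc_subset_Icc_self hs, hIoc β hβ⟩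
    · refine Eventually.of_forall fun β _ => ?_
      have h1 : ContinuousOn (fun s => g s β) (Icc 0 δ) :=
        hgc.comp (f := fun s : ℝ => (s, β)) (by fun_prop) fun s hs => ⟨hs, mem_univ _⟩
      exact ((h1 0 ⟨le_rfl, hδ.le⟩).mono Ioc_subset_Icc_self).tendsto.mono_left
        (nhdsWithin_le_of_mem (Ioc_mem_nhdsGT hδ))
  have h0 : ∫ β in -Real.pi..Real.pi, g 0 β = 0 := by
    refine tendsto_nhds_unique hlim (tendsto_const_nhds.congr' ?_)
    filter_upwards [Ioc_mem_nhdsGT hδ] with s hs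
    exact (hzero s hs).symm
  simpa [hg, displaced] using h0

/-- Cauchy's theorem for the domain on one side of the curve. -/
theorem integral_cotKernel_eq_zero {U : Set ℂ} (hU : IsOpen U) (hsc : IsSimplyConnected U)
    (hper : ∀ x : ℂ, x + 2 * Real.pi ∈ U ↔ x ∈ U) {F : ℂ → ℂ} (hF : IsPeriodicFlow ζ U F)
    {σ δ : ℝ} (hδ : 0 < δ)
    (hside : ∀ s β : ℝ, 0 < s → s ≤ δ → displaced ζ dζ (σ * s) β ∈ U)
    {w : ℂ} (hwU : w ∉ U) (hwζ : ∀ β, ζ β ≠ w) {S : Set ℝ} (hS : MeasurableSet S)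
    (hS' : volume S = ⊤) (hSU : ∀ y ∈ S, ∀ x : ℝ, (x + y * Complex.I : ℂ) ∈ U)
    (hSw : ∀ y ∈ S, 1 ≤ |y - w.im|)
    (hfin : ∫⁻ y in S, ∫⁻ x in Ioc 0 (2 * Real.pi),
      ENNReal.ofReal (‖F ((x : ℝ) + (y : ℝ) * Complex.I)‖ ^ 2) < ⊤) :
    ∫ β in -Real.pi..Real.pi, F (ζ β) * dζ β * cotKernel (ζ β - w) = 0 := by
  have hmem : ∀ x ∈ U ∪ range ζ, x - w ∈ cotDomain := by
    rintro x (hx | ⟨β, rfl⟩)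
    · intro n e
      apply hwU
      have := (mem_of_add_int_mul hper x (-n)).2 hx
      push_cast at this
      convert this using 1
      linear_combination -e
    · exact h.sub_mem_cotDomain hwζ β
  set G : ℂ → ℂ := fun x => F x * cotKernel (x - w) with hGdef
  have hGd : DifferentiableOn ℂ G U := hF.differentiableOn.mul
    (differentiableOn_cotKernel.comp (by fun_prop) fun x hx => hmem x (Or.inl hx))
  have hGc : ContinuousOn G (U ∪ range ζ) := hF.continuousOn.mul
    (continuousOn_cotKernel.comp (by fun_prop) fun x hx => hmem x hx)
  have hGp : ∀ x ∈ U, G (x + 2 * Real.pi) = G x := by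
    intro x hx
    simp only [hGdef]
    rw [hF.periodic x hx, show x + 2 * Real.pi - w = x - w + 2 * Real.pi by ring,
      cotKernel_add_two_pi]
  obtain ⟨Ψ, hΨ⟩ := exists_primitive_of_isSimplyConnected hU hsc hGd
  have hD : ∀ x ∈ U, HasDerivAt (fun x => Ψ (x + 2 * Real.pi) - Ψ x) 0 x := by
    intro x hx
    have h1 := (hΨ _ ((hper x).2 hx)).comp_add_const x (2 * Real.pi)
    rw [hGp x hx] at h1
    exact (h1.sub (hΨ x hx)).congr_deriv (sub_self _)
  obtain ⟨x₀, hx₀⟩ := hsc.nonempty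
  have hconst : ∀ x ∈ U, Ψ (x + 2 * Real.pi) - Ψ x = Ψ (x₀ + 2 * Real.pi) - Ψ x₀ := fun x hx =>
    hU.is_const_of_deriv_eq_zero hsc.isPathConnected.isConnected.isPreconnected
      (fun y hy => (hD y hy).differentiableAt.differentiableWithinAt)
      (fun y hy => (hD y hy).deriv) hx hx₀
  have hline : ∀ y : ℝ, Continuous fun x : ℝ => (x + y * Complex.I : ℂ) := fun y => by fun_prop
  have hc0 : Ψ (x₀ + 2 * Real.pi) - Ψ x₀ = 0 := by
    refine eq_zero_of_forall_horizontal_integral_eq (F := F) (k := fun x => cotKernel (x - w)) hS hS'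
      (fun y hy => hF.differentiableOn.continuousOn.comp_continuous (hline y) (hSU y hy))
      (fun y hy x => norm_cotKernel_le (by simpa using hSw y hy)) (fun y hy => ?_) hfin
    have hd : ∀ x ∈ uIcc (0 : ℝ) (2 * Real.pi),
        HasDerivAt (fun x : ℝ => Ψ (x + y * Complex.I)) (G (x + y * Complex.I)) x := by
      intro x _
      have h1 : HasDerivAt (fun x : ℝ => (x + y * Complex.I : ℂ)) 1 x :=
        (Complex.ofRealCLM.hasDerivAt (x := x)).add_const _
      exact ((hΨ _ (hSU y hy x)).comp x h1).congr_deriv (mul_one _)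
    have h2 := intervalIntegral.integral_eq_sub_of_hasDerivAt hd
      ((hGd.continuousOn.comp_continuous (hline y) (hSU y hy)).intervalIntegrable _ _)
    simp only [hGdef] at h2
    rw [h2, ← hconst _ (hSU y hy 0)]
    congr 2
    push_cast
    ring
  have hfinal := h.integral_eq_zero_of_periodic_primitive hδ hΨ
    (fun x hx => sub_eq_zero.1 ((hconst x hx).trans hc0)) hGc hside
  rw [← hfinal]
  refine intervalIntegral.integral_congr fun β _ => ?_
  simp only [hGdef]
  ring

/-- The Cauchy integral over one period has the finite part determined by its one-sided limit. -/
theorem finitePart_eq {f : ℝ → ℂ} (hf : Continuous f) (hfp : Function.Periodic f (2 * Real.pi))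
    {α K : ℝ} (hK : ∀ τ : ℝ, |τ| ≤ Real.pi → ‖f (α + τ) - f α‖ ≤ K * |τ|) {l : Filter ℝ} [l.NeBot]
    (hl : l ≤ 𝓝[≠] 0) {v : ℂ}
    (hv : Tendsto (fun s : ℝ => ∫ τ in -Real.pi..Real.pi, ((τ : ℂ) - Complex.I * s)⁻¹) l (𝓝 v))
    (h0 : ∀ᶠ s in l, ∫ β in -Real.pi..Real.pi,
      f β * cotKernel (ζ β - displaced ζ dζ s α) = 0) :
    finitePart ζ dζ f α = -(f α / dζ α * v) := by
  have h1 := h.tendsto_cauchyIntegral hf hK hl hv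
  have h2 : Tendsto (fun s => ∫ τ in -Real.pi..Real.pi, f (α + τ) * cotKernel (chord ζ dζ α s τ)) l
      (𝓝 0) := by
    refine tendsto_const_nhds.congr' ?_
    filter_upwards [h0] with s hs
    rw [← hs]
    have hp : Function.Periodic (fun β => f β * cotKernel (ζ β - displaced ζ dζ s α))
        (2 * Real.pi) := by
      intro β
      simp only [hfp β, h.add_two_pi]
      rw [show ζ β + 2 * Real.pi - displaced ζ dζ s α = ζ β - displaced ζ dζ s α + 2 * Real.pi by
        ring, cotKernel_add_two_pi]
    have h3 := hp.intervalIntegral_add_eq (-Real.pi) (α + -Real.pi)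
    rw [show -Real.pi + 2 * Real.pi = Real.pi by ring,
      show α + -Real.pi + 2 * Real.pi = α + Real.pi by ring] at h3
    rw [h3, ← intervalIntegral.integral_comp_add_left]
    refine intervalIntegral.integral_congr fun τ _ => ?_
    simp only [chord, displaced]
    congr 2
    ring
  have h3 := tendsto_nhds_unique h1 h2
  linear_combination h3

end PeriodicCurve

theorem truncation_eq {α ε R : ℝ} (hε : 0 < ε) :
    truncation α ε R = Icc (α + -R) (α + -ε) ∪ Icc (α + ε) (α + R) := by
  ext β
  simp only [truncation, mem_ofPred_eq, mem_union, mem_Icc]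
  constructor
  · rintro ⟨h1, h2⟩
    rw [abs_le] at h2
    rcases le_abs.1 h1 with h | h
    · left; constructor <;> linarith
    · right; constructor <;> linarith
  · rintro (⟨h1, h2⟩ | ⟨h1, h2⟩)
    · rw [abs_of_nonneg (by linarith)]; constructor <;> linarith
    · rw [abs_of_nonpos (by linarith)]; constructor <;> linarith

theorem integral_truncation {g : ℝ → ℂ} {α ε R : ℝ} (hε : 0 < ε) (hR : ε ≤ R)
    (h1 : IntegrableOn g (Icc (α + -R) (α + -ε))) (h2 : IntegrableOn g (Icc (α + ε) (α + R))) :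
    ∫ β in truncation α ε R, g β =
      (∫ τ in -R..-ε, g (α + τ)) + ∫ τ in ε..R, g (α + τ) := by
  rw [truncation_eq hε, setIntegral_union _ measurableSet_Icc h1 h2,
    intervalIntegral.integral_comp_add_left, intervalIntegral.integral_comp_add_left,
    intervalIntegral.integral_of_le (by linarith), intervalIntegral.integral_of_le (by linarith),
    integral_Icc_eq_integral_Ioc, integral_Icc_eq_integral_Ioc]
  rw [Set.disjoint_left]
  rintro β ⟨-, h3⟩ ⟨h4, -⟩
  linarith

namespace PeriodicCurve

variable {ζ dζ ddζ : ℝ → ℂ} (h : PeriodicCurve ζ dζ ddζ)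
include h

theorem continuousOn_div_sub {f : ℝ → ℂ} (hf : Continuous f) (α : ℝ) {S : Set ℝ} (hS : α ∉ S) :
    ContinuousOn (fun β => f β / (ζ β - ζ α)) S := by
  have := h.continuous
  refine ContinuousOn.div (by fun_prop) (by fun_prop) fun β hβ => ?_
  exact _root_.sub_ne_zero.2 fun e => hS (h.injective e ▸ hβ)

theorem integrableOn_div_sub {f : ℝ → ℂ} (hf : Continuous f) (α : ℝ) {a b : ℝ}
    (hS : α ∉ Icc a b) : IntegrableOn (fun β => f β / (ζ β - ζ α)) (Icc a b) :=
  (h.continuousOn_div_sub hf α hS).integrableOn_compact isCompact_Icc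

theorem integrableOn_truncation {f : ℝ → ℂ} (hf : Continuous f) (α R : ℝ) {ε : ℝ} (hε : 0 < ε) :
    IntegrableOn (fun β => f β / (ζ β - ζ α)) (truncation α ε R) := by
  rw [truncation_eq hε]
  exact (h.integrableOn_div_sub hf α fun hx => by linarith [hx.2]).union
    (h.integrableOn_div_sub hf α fun hx => by linarith [hx.1])

/-- The principal value on the line of the Cauchy integral is its finite part. -/
theorem tendsto_truncation {f : ℝ → ℂ} (hf : Continuous f)
    (hfp : Function.Periodic f (2 * Real.pi))
    {α K : ℝ} (hK : ∀ τ : ℝ, |τ| ≤ Real.pi → ‖f (α + τ) - f α‖ ≤ K * |τ|) :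
    Tendsto (fun q : ℝ × ℝ => ∫ β in truncation α q.1 q.2, f β / (ζ β - ζ α))
      (𝓝[>] 0 ×ˢ atTop) (𝓝 (finitePart ζ dζ f α)) := by
  have hpi := Real.pi_pos
  have h1 := ((h.tendsto_truncated_inv hf hK).comp
    (tendsto_fst (f := 𝓝[>] (0 : ℝ)) (g := (atTop : Filter ℝ)))).add
    ((h.tendsto_tail hf hfp α).comp (tendsto_snd (f := 𝓝[>] (0 : ℝ)) (g := (atTop : Filter ℝ))))
  rw [sub_add_cancel] at h1
  refine h1.congr' ?_
  have hnear : ∀ᶠ ε in 𝓝[>] (0 : ℝ), ε ∈ Ioo 0 Real.pi := Ioo_mem_nhdsGT hpi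
  filter_upwards [hnear.prod_mk (eventually_gt_atTop Real.pi)] with ⟨ε, R⟩ ⟨hε, hR⟩
  simp only at hε hR
  have hε0 := hε.1
  have hεπ := hε.2
  simp only [Function.comp_apply]
  rw [integral_truncation hε0 (by linarith)
    (h.integrableOn_div_sub hf α fun hx => by linarith [hx.2])
    (h.integrableOn_div_sub hf α fun hx => by linarith [hx.1]),
    ← intervalIntegral.integral_add_adjacent_intervals (a := -R) (b := -Real.pi) (c := -ε)
      (h.intervalIntegrable_div_sub_of_neg hf (by linarith) (by linarith))
      (h.intervalIntegrable_div_sub_of_neg hf (by linarith) (by linarith)),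
    ← intervalIntegral.integral_add_adjacent_intervals (a := ε) (b := Real.pi) (c := R)
      (h.intervalIntegrable_div_sub_of_pos hf (by linarith) (by linarith))
      (h.intervalIntegrable_div_sub_of_pos hf (by linarith) (by linarith))]
  ring

theorem finitePart_lower {U₀ U₁ : Set ℂ} (hs : SeparatedDomains ζ U₀ U₁) {F : ℂ → ℂ}
    (hF : IsPeriodicFlow ζ U₀ F) {b : ℝ}
    (hfin : ∫⁻ y in Iic b, ∫⁻ x in Ioc 0 (2 * Real.pi),
      ENNReal.ofReal (‖F ((x : ℝ) + (y : ℝ) * Complex.I)‖ ^ 2) < ⊤)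
    (hfc : Continuous fun β => F (ζ β) * dζ β)
    (hfp : Function.Periodic (fun β => F (ζ β) * dζ β) (2 * Real.pi)) {α K : ℝ}
    (hK : ∀ τ : ℝ, |τ| ≤ Real.pi →
      ‖F (ζ (α + τ)) * dζ (α + τ) - F (ζ α) * dζ α‖ ≤ K * |τ|) :
    finitePart ζ dζ (fun β => F (ζ β) * dζ β) α = -(F (ζ α) * (Real.pi * Complex.I)) := by
  obtain ⟨δ, hδ, hside⟩ := h.exists_displaced_mem hs
  obtain ⟨a, ha, -⟩ := hs.position
  have := h.finitePart_eq hfc hfp hK (nhdsGT_le_nhdsNE 0) tendsto_integral_inv_sub_right (by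
    filter_upwards [Ioc_mem_nhdsGT hδ] with s hs'
    have hw := (hside s α hs'.1 hs'.2).1
    set w := displaced ζ dζ s α
    refine h.integral_cotKernel_eq_zero (σ := -1) (S := Iic (min (min b (-a)) (w.im - 1)))
      hs.isOpen_lower hs.isSimplyConnected_lower hs.periodic_lower hF hδ
      (fun s β h1 h2 => by simpa using (hside s β h1 h2).2)
      (fun h1 => Set.disjoint_left.1 hs.disjoint h1 hw)
      (fun β e => hs.notMem_upper β (e ▸ hw)) measurableSet_Iic (by simp)
      (fun y hy x => ha _ ?_) (fun y hy => ?_) ((lintegral_mono_set ?_).trans_lt hfin)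
    · have : y ≤ -a := (mem_Iic.1 hy).trans ((min_le_left _ _).trans (min_le_right _ _))
      simpa using this
    · have : y ≤ w.im - 1 := (mem_Iic.1 hy).trans (min_le_right _ _)
      exact le_trans (by linarith) (neg_le_abs _)
    · exact Iic_subset_Iic.2 ((min_le_left _ _).trans (min_le_left _ _)))
  rw [this, mul_div_cancel_right₀ _ (h.deriv_ne_zero α)]

theorem finitePart_upper {U₀ U₁ : Set ℂ} (hs : SeparatedDomains ζ U₀ U₁) {F : ℂ → ℂ}
    (hF : IsPeriodicFlow ζ U₁ F) {b : ℝ}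
    (hfin : ∫⁻ y in Ici b, ∫⁻ x in Ioc 0 (2 * Real.pi),
      ENNReal.ofReal (‖F ((x : ℝ) + (y : ℝ) * Complex.I)‖ ^ 2) < ⊤)
    (hfc : Continuous fun β => F (ζ β) * dζ β)
    (hfp : Function.Periodic (fun β => F (ζ β) * dζ β) (2 * Real.pi)) {α K : ℝ}
    (hK : ∀ τ : ℝ, |τ| ≤ Real.pi →
      ‖F (ζ (α + τ)) * dζ (α + τ) - F (ζ α) * dζ α‖ ≤ K * |τ|) :
    finitePart ζ dζ (fun β => F (ζ β) * dζ β) α = F (ζ α) * (Real.pi * Complex.I) := by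
  obtain ⟨δ, hδ, hside⟩ := h.exists_displaced_mem hs
  obtain ⟨a, -, ha⟩ := hs.position
  have := h.finitePart_eq hfc hfp hK (nhdsLT_le_nhdsNE 0) tendsto_integral_inv_sub_left (by
    filter_upwards [Ico_mem_nhdsLT (neg_lt_zero.2 hδ)] with s hs'
    have hw := (hside (-s) α (by linarith [hs'.2]) (by linarith [hs'.1])).2
    rw [neg_neg] at hw
    set w := displaced ζ dζ s α
    refine h.integral_cotKernel_eq_zero (σ := 1) (S := Ici (max (max b a) (w.im + 1)))
      hs.isOpen_upper hs.isSimplyConnected_upper hs.periodic_upper hF hδ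
      (fun s β h1 h2 => by simpa using (hside s β h1 h2).1)
      (fun h1 => Set.disjoint_left.1 hs.disjoint hw h1)
      (fun β e => hs.notMem_lower β (e ▸ hw)) measurableSet_Ici (by simp)
      (fun y hy x => ha _ ?_) (fun y hy => ?_) ((lintegral_mono_set ?_).trans_lt hfin)
    · have : a ≤ y := ((le_max_right _ _).trans (le_max_left _ _)).trans (mem_Ici.1 hy)
      simpa using this
    · have : w.im + 1 ≤ y := (le_max_right _ _).trans (mem_Ici.1 hy)
      exact le_trans (by linarith) (le_abs_self _)
    · exact Ici_subset_Ici.2 ((le_max_left _ _).trans (le_max_left _ _)))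
  rw [this, mul_div_cancel_right₀ _ (h.deriv_ne_zero α)]
  ring

end PeriodicCurve

theorem plane_inner (x y : Plane) : inner ℝ x y = x 0 * y 0 + x 1 * y 1 := by
  rw [EuclideanSpace.inner_eq_star_dotProduct]
  simp [dotProduct, Fin.sum_univ_two, mul_comm]

theorem plane_ext {x y : Plane} (h0 : x 0 = y 0) (h1 : x 1 = y 1) : x = y := by
  ext i
  fin_cases i
  · exact h0
  · exact h1

@[simp] theorem perp_zero (x : Plane) : perp x 0 = -x 1 := rfl

@[simp] theorem perp_one (x : Plane) : perp x 1 = x 0 := rfl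

@[simp] theorem tr_zero (x : Plane) : tr x 0 = x 0 + 2 * Real.pi := rfl

@[simp] theorem tr_one (x : Plane) : tr x 1 = x 1 := rfl

theorem plane_eq_sum (x : Plane) : x = x 0 • stdVec 0 + x 1 • stdVec 1 := by
  refine plane_ext ?_ ?_ <;> simp [stdVec]

theorem inner_stdVec_one (x : Plane) : inner ℝ (stdVec 1) x = x 1 := by
  simp [plane_inner, stdVec]

theorem abs_coord_le (x : Plane) (i : Fin 2) : |x i| ≤ ‖x‖ := by
  simpa using PiLp.norm_apply_le x i

section Slices

variable {E : Type*} [NormedAddCommGroup E] [NormedSpace ℝ E] {f : ℝ × ℝ → E} {L : ℝ × ℝ →L[ℝ] E}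
  {T α t : ℝ}

theorem hasDerivAt_space_slice (ht : t ∈ Icc 0 T)
    (h : HasFDerivWithinAt f L (univ ×ˢ Icc 0 T) (α, t)) :
    HasDerivAt (fun a => f (a, t)) (L (1, 0)) α := by
  have h1 : HasDerivWithinAt (fun a : ℝ => (a, t)) (1, 0) univ α :=
    ((hasDerivAt_id α).prodMk (hasDerivAt_const α t)).hasDerivWithinAt
  have h2 : MapsTo (fun a : ℝ => (a, t)) univ (univ ×ˢ Icc 0 T) := fun a _ => ⟨mem_univ _, ht⟩
  exact hasDerivWithinAt_univ.1 (h.comp_hasDerivWithinAt α h1 h2)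

theorem hasDerivWithinAt_time_slice (h : HasFDerivWithinAt f L (univ ×ˢ Icc 0 T) (α, t)) :
    HasDerivWithinAt (fun s => f (α, s)) (L (0, 1)) (Icc 0 T) t := by
  have h1 : HasDerivWithinAt (fun s : ℝ => (α, s)) (0, 1) (Icc 0 T) t :=
    ((hasDerivAt_const t α).prodMk (hasDerivAt_id t)).hasDerivWithinAt
  exact h.comp_hasDerivWithinAt t h1 fun s hs => ⟨mem_univ _, hs⟩

theorem dAlpha_eq {F : ℝ → ℝ → E} (ht : t ∈ Icc 0 T)
    (h : HasFDerivWithinAt (fun p : ℝ × ℝ => F p.1 p.2) L (univ ×ˢ Icc 0 T) (α, t)) :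
    dAlpha F α t = L (1, 0) :=
  (hasDerivAt_space_slice ht h).deriv

theorem dTime_eq {F : ℝ → ℝ → E} (hT : 0 < T) (ht : t ∈ Icc 0 T)
    (h : HasFDerivWithinAt (fun p : ℝ × ℝ => F p.1 p.2) L (univ ×ˢ Icc 0 T) (α, t)) :
    dTime T F α t = L (0, 1) :=
  (hasDerivWithinAt_time_slice h).derivWithin (uniqueDiffOn_Icc hT t ht)

theorem uniqueDiffOn_strip (hT : 0 < T) : UniqueDiffOn ℝ (univ ×ˢ Icc 0 T : Set (ℝ × ℝ)) :=
  uniqueDiffOn_univ.prod (uniqueDiffOn_Icc hT)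

theorem contDiffOn_dAlpha {F : ℝ → ℝ → E} {m n : WithTop ℕ∞} (hT : 0 < T) (hmn : m + 1 ≤ n)
    (h : ContDiffOn ℝ n (fun p : ℝ × ℝ => F p.1 p.2) (univ ×ˢ Icc 0 T)) :
    ContDiffOn ℝ m (fun p : ℝ × ℝ => dAlpha F p.1 p.2) (univ ×ˢ Icc 0 T) := by
  have hn : n ≠ 0 := by
    rintro rfl
    exact absurd hmn (by simp)
  refine ((h.fderivWithin (uniqueDiffOn_strip hT) hmn).clm_apply
    (contDiffOn_const (c := ((1 : ℝ), (0 : ℝ))))).congr ?_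
  rintro ⟨a, s⟩ hp
  exact dAlpha_eq hp.2 ((h.differentiableOn hn) _ hp).hasFDerivWithinAt

theorem contDiffOn_dTime {F : ℝ → ℝ → E} {m n : WithTop ℕ∞} (hT : 0 < T) (hmn : m + 1 ≤ n)
    (h : ContDiffOn ℝ n (fun p : ℝ × ℝ => F p.1 p.2) (univ ×ˢ Icc 0 T)) :
    ContDiffOn ℝ m (fun p : ℝ × ℝ => dTime T F p.1 p.2) (univ ×ˢ Icc 0 T) := by
  have hn : n ≠ 0 := by
    rintro rfl
    exact absurd hmn (by simp)
  refine ((h.fderivWithin (uniqueDiffOn_strip hT) hmn).clm_apply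
    (contDiffOn_const (c := ((0 : ℝ), (1 : ℝ))))).congr ?_
  rintro ⟨a, s⟩ hp
  exact dTime_eq hT hp.2 ((h.differentiableOn hn) _ hp).hasFDerivWithinAt

theorem dTime_dAlpha_comm {F : ℝ → ℝ → E} (hT : 0 < T) (ht : t ∈ Icc 0 T)
    (h : ContDiffOn ℝ 2 (fun p : ℝ × ℝ => F p.1 p.2) (univ ×ˢ Icc 0 T)) :
    dTime T (dAlpha F) α t = dAlpha (dTime T F) α t := by
  set S : Set (ℝ × ℝ) := univ ×ˢ Icc 0 T with hS
  set f : ℝ × ℝ → E := fun p => F p.1 p.2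
  have hmem : (α, t) ∈ S := ⟨mem_univ _, ht⟩
  have hu := uniqueDiffOn_strip hT
  have hcl : (α, t) ∈ closure (interior S) := by
    rw [hS, interior_prod_eq, closure_prod_eq, interior_Icc, closure_Ioo hT.ne]
    simpa using ht
  have hsymm := (h (α, t) hmem).isSymmSndFDerivWithinAt
    (by rw [minSmoothness_of_isRCLikeNormedField]) hu hcl hmem
  have hd : HasFDerivWithinAt (fderivWithin ℝ f S) (fderivWithin ℝ (fderivWithin ℝ f S) S (α, t)) S
      (α, t) :=
    ((h.fderivWithin hu (m := 1) (by norm_num)).differentiableOn (by norm_num) _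
      hmem).hasFDerivWithinAt
  have hf1 : ∀ p ∈ S, HasFDerivWithinAt f (fderivWithin ℝ f S p) S p := fun p hp =>
    (h.differentiableOn (by norm_num) p hp).hasFDerivWithinAt
  have ha : HasFDerivWithinAt (fun p : ℝ × ℝ => dAlpha F p.1 p.2)
      (fderivWithin ℝ (fderivWithin ℝ f S) S (α, t)|>.flip (1, 0)) S (α, t) := by
    have := hd.clm_apply (hasFDerivWithinAt_const ((1 : ℝ), (0 : ℝ)) (α, t) S)
    refine (this.congr (fun p hp => ?_) ?_).congr_fderiv ?_
    · exact dAlpha_eq hp.2 (hf1 p hp)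
    · exact dAlpha_eq ht (hf1 _ hmem)
    · ext <;> simp
  have hb : HasFDerivWithinAt (fun p : ℝ × ℝ => dTime T F p.1 p.2)
      (fderivWithin ℝ (fderivWithin ℝ f S) S (α, t)|>.flip (0, 1)) S (α, t) := by
    have := hd.clm_apply (hasFDerivWithinAt_const ((0 : ℝ), (1 : ℝ)) (α, t) S)
    refine (this.congr (fun p hp => ?_) ?_).congr_fderiv ?_
    · exact dTime_eq hT hp.2 (hf1 p hp)
    · exact dTime_eq hT ht (hf1 _ hmem)
    · ext <;> simp
  rw [dTime_eq hT ht ha, dAlpha_eq ht hb]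
  exact hsymm _ _

end Slices

namespace PeriodicInterface

variable {T : ℝ} {z : ℝ → ℝ → Plane} {Ω : Fin 2 → ℝ → Set Plane} (h : PeriodicInterface T z Ω)
include h

theorem exists_common_point (j : Fin 2) : ∃ p : Plane, ∀ s ∈ Icc 0 T, p ∈ Ω j s := by
  obtain ⟨a, -, ha⟩ := h.position
  match j with
  | 0 => exact ⟨!₂[0, -a], fun s hs => (ha s hs).1 (by simp)⟩
  | 1 => exact ⟨!₂[0, a], fun s hs => (ha s hs).2 (by simp)⟩

theorem exists_horizontal_bound : ∃ B : ℝ, ∀ s ∈ Icc 0 T, ∀ α, |z α s 0 - α| ≤ B := by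
  have hc : ContinuousOn (fun p : ℝ × ℝ => z p.1 p.2 0 - p.1) (univ ×ˢ Icc 0 T) := by
    have h1 := h.contDiff_z.continuousOn
    have h2 : Continuous fun x : Plane => x 0 := by fun_prop
    exact (h2.comp_continuousOn h1).sub continuousOn_fst
  obtain ⟨B, hB⟩ := (isCompact_Icc.prod isCompact_Icc).exists_bound_of_continuousOn
    (hc.mono (prod_mono_left (subset_univ (Icc 0 (2 * Real.pi)))))
  refine ⟨B, fun s hs α => ?_⟩
  have hp : Function.Periodic (fun α => z α s 0 - α) (2 * Real.pi) := by
    intro α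
    simp only [h.periodic_z s hs α, tr_zero]
    ring
  obtain ⟨y, hy, e⟩ := hp.exists_mem_Ico₀ Real.two_pi_pos α
  rw [e]
  exact hB (y, s) ⟨Ico_subset_Icc_self hy, hs⟩

/-- A point of one of the domains stays in it for a short time. -/
theorem eventually_mem {t : ℝ} (ht : t ∈ Icc 0 T) {j : Fin 2} {y : Plane} (hy : y ∈ Ω j t) :
    ∀ᶠ s in 𝓝[Icc 0 T] t, y ∈ Ω j s := by
  obtain ⟨p, hp⟩ := h.exists_common_point j
  obtain ⟨B, hB⟩ := h.exists_horizontal_bound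
  obtain ⟨γ, hγ⟩ := (h.simplyConnected t ht j).isPathConnected.joinedIn p (hp t ht) y hy
  have hK : IsCompact (range γ) := isCompact_range γ.continuous
  obtain ⟨R, hR⟩ := hK.isBounded.exists_norm_le
  set A : Set (ℝ × ℝ) := Icc (-(R + B)) (R + B) ×ˢ Icc 0 T with hA
  have hzc : ContinuousOn (fun p : ℝ × ℝ => z p.1 p.2) A :=
    h.contDiff_z.continuousOn.mono (prod_mono_left (subset_univ _))
  have hAc : IsCompact A := isCompact_Icc.prod isCompact_Icc
  have hC : IsCompact (A ∩ (fun p : ℝ × ℝ => z p.1 p.2) ⁻¹' range γ) :=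
    hAc.of_isClosed_subset (hzc.preimage_isClosed_of_isClosed hAc.isClosed hK.isClosed)
      inter_subset_left
  have hcl : IsClosed (Prod.snd '' (A ∩ (fun p : ℝ × ℝ => z p.1 p.2) ⁻¹' range γ)) :=
    (hC.image continuous_snd).isClosed
  have hnot : t ∉ Prod.snd '' (A ∩ (fun p : ℝ × ℝ => z p.1 p.2) ⁻¹' range γ) := by
    rintro ⟨⟨α, s⟩, ⟨-, ⟨r, hr⟩⟩, rfl⟩
    simp only at hr
    exact Set.disjoint_left.1 (h.disjoint_curve s ht j) (hγ r) (hr ▸ ⟨α, rfl⟩)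
  filter_upwards [nhdsWithin_le_nhds (hcl.isOpen_compl.mem_nhds hnot), self_mem_nhdsWithin]
    with s hs hsT
  have hoff : range γ ⊆ Ω 0 s ∪ Ω 1 s := by
    intro x hx
    have hx' : x ∈ Ω 0 s ∪ Ω 1 s ∪ interfaceCurve z s := by rw [h.cover s hsT]; trivial
    refine hx'.resolve_right ?_
    rintro ⟨α, rfl⟩
    refine hs ⟨(α, s), ⟨⟨abs_le.1 ?_, hsT⟩, hx⟩, rfl⟩
    have h1 := (abs_coord_le _ 0).trans (hR _ hx)
    have h2 := hB s hsT α
    have h3 : α = z α s 0 - (z α s 0 - α) := by ring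
    rw [h3]
    exact (abs_sub _ _).trans (add_le_add h1 h2)
  have hpK : p ∈ range γ := ⟨0, γ.source⟩
  have hyK : y ∈ range γ := ⟨1, γ.target⟩
  have hpre : IsPreconnected (range γ) := isPreconnected_range γ.continuous
  have hps := hp s hsT
  have hdis := Set.disjoint_left.1 (h.disjoint_domains s hsT)
  rcases hpre.subset_or_subset (h.isOpen s hsT 0) (h.isOpen s hsT 1) (h.disjoint_domains s hsT) hoff
    with h1 | h1
  · match j with
    | 0 => exact h1 hyK
    | 1 => exact absurd hps (hdis (h1 hpK))
  · match j with
    | 0 => exact absurd (h1 hpK) (hdis hps)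
    | 1 => exact h1 hyK

theorem curve_mem_closure {t : ℝ} (ht : t ∈ Icc 0 T) (j : Fin 2) (α : ℝ) :
    z α t ∈ closure (Ω j t) :=
  frontier_subset_closure (by rw [h.frontier_eq t ht j]; exact ⟨α, rfl⟩)

theorem mapsTo_spaceTime (j : Fin 2) :
    MapsTo (fun p : ℝ × ℝ => (z p.1 p.2, p.2)) (univ ×ˢ Icc 0 T) (spaceTime T (Ω j)) :=
  fun p hp => ⟨hp.2, h.curve_mem_closure hp.2 j p.1⟩

end PeriodicInterface

namespace IsTwoFluidSolution

variable {T σ g : ℝ} {ρ : Fin 2 → ℝ} {z : ℝ → ℝ → Plane} {Ω : Fin 2 → ℝ → Set Plane}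
  {u : Fin 2 → Plane → ℝ → Plane} {P : Fin 2 → Plane → ℝ → ℝ}
  (h : IsTwoFluidSolution T σ g ρ z Ω u P)
include h

theorem hasFDerivAt_space {t : ℝ} (ht : t ∈ Icc 0 T) {j : Fin 2} {y : Plane} (hy : y ∈ Ω j t)
    {D : Plane × ℝ →L[ℝ] Plane}
    (hD : HasFDerivWithinAt (fun q : Plane × ℝ => u j q.1 q.2) D (spaceTime T (Ω j)) (y, t)) :
    HasFDerivAt (fun y => u j y t) (D.comp (ContinuousLinearMap.inl ℝ Plane ℝ)) y := by
  have h1 : HasFDerivWithinAt (fun y : Plane => (y, t)) (ContinuousLinearMap.inl ℝ Plane ℝ)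
      (Ω j t) y := (hasFDerivAt_prodMk_left y t).hasFDerivWithinAt
  have h2 : MapsTo (fun y : Plane => (y, t)) (Ω j t) (spaceTime T (Ω j)) :=
    fun x hx => ⟨ht, subset_closure hx⟩
  exact (hD.comp y h1 h2).hasFDerivAt ((h.isOpen t ht j).mem_nhds hy)

theorem dTime_velocity {t : ℝ} (hT : 0 < T) (ht : t ∈ Icc 0 T) {j : Fin 2} {y : Plane}
    (hy : y ∈ Ω j t) {D : Plane × ℝ →L[ℝ] Plane}
    (hD : HasFDerivWithinAt (fun q : Plane × ℝ => u j q.1 q.2) D (spaceTime T (Ω j)) (y, t)) :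
    dTime T (u j) y t = D (0, 1) := by
  have h0 : {s | y ∈ Ω j s} ∈ 𝓝[Icc 0 T] t := h.eventually_mem ht hy
  have h1 : HasDerivWithinAt (fun s : ℝ => (y, s)) (0, 1) (Icc 0 T ∩ {s | y ∈ Ω j s}) t :=
    ((hasDerivAt_const t y).prodMk (hasDerivAt_id t)).hasDerivWithinAt
  have h2 : MapsTo (fun s : ℝ => (y, s)) (Icc 0 T ∩ {s | y ∈ Ω j s}) (spaceTime T (Ω j)) :=
    fun s hs => ⟨hs.1, subset_closure hs.2⟩
  have h3 := hD.comp_hasDerivWithinAt t h1 h2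
  have h4 : HasDerivWithinAt (fun s => u j y s) (D (0, 1)) (Icc 0 T) t :=
    (hasDerivWithinAt_inter' h0).1 h3
  exact h4.derivWithin (uniqueDiffOn_Icc hT t ht)

theorem inner_deriv_symm {t : ℝ} (ht : t ∈ Icc 0 T) {j : Fin 2} {y : Plane} (hy : y ∈ Ω j t)
    {D : Plane × ℝ →L[ℝ] Plane}
    (hD : HasFDerivWithinAt (fun q : Plane × ℝ => u j q.1 q.2) D (spaceTime T (Ω j)) (y, t))
    (a b : Plane) : inner ℝ (D (a, 0)) b = inner ℝ (D (b, 0)) a := by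
  have h1 := h.curl_free t ht j y hy
  rw [curl, (h.hasFDerivAt_space ht hy hD).fderiv] at h1
  simp only [ContinuousLinearMap.comp_apply, ContinuousLinearMap.inl_apply] at h1
  have h2 : ∀ c : Plane, D (c, 0) = c 0 • D (stdVec 0, 0) + c 1 • D (stdVec 1, 0) := by
    intro c
    rw [← map_smul, ← map_smul, ← map_add]
    congr 1
    simp [← plane_eq_sum]
  rw [h2 a, h2 b, plane_inner, plane_inner]
  simp only [PiLp.add_apply, PiLp.smul_apply, smul_eq_mul]
  linear_combination (a 0 * b 1 - a 1 * b 0) * h1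

theorem inner_euler {t : ℝ} (hT : 0 < T) (ht : t ∈ Icc 0 T) {j : Fin 2} {y : Plane}
    (hy : y ∈ Ω j t) {D : Plane × ℝ →L[ℝ] Plane} {p : Plane →L[ℝ] ℝ}
    (hD : HasFDerivWithinAt (fun q : Plane × ℝ => u j q.1 q.2) D (spaceTime T (Ω j)) (y, t))
    (hp : HasFDerivWithinAt (fun x => P j x t) p (closure (Ω j t)) y) (b : Plane) :
    ρ j * (inner ℝ (D (0, 1)) b + inner ℝ (D (u j y t, 0)) b) = -p b - g * ρ j * b 1 := by
  have h1 := congrArg (fun w => inner ℝ w b) (h.euler t ht j y hy)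
  have h2 : HasFDerivAt (fun x => P j x t) p y :=
    hp.hasFDerivAt (mem_of_superset ((h.isOpen t ht j).mem_nhds hy) subset_closure)
  simp only [h.dTime_velocity hT ht hy hD, (h.hasFDerivAt_space ht hy hD).fderiv,
    ContinuousLinearMap.comp_apply, ContinuousLinearMap.inl_apply, inner_smul_left, inner_add_left,
    inner_sub_left, inner_neg_left, inner_gradient_left, h2.fderiv, inner_stdVec_one] at h1
  simpa using h1

/-- The irrotationality and the Euler equation hold up to the boundary. -/
theorem exists_boundary_derivative (hT : 0 < T) {t : ℝ} (ht : t ∈ Icc 0 T) (j : Fin 2) {x : Plane}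
    (hx : x ∈ closure (Ω j t)) :
    ∃ (D : Plane × ℝ →L[ℝ] Plane) (p : Plane →L[ℝ] ℝ),
      HasFDerivWithinAt (fun q : Plane × ℝ => u j q.1 q.2) D (spaceTime T (Ω j)) (x, t) ∧
      HasFDerivWithinAt (fun y => P j y t) p (closure (Ω j t)) x ∧
      (∀ a b, inner ℝ (D (a, 0)) b = inner ℝ (D (b, 0)) a) ∧
      ∀ b, ρ j * (inner ℝ (D (0, 1)) b + inner ℝ (D (u j x t, 0)) b) = -p b - g * ρ j * b 1 := by
  have hxt : (x, t) ∈ spaceTime T (Ω j) := ⟨ht, hx⟩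
  obtain ⟨V, hV, -, -, D, hD, hDc⟩ := (contDiffWithinAt_succ_iff_hasFDerivWithinAt' (n := 1)
    (by simp)).1 (by simpa [one_add_one_eq_two] using h.contDiff_u j (x, t) hxt)
  obtain ⟨W, hW, -, -, p, hp, hpc⟩ := (contDiffWithinAt_succ_iff_hasFDerivWithinAt' (n := 0)
    (by simp)).1 (by simpa using h.contDiff_P t ht j x hx)
  rw [insert_eq_of_mem hxt] at hV
  rw [insert_eq_of_mem hx] at hW
  have hxV : (x, t) ∈ V := mem_of_mem_nhdsWithin hxt hV
  have hxW : x ∈ W := mem_of_mem_nhdsWithin hx hW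
  have hne : (𝓝[Ω j t] x).NeBot := mem_closure_iff_nhdsWithin_neBot.1 hx
  have hin : Tendsto (fun y : Plane => (y, t)) (𝓝[Ω j t] x) (𝓝[spaceTime T (Ω j)] (x, t)) := by
    refine tendsto_nhdsWithin_iff.2 ⟨?_, ?_⟩
    · exact ((by fun_prop : Continuous fun y : Plane => (y, t)).tendsto x).mono_left
        nhdsWithin_le_nhds
    · filter_upwards [self_mem_nhdsWithin] with y hy using ⟨ht, subset_closure hy⟩
  have hcl : 𝓝[Ω j t] x ≤ 𝓝[closure (Ω j t)] x := nhdsWithin_mono _ subset_closure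
  have hDt : Tendsto (fun y => D (y, t)) (𝓝[Ω j t] x) (𝓝 (D (x, t))) :=
    hDc.continuousWithinAt.tendsto.comp hin
  have hpt : Tendsto p (𝓝[Ω j t] x) (𝓝 (p x)) := hpc.continuousWithinAt.tendsto.mono_left hcl
  have hut : Tendsto (fun y => u j y t) (𝓝[Ω j t] x) (𝓝 (u j x t)) :=
    ((h.contDiff_u j).continuousOn (x, t) hxt).tendsto.comp hin
  have hev : ∀ᶠ y in 𝓝[Ω j t] x, y ∈ Ω j t ∧ (y, t) ∈ V ∧ y ∈ W := by
    filter_upwards [self_mem_nhdsWithin, hin hV, hcl hW] with y h1 h2 h3 using ⟨h1, h2, h3⟩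
  have happ : ∀ {w : Plane → Plane × ℝ} {w₀ : Plane × ℝ}, Tendsto w (𝓝[Ω j t] x) (𝓝 w₀) →
      ∀ b : Plane, Tendsto (fun y => inner ℝ (D (y, t) (w y)) b) (𝓝[Ω j t] x)
        (𝓝 (inner ℝ (D (x, t) w₀) b)) := fun hw b =>
    Tendsto.inner (isBoundedBilinearMap_apply.continuous.tendsto (D (x, t), _) |>.comp
      (hDt.prodMk_nhds hw)) tendsto_const_nhds
  refine ⟨D (x, t), p x, hD _ hxV, hp _ hxW, fun a b => ?_, fun b => ?_⟩
  · refine tendsto_nhds_unique (happ (tendsto_const_nhds (x := (a, (0 : ℝ)))) b)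
      ((happ (tendsto_const_nhds (x := (b, (0 : ℝ)))) a).congr' ?_)
    filter_upwards [hev] with y ⟨h1, h2, _⟩
    exact h.inner_deriv_symm ht h1 (hD _ h2) b a
  · have hl := ((happ (tendsto_const_nhds (x := ((0 : Plane), (1 : ℝ)))) b).add
      (happ (hut.prodMk_nhds (tendsto_const_nhds (x := (0 : ℝ)))) b)).const_mul (ρ j)
    have hr : Tendsto (fun y => -p y b - g * ρ j * b 1) (𝓝[Ω j t] x)
        (𝓝 (-p x b - g * ρ j * b 1)) :=
      (((ContinuousLinearMap.apply ℝ ℝ b).continuous.tendsto (p x)).comp hpt).neg.sub_const _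
    refine tendsto_nhds_unique hl (hr.congr' ?_)
    filter_upwards [hev] with y ⟨h1, h2, h3⟩
    exact (h.inner_euler hT ht h1 (hD _ h2) (hp _ h3) b).symm

theorem contDiffOn_trace (j : Fin 2) :
    ContDiffOn ℝ 2 (fun p : ℝ × ℝ => trace z (u j) p.1 p.2) (univ ×ˢ Icc 0 T) := by
  have h1 : ContDiffOn ℝ 2 (fun p : ℝ × ℝ => (z p.1 p.2, p.2)) (univ ×ˢ Icc 0 T) :=
    (h.contDiff_z.of_le (by norm_num)).prodMk contDiff_snd.contDiffOn
  exact (h.contDiff_u j).comp h1 (h.mapsTo_spaceTime j)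

theorem tangentialEuler (hT : 0 < T) (hρ : ∀ j, 0 < ρ j) {t : ℝ} (ht : t ∈ Icc 0 T) (α : ℝ)
    (j : Fin 2) : TangentialEuler T g (ρ j) z (trace z (u j)) (trace z (P j)) α t := by
  obtain ⟨D, p, hD, hp, hsymm, heuler⟩ :=
    h.exists_boundary_derivative hT ht j (h.curve_mem_closure ht j α)
  have hmem : (α, t) ∈ (univ ×ˢ Icc 0 T : Set (ℝ × ℝ)) := ⟨mem_univ _, ht⟩
  have hz := ((h.contDiff_z.differentiableOn (by norm_num)) _ hmem).hasFDerivWithinAt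
  set Z := fderivWithin ℝ (fun p : ℝ × ℝ => z p.1 p.2) (univ ×ˢ Icc 0 T) (α, t)
  have hza : dAlpha z α t = Z (1, 0) := dAlpha_eq ht hz
  have hzt : dTime T z α t = Z (0, 1) := dTime_eq hT ht hz
  have hv : HasFDerivWithinAt (fun p : ℝ × ℝ => trace z (u j) p.1 p.2)
      (D.comp (Z.prod (ContinuousLinearMap.snd ℝ ℝ ℝ))) (univ ×ˢ Icc 0 T) (α, t) :=
    HasFDerivWithinAt.comp (g := fun q : Plane × ℝ => u j q.1 q.2) (α, t) hD
      (hz.prodMk hasFDerivAt_snd.hasFDerivWithinAt) (h.mapsTo_spaceTime j)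
  have hva := hasDerivAt_space_slice ht hv
  have hvt := hasDerivWithinAt_time_slice hv
  simp only [ContinuousLinearMap.comp_apply, ContinuousLinearMap.prod_apply,
    ContinuousLinearMap.coe_snd', ← hza, ← hzt] at hva hvt
  have hzat := ((contDiffOn_dAlpha (m := 3) hT (by norm_num) h.contDiff_z).differentiableOn
    (by norm_num) _ hmem).hasFDerivWithinAt
  have hzta := ((contDiffOn_dTime (m := 3) hT (by norm_num) h.contDiff_z).differentiableOn
    (by norm_num) _ hmem).hasFDerivWithinAt
  have hcomm := dTime_dAlpha_comm (α := α) hT ht (h.contDiff_z.of_le (by norm_num))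
  rw [dTime_eq hT ht hzat, dAlpha_eq ht hzta] at hcomm
  have d1 := hvt.inner ℝ (hasDerivWithinAt_time_slice hzat)
  have d2 := hva.inner ℝ (hasDerivAt_space_slice ht hzta)
  have d3 : HasDerivAt (fun a => ‖trace z (u j) a t‖ ^ 2)
      (2 * inner ℝ (trace z (u j) α t) (D (dAlpha z α t, 0))) α := hva.norm_sq
  have hzs := hasDerivAt_space_slice ht hz
  have d4 : HasDerivAt (fun a => trace z (P j) a t) (p (dAlpha z α t)) α := by
    rw [hza]
    have hm : MapsTo (fun a => z a t) univ (closure (Ω j t)) :=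
      fun a _ => h.curve_mem_closure ht j a
    exact hasDerivWithinAt_univ.1 (HasFDerivWithinAt.comp_hasDerivWithinAt
      (l := fun y => P j y t) α hp hzs.hasDerivWithinAt hm)
  have d5 : HasDerivAt (fun a => z a t 1) (dAlpha z α t 1) α := by
    rw [hza]
    exact (EuclideanSpace.proj (𝕜 := ℝ) (1 : Fin 2)).hasFDerivAt.comp_hasDerivAt α hzs
  refine ⟨d1.differentiableWithinAt, d2.differentiableAt, d3.differentiableAt, d4.differentiableAt,
    ?_⟩
  have e1 : dTime T (fun a s => inner ℝ (trace z (u j) a s) (dAlpha z a s)) α t = _ :=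
    d1.derivWithin (uniqueDiffOn_Icc hT t ht)
  have e2 : dAlpha (fun a s => inner ℝ (trace z (u j) a s) (dTime T z a s)) α t = _ := d2.deriv
  have e3 : dAlpha (fun a s => ‖trace z (u j) a s‖ ^ 2) α t = _ := d3.deriv
  have e4 : dAlpha (trace z (P j)) α t = _ := d4.deriv
  have e5 : dAlpha (fun a s => z a s 1) α t = _ := d5.deriv
  rw [e1, e2, e3, e4, e5, hcomm]
  have h6 := heuler (dAlpha z α t)
  have h7 := hsymm (u j (z α t) t) (dAlpha z α t)
  have h8 := hsymm (dTime T z α t) (dAlpha z α t)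
  have h9 : D (dTime T z α t, 1) = D (dTime T z α t, 0) + D (0, 1) := by
    rw [← map_add]; simp
  have h10 : inner ℝ (trace z (u j) α t) (D (dAlpha z α t, 0)) =
      inner ℝ (D (u j (z α t) t, 0)) (dAlpha z α t) := by
    rw [h7, real_inner_comm]; rfl
  simp only [h9, h10, inner_add_left, h8]
  have hρj := (hρ j).ne'
  have h11 : inner ℝ (D (0, 1)) (dAlpha z α t) + inner ℝ (D (u j (z α t) t, 0)) (dAlpha z α t) =
      -(1 / ρ j * p (dAlpha z α t)) - g * dAlpha z α t 1 := by
    field_simp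
    linear_combination h6
  linear_combination h11

end IsTwoFluidSolution

theorem exists_lipschitz_bound {f : ℝ → ℂ} (hf : ContDiff ℝ 1 f) (α r : ℝ) :
    ∃ K : ℝ, ∀ τ : ℝ, |τ| ≤ r → ‖f (α + τ) - f α‖ ≤ K * |τ| := by
  obtain ⟨K, hK⟩ := (isCompact_Icc (a := α - r) (b := α + r)).exists_bound_of_continuousOn
    (hf.continuous_deriv le_rfl).continuousOn
  refine ⟨K, fun τ hτ => ?_⟩
  have hτ' := abs_le.1 hτ
  have := (convex_Icc (α - r) (α + r)).norm_image_sub_le_of_norm_deriv_le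
    (fun x _ => (hf.differentiable one_ne_zero) x) hK (x := α) (y := α + τ)
    ⟨by linarith [abs_nonneg τ], by linarith [abs_nonneg τ]⟩ ⟨by linarith, by linarith⟩
  simpa using this

/-- The identification of the Euclidean plane with the complex numbers. -/
noncomputable def toComplex : Plane ≃ₗᵢ[ℝ] ℂ := Complex.orthonormalBasisOneI.repr.symm

theorem toComplex_apply (x : Plane) : toComplex x = x 0 + x 1 * Complex.I := by
  rw [toComplex, ← OrthonormalBasis.sum_repr_symm]
  simp [Fin.sum_univ_two]

@[simp] theorem toComplex_re (x : Plane) : (toComplex x).re = x 0 := by simp [toComplex_apply]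

@[simp] theorem toComplex_im (x : Plane) : (toComplex x).im = x 1 := by simp [toComplex_apply]

theorem toComplex_symm_zero (w : ℂ) : toComplex.symm w 0 = w.re := by
  rw [← toComplex_re, LinearIsometryEquiv.apply_symm_apply]

theorem toComplex_symm_one (w : ℂ) : toComplex.symm w 1 = w.im := by
  rw [← toComplex_im, LinearIsometryEquiv.apply_symm_apply]

theorem toComplex_perp (x : Plane) : toComplex (perp x) = Complex.I * toComplex x := by
  apply Complex.ext <;> simp

theorem toComplex_tr (x : Plane) : toComplex (tr x) = toComplex x + 2 * Real.pi := by
  apply Complex.ext <;> simp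

theorem toComplex_symm_add_two_pi (w : ℂ) :
    toComplex.symm (w + 2 * Real.pi) = tr (toComplex.symm w) := by
  rw [LinearIsometryEquiv.symm_apply_eq, toComplex_tr, LinearIsometryEquiv.apply_symm_apply]

theorem tr_injective : Function.Injective tr := fun x y hxy => by
  apply toComplex.injective
  simpa [toComplex_tr] using congrArg toComplex hxy

/-- The complex velocity `w₁ - i w₂` of a planar vector field. -/
noncomputable def complexVelocity (w : Plane → Plane) (ξ : ℂ) : ℂ :=
  Complex.conjCLE (toComplex (w (toComplex.symm ξ)))

theorem norm_complexVelocity (w : Plane → Plane) (ξ : ℂ) :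
    ‖complexVelocity w ξ‖ = ‖w (toComplex.symm ξ)‖ := by
  simp [complexVelocity]

theorem differentiableAt_complexVelocity {w : Plane → Plane} {ξ : ℂ}
    (hw : DifferentiableAt ℝ w (toComplex.symm ξ)) (hdiv : divergence w (toComplex.symm ξ) = 0)
    (hcurl : curl w (toComplex.symm ξ) = 0) : DifferentiableAt ℂ (complexVelocity w) ξ := by
  set L := fderiv ℝ w (toComplex.symm ξ) with hL
  have hF : HasFDerivAt (complexVelocity w)
      ((Complex.conjCLE : ℂ →L[ℝ] ℂ) ∘L (toComplex.toContinuousLinearEquiv : Plane →L[ℝ] ℂ) ∘L L ∘L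
        (toComplex.symm.toContinuousLinearEquiv : ℂ →L[ℝ] Plane)) ξ :=
    (Complex.conjCLE : ℂ →L[ℝ] ℂ).hasFDerivAt.comp ξ
      ((toComplex.toContinuousLinearEquiv : Plane →L[ℝ] ℂ).hasFDerivAt.comp ξ
        (hw.hasFDerivAt.comp ξ
          (toComplex.symm.toContinuousLinearEquiv : ℂ →L[ℝ] Plane).hasFDerivAt))
  rw [differentiableAt_complex_iff_differentiableAt_real]
  refine ⟨hF.differentiableAt, ?_⟩
  have h1 : toComplex.symm 1 = stdVec 0 := by
    rw [LinearIsometryEquiv.symm_apply_eq]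
    apply Complex.ext <;> simp [stdVec]
  have hI : toComplex.symm Complex.I = stdVec 1 := by
    rw [LinearIsometryEquiv.symm_apply_eq]
    apply Complex.ext <;> simp [stdVec]
  have hdiv' : L (stdVec 0) 0 + L (stdVec 1) 1 = 0 := hdiv
  have hcurl' : L (stdVec 0) 1 - L (stdVec 1) 0 = 0 := hcurl
  rw [hF.fderiv]
  apply Complex.ext
  · simp [h1, hI]
    linarith
  · simp [h1, hI]
    linarith

theorem hasDerivAt_dAlpha {E : Type*} [NormedAddCommGroup E] [NormedSpace ℝ E] {F : ℝ → ℝ → E}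
    {n : WithTop ℕ∞} {T t : ℝ} (hn : n ≠ 0) (ht : t ∈ Icc 0 T)
    (h : ContDiffOn ℝ n (fun p : ℝ × ℝ => F p.1 p.2) (univ ×ˢ Icc 0 T)) (α : ℝ) :
    HasDerivAt (fun a => F a t) (dAlpha F α t) α := by
  have hd := (h.differentiableOn hn (α, t) ⟨mem_univ _, ht⟩).hasFDerivWithinAt
  rw [dAlpha_eq ht hd]
  exact hasDerivAt_space_slice ht hd

theorem contDiff_space_slice {E : Type*} [NormedAddCommGroup E] [NormedSpace ℝ E]
    {F : ℝ → ℝ → E} {n : WithTop ℕ∞} {T t : ℝ} (ht : t ∈ Icc 0 T)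
    (h : ContDiffOn ℝ n (fun p : ℝ × ℝ => F p.1 p.2) (univ ×ˢ Icc 0 T)) :
    ContDiff ℝ n fun a => F a t :=
  contDiffOn_univ.1 (h.comp (contDiff_id.prodMk contDiff_const).contDiffOn
    fun _ _ => ⟨mem_univ _, ht⟩)

theorem lintegral_complexVelocity_lt_top {w : Plane → Plane} {A : Set Plane} (hA : MeasurableSet A)
    (hw : MemLp w 2 (volume.restrict (A ∩ {x : Plane | x 0 ∈ Icc 0 (2 * Real.pi)})))
    {S : Set ℝ} (hS : ∀ ξ : ℂ, ξ.im ∈ S → toComplex.symm ξ ∈ A) :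
    ∫⁻ y in S, ∫⁻ x in Ioc 0 (2 * Real.pi),
      ENNReal.ofReal (‖complexVelocity w ((x : ℝ) + (y : ℝ) * Complex.I)‖ ^ 2) < ⊤ := by
  set φ : ℝ × ℝ → Plane := fun p => toComplex.symm (Complex.measurableEquivRealProd.symm p)
  have hφ : MeasurePreserving φ :=
    toComplex.symm.measurePreserving.comp
      (Complex.volume_preserving_equiv_real_prod.symm Complex.measurableEquivRealProd)
  have hB : MeasurableSet (A ∩ {x : Plane | x 0 ∈ Icc 0 (2 * Real.pi)}) :=
    hA.inter (measurableSet_Icc.preimage (by fun_prop))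
  have h1 := hw.comp_measurePreserving (hφ.restrict_preimage hB)
  have hsub : Ioc 0 (2 * Real.pi) ×ˢ S ⊆ φ ⁻¹' (A ∩ {x : Plane | x 0 ∈ Icc 0 (2 * Real.pi)}) := by
    rintro ⟨x, y⟩ ⟨hx, hy⟩
    refine ⟨hS _ hy, ?_⟩
    change toComplex.symm _ 0 ∈ Icc 0 (2 * Real.pi)
    rw [toComplex_symm_zero]
    exact Ioc_subset_Icc_self hx
  have h2 := h1.mono_measure (Measure.restrict_mono hsub le_rfl)
  rw [Measure.volume_eq_prod, ← Measure.prod_restrict] at h2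
  have h3 := lintegral_rpow_enorm_lt_top_of_eLpNorm_lt_top two_ne_zero ENNReal.ofNat_ne_top
    h2.eLpNorm_lt_top
  rw [lintegral_prod_symm _ (h2.aestronglyMeasurable.enorm.pow_const _)] at h3
  convert h3 using 5 with y x
  rw [norm_complexVelocity, ENNReal.ofReal_pow (norm_nonneg _), ofReal_norm]
  simp [φ, Complex.measurableEquivRealProd_symm_apply, Complex.mk_eq_add_mul_I]

namespace PeriodicInterface

variable {T : ℝ} {z : ℝ → ℝ → Plane} {Ω : Fin 2 → ℝ → Set Plane} (h : PeriodicInterface T z Ω)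
include h

theorem dAlpha_periodic {t : ℝ} (ht : t ∈ Icc 0 T) (α : ℝ) :
    dAlpha z (α + 2 * Real.pi) t = dAlpha z α t := by
  have h1 := (hasDerivAt_dAlpha (by norm_num) ht h.contDiff_z (α + 2 * Real.pi)).comp_add_const
    α (2 * Real.pi)
  have h2 := (hasDerivAt_dAlpha (by norm_num) ht h.contDiff_z α).add_const
    (tr 0)
  refine h1.unique (h2.congr_of_eventuallyEq (Eventually.of_forall fun a => ?_))
  change z (a + 2 * Real.pi) t = z a t + tr 0
  rw [h.periodic_z t ht]
  refine plane_ext ?_ ?_ <;> simp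

theorem periodicCurve (hT : 0 < T) {t : ℝ} (ht : t ∈ Icc 0 T) :
    PeriodicCurve (fun β => toComplex (z β t)) (fun β => toComplex (dAlpha z β t))
      (fun β => toComplex (dAlpha (dAlpha z) β t)) where
  hasDerivAt β := (toComplex.toContinuousLinearEquiv : Plane →L[ℝ] ℂ).hasFDerivAt.comp_hasDerivAt β
    (hasDerivAt_dAlpha (by norm_num) ht h.contDiff_z β)
  hasDerivAt_deriv β :=
    (toComplex.toContinuousLinearEquiv : Plane →L[ℝ] ℂ).hasFDerivAt.comp_hasDerivAt β
      (hasDerivAt_dAlpha (n := 3) (by norm_num) ht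
        (contDiffOn_dAlpha hT (by norm_num) h.contDiff_z) β)
  continuous_deriv2 := toComplex.continuous.comp (contDiff_space_slice (n := 2) ht
    (contDiffOn_dAlpha hT (by norm_num)
      (contDiffOn_dAlpha (m := 3) hT (by norm_num) h.contDiff_z))).continuous
  add_two_pi β := by rw [h.periodic_z t ht, toComplex_tr]
  injective := toComplex.injective.comp (h.injective t ht)
  deriv_ne_zero β := by simpa using h.regular t ht β

theorem tr_mem_iff {t : ℝ} (ht : t ∈ Icc 0 T) (j : Fin 2) (x : Plane) :
    tr x ∈ Ω j t ↔ x ∈ Ω j t := by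
  conv_lhs => rw [← h.periodic_domains t ht j]
  exact tr_injective.mem_set_image

theorem separatedDomains {t : ℝ} (ht : t ∈ Icc 0 T) :
    SeparatedDomains (fun β => toComplex (z β t)) (toComplex.symm ⁻¹' Ω 0 t)
      (toComplex.symm ⁻¹' Ω 1 t) := by
  have hcurve : ∀ j β, toComplex (z β t) ∉ toComplex.symm ⁻¹' Ω j t := fun j β hβ => by
    rw [mem_preimage, LinearIsometryEquiv.symm_apply_apply] at hβ
    exact Set.disjoint_left.1 (h.disjoint_curve t ht j) hβ ⟨β, rfl⟩
  have hper : ∀ j (x : ℂ), x + 2 * Real.pi ∈ toComplex.symm ⁻¹' Ω j t ↔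
      x ∈ toComplex.symm ⁻¹' Ω j t := fun j x => by
    rw [mem_preimage, mem_preimage, toComplex_symm_add_two_pi, h.tr_mem_iff ht]
  have hsc : ∀ j, IsSimplyConnected (toComplex.symm ⁻¹' Ω j t) := fun j =>
    toComplex.symm.toHomeomorph.isSimplyConnected_preimage.2 (h.simplyConnected t ht j)
  refine ⟨(h.isOpen t ht 0).preimage toComplex.symm.continuous,
    (h.isOpen t ht 1).preimage toComplex.symm.continuous, hsc 0, hsc 1,
    (h.disjoint_domains t ht).preimage _, hcurve 0, hcurve 1, fun x => ?_, hper 0, hper 1, ?_⟩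
  · rcases (h.cover t ht).ge (mem_univ (toComplex.symm x)) with (h0 | h1) | ⟨β, hβ⟩
    · exact Or.inl h0
    · exact Or.inr (Or.inl h1)
    · refine Or.inr (Or.inr ⟨β, ?_⟩)
      rw [← LinearIsometryEquiv.eq_symm_apply]
      exact hβ
  · obtain ⟨a, -, ha⟩ := h.position
    refine ⟨a, fun x hx => (ha t ht).1 ?_, fun x hx => (ha t ht).2 ?_⟩
    · change toComplex.symm x 1 ≤ -a
      rwa [toComplex_symm_one]
    · change a ≤ toComplex.symm x 1
      rwa [toComplex_symm_one]

end PeriodicInterface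

namespace IsTwoFluidSolution

variable {T σ g : ℝ} {ρ : Fin 2 → ℝ} {z : ℝ → ℝ → Plane} {Ω : Fin 2 → ℝ → Set Plane}
  {u : Fin 2 → Plane → ℝ → Plane} {P : Fin 2 → Plane → ℝ → ℝ}
  (h : IsTwoFluidSolution T σ g ρ z Ω u P)
include h

theorem continuousOn_space {t : ℝ} (ht : t ∈ Icc 0 T) (j : Fin 2) :
    ContinuousOn (fun x => u j x t) (closure (Ω j t)) :=
  (h.contDiff_u j).continuousOn.comp (by fun_prop : Continuous fun x : Plane => (x, t)).continuousOn
    fun _ hx => ⟨ht, hx⟩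

theorem trace_periodic {t : ℝ} (ht : t ∈ Icc 0 T) (j : Fin 2) (α : ℝ) :
    trace z (u j) (α + 2 * Real.pi) t = trace z (u j) α t := by
  have hc : Continuous tr := by
    have : tr = fun x => x + tr 0 := funext fun x => plane_ext (by simp) (by simp)
    rw [this]
    fun_prop
  have hm : MapsTo tr (Ω j t) (Ω j t) := fun x hx =>
    (h.tr_mem_iff ht j x).2 hx
  have := Set.EqOn.of_subset_closure (f := fun x => u j (tr x) t) (g := fun x => u j x t)
    (fun x hx => h.periodic_u t ht j x hx)
    ((h.continuousOn_space ht j).comp hc.continuousOn (hm.closure hc))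
    (h.continuousOn_space ht j) subset_closure subset_rfl
    (h.curve_mem_closure ht j α)
  simpa [trace, h.periodic_z t ht] using this

theorem isPeriodicFlow {t : ℝ} (ht : t ∈ Icc 0 T) (j : Fin 2) :
    IsPeriodicFlow (fun β => toComplex (z β t)) (toComplex.symm ⁻¹' Ω j t)
      (complexVelocity fun x => u j x t) where
  differentiableOn ξ hξ := by
    obtain ⟨L, hL⟩ : ∃ L, HasFDerivAt (fun x => u j x t) L (toComplex.symm ξ) :=
      ⟨_, ((((h.contDiff_u j).comp (contDiff_id.prodMk contDiff_const).contDiffOn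
        (fun x (hx : x ∈ Ω j t) => ⟨ht, subset_closure hx⟩)).contDiffAt
        ((h.isOpen t ht j).mem_nhds hξ)).differentiableAt (by norm_num)).hasFDerivAt⟩
    exact (differentiableAt_complexVelocity hL.differentiableAt (h.div_free t ht j _ hξ)
      (h.curl_free t ht j _ hξ)).differentiableWithinAt
  continuousOn := by
    refine Complex.conjCLE.continuous.comp_continuousOn (toComplex.continuous.comp_continuousOn
      ((h.continuousOn_space ht j).comp toComplex.symm.continuous.continuousOn ?_))
    rintro ξ (hξ | ⟨β, rfl⟩)
    · exact subset_closure hξ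
    · rw [LinearIsometryEquiv.symm_apply_apply]
      exact h.curve_mem_closure ht j β
  periodic ξ hξ := by
    simp only [complexVelocity, toComplex_symm_add_two_pi, h.periodic_u t ht j _ hξ]

end IsTwoFluidSolution

theorem eq_smul_of_inner_perp_eq_zero {x y : Plane} (hy : y ≠ 0) (h : inner ℝ x (perp y) = 0) :
    x = inner ℝ x y • (1 / ‖y‖ ^ 2) • y := by
  have hn : ‖y‖ ^ 2 ≠ 0 := pow_ne_zero 2 (norm_ne_zero_iff.2 hy)
  have hsq : ‖y‖ ^ 2 = y 0 ^ 2 + y 1 ^ 2 := by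
    rw [← real_inner_self_eq_norm_sq, plane_inner]
    ring
  rw [plane_inner, perp_zero, perp_one] at h
  refine plane_ext ?_ ?_
  · simp only [PiLp.smul_apply, smul_eq_mul, plane_inner]
    field_simp
    rw [hsq]
    linear_combination (-y 1) * h
  · simp only [PiLp.smul_apply, smul_eq_mul, plane_inner]
    field_simp
    rw [hsq]
    linear_combination (y 0) * h

theorem conj_mul_of_inner_perp_eq_zero {x y : Plane} (h : inner ℝ x (perp y) = 0) :
    Complex.conjCLE (toComplex x) * toComplex y = (inner ℝ x y : ℝ) := by
  rw [plane_inner, perp_zero, perp_one] at h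
  apply Complex.ext
  · simp [plane_inner]
  · simp
    linarith

/-- The real-linear map `ξ ↦ conj (i ξ)`, with values in the plane. -/
noncomputable def conjRotation : ℂ →L[ℝ] Plane :=
  (toComplex.symm.toContinuousLinearEquiv : ℂ →L[ℝ] Plane) ∘L (Complex.conjCLE : ℂ →L[ℝ] ℂ) ∘L
    ContinuousLinearMap.mul ℝ ℂ Complex.I

theorem conjRotation_apply (ξ : ℂ) :
    conjRotation ξ = toComplex.symm (Complex.conjCLE (Complex.I * ξ)) := rfl

theorem birkhoffRottKernel_eq (z : ℝ → ℝ → Plane) (ω : ℝ → ℝ → ℝ) (α t β : ℝ) :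
    birkhoffRottKernel z ω α t β =
      conjRotation (ω β t / (toComplex (z β t) - toComplex (z α t))) := by
  rw [conjRotation_apply, LinearIsometryEquiv.eq_symm_apply, birkhoffRottKernel, map_smul,
    toComplex_perp, ← map_sub, ← neg_sub (z α t), map_neg, ← toComplex.norm_map]
  set X := toComplex (z α t - z β t)
  rcases eq_or_ne X 0 with hX | hX
  · simp [hX]
  have hc : (starRingEnd ℂ) X ≠ 0 := (map_ne_zero _).2 hX
  have hn : ((‖X‖ : ℂ)) ^ 2 = X * (starRingEnd ℂ) X := (Complex.mul_conj' X).symm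
  simp only [Complex.real_smul, Complex.ofReal_div, Complex.ofReal_pow, hn,
    Complex.conjCLE_apply, map_mul, map_div₀, Complex.conj_I, map_neg, Complex.conj_ofReal]
  field_simp

/-- The strength of the vortex sheet that is defined by the velocities on both sides of it. -/
noncomputable def vortexStrength (z : ℝ → ℝ → Plane) (u : Fin 2 → Plane → ℝ → Plane)
    (α t : ℝ) : ℝ :=
  inner ℝ (trace z (u 0) α t - trace z (u 1) α t) (dAlpha z α t)

namespace IsTwoFluidSolution

variable {T σ g : ℝ} {ρ : Fin 2 → ℝ} {z : ℝ → ℝ → Plane} {Ω : Fin 2 → ℝ → Set Plane}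
  {u : Fin 2 → Plane → ℝ → Plane} {P : Fin 2 → Plane → ℝ → ℝ}
  (h : IsTwoFluidSolution T σ g ρ z Ω u P)
include h

theorem contDiffOn_vortexStrength (hT : 0 < T) :
    ContDiffOn ℝ 2 (fun p : ℝ × ℝ => vortexStrength z u p.1 p.2) (univ ×ˢ Icc 0 T) :=
  ((h.contDiffOn_trace 0).sub (h.contDiffOn_trace 1)).inner ℝ
    (contDiffOn_dAlpha hT (by norm_num) h.contDiff_z)

theorem vortexStrength_periodic {t : ℝ} (ht : t ∈ Icc 0 T) (α : ℝ) :
    vortexStrength z u (α + 2 * Real.pi) t = vortexStrength z u α t := by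
  simp only [vortexStrength, h.trace_periodic ht, h.dAlpha_periodic ht]

theorem inner_jump_perp {t : ℝ} (ht : t ∈ Icc 0 T) (α : ℝ) :
    inner ℝ (trace z (u 0) α t - trace z (u 1) α t) (perp (dAlpha z α t)) = 0 := by
  have h0 := h.kinematic t ht 0 α
  have h1 := h.kinematic t ht 1 α
  rw [inner_sub_left] at h0 h1 ⊢
  simp only [trace]
  linarith

theorem velocity_jump {t : ℝ} (ht : t ∈ Icc 0 T) (α : ℝ) :
    trace z (u 0) α t - trace z (u 1) α t =
      vortexStrength z u α t • (1 / ‖dAlpha z α t‖ ^ 2) • dAlpha z α t :=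
  eq_smul_of_inner_perp_eq_zero (h.regular t ht α) (h.inner_jump_perp ht α)

/-- The complex velocity of the fluid `j` along the curve, multiplied by the tangent, is `C¹`. -/
theorem contDiff_complexVelocity_curve (hT : 0 < T) {t : ℝ} (ht : t ∈ Icc 0 T) (j : Fin 2) :
    ContDiff ℝ 1 fun β => complexVelocity (fun x => u j x t) (toComplex (z β t)) *
      toComplex (dAlpha z β t) := by
  have h1 : ContDiff ℝ 1 fun β => trace z (u j) β t :=
    (contDiff_space_slice ht (h.contDiffOn_trace j)).of_le (by norm_num)
  have h2 : ContDiff ℝ 1 fun β => dAlpha z β t :=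
    contDiff_space_slice ht (contDiffOn_dAlpha hT (by norm_num) h.contDiff_z)
  have h3 : ContDiff ℝ 1 fun β => Complex.conjCLE (toComplex (trace z (u j) β t)) *
      toComplex (dAlpha z β t) :=
    (Complex.conjCLE.contDiff.comp (toComplex.contDiff.comp h1)).mul (toComplex.contDiff.comp h2)
  simpa [complexVelocity, trace] using h3

theorem periodic_complexVelocity_curve {t : ℝ} (ht : t ∈ Icc 0 T) (j : Fin 2) :
    Function.Periodic (fun β => complexVelocity (fun x => u j x t) (toComplex (z β t)) *
      toComplex (dAlpha z β t)) (2 * Real.pi) := fun β => by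
  have h1 := h.trace_periodic ht j β
  simp only [trace] at h1
  simp only [complexVelocity, LinearIsometryEquiv.symm_apply_apply, h1, h.dAlpha_periodic ht]

theorem finitePart_complexVelocity (hT : 0 < T) {t : ℝ} (ht : t ∈ Icc 0 T) (α : ℝ) :
    finitePart (fun β => toComplex (z β t)) (fun β => toComplex (dAlpha z β t))
        (fun β => complexVelocity (fun x => u 0 x t) (toComplex (z β t)) *
          toComplex (dAlpha z β t)) α =
      -(complexVelocity (fun x => u 0 x t) (toComplex (z α t)) * (Real.pi * Complex.I)) ∧
    finitePart (fun β => toComplex (z β t)) (fun β => toComplex (dAlpha z β t))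
        (fun β => complexVelocity (fun x => u 1 x t) (toComplex (z β t)) *
          toComplex (dAlpha z β t)) α =
      complexVelocity (fun x => u 1 x t) (toComplex (z α t)) * (Real.pi * Complex.I) := by
  have hs := h.separatedDomains ht
  obtain ⟨a, ha0, ha1⟩ := hs.position
  have hf := fun j => h.contDiff_complexVelocity_curve hT ht j
  choose K hK using fun j => exists_lipschitz_bound (hf j) α Real.pi
  exact ⟨(h.periodicCurve hT ht).finitePart_lower hs (h.isPeriodicFlow ht 0) (b := -a)
      (lintegral_complexVelocity_lt_top (h.isOpen t ht 0).measurableSet (h.finite_energy t ht 0)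
        fun ξ hξ => ha0 ξ hξ) (hf 0).continuous (h.periodic_complexVelocity_curve ht 0) (hK 0),
    (h.periodicCurve hT ht).finitePart_upper hs (h.isPeriodicFlow ht 1) (b := a)
      (lintegral_complexVelocity_lt_top (h.isOpen t ht 1).measurableSet (h.finite_energy t ht 1)
        fun ξ hξ => ha1 ξ hξ) (hf 1).continuous (h.periodic_complexVelocity_curve ht 1) (hK 1)⟩

theorem isBirkhoffRott (hT : 0 < T) {t : ℝ} (ht : t ∈ Icc 0 T) (α : ℝ) :
    IsBirkhoffRott z (vortexStrength z u) α t
      ((1 / 2 : ℝ) • (trace z (u 0) α t + trace z (u 1) α t)) := by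
  have hc := h.periodicCurve hT ht
  have hf := fun j => h.contDiff_complexVelocity_curve hT ht j
  choose K hK using fun j => exists_lipschitz_bound (hf j) α Real.pi
  have hlim := fun j => hc.tendsto_truncation (hf j).continuous
    (h.periodic_complexVelocity_curve ht j) (hK j)
  have hint := fun (j : Fin 2) (ε R : ℝ) (hε : 0 < ε) =>
    hc.integrableOn_truncation (hf j).continuous α R hε
  obtain ⟨h0, h1⟩ := h.finitePart_complexVelocity hT ht α
  have hker : birkhoffRottKernel z (vortexStrength z u) α t = fun β => conjRotation
      (complexVelocity (fun x => u 0 x t) (toComplex (z β t)) * toComplex (dAlpha z β t) /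
          (toComplex (z β t) - toComplex (z α t)) -
        complexVelocity (fun x => u 1 x t) (toComplex (z β t)) * toComplex (dAlpha z β t) /
          (toComplex (z β t) - toComplex (z α t))) := by
    funext β
    rw [birkhoffRottKernel_eq, vortexStrength,
      ← conj_mul_of_inner_perp_eq_zero (h.inner_jump_perp ht β)]
    congr 1
    simp only [complexVelocity, LinearIsometryEquiv.symm_apply_apply, trace, map_sub]
    ring
  rw [IsBirkhoffRott, HasPrincipalValue, hker]
  refine ⟨fun ε R hε => conjRotation.integrable_comp ((hint 0 ε R hε).sub (hint 1 ε R hε)), ?_⟩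
  have hv : (2 * Real.pi) • (1 / 2 : ℝ) • (trace z (u 0) α t + trace z (u 1) α t) =
      conjRotation (-(complexVelocity (fun x => u 0 x t) (toComplex (z α t)) *
          (Real.pi * Complex.I)) -
        complexVelocity (fun x => u 1 x t) (toComplex (z α t)) * (Real.pi * Complex.I)) := by
    rw [conjRotation_apply, LinearIsometryEquiv.eq_symm_apply]
    simp only [complexVelocity, LinearIsometryEquiv.symm_apply_apply, trace]
    apply Complex.ext
    · simp
      ring
    · simp
      ring
  rw [hv, ← h0, ← h1]
  refine ((conjRotation.continuous.tendsto _).comp ((hlim 0).sub (hlim 1))).congr' ?_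
  have hpos : ∀ᶠ q : ℝ × ℝ in 𝓝[>] 0 ×ˢ atTop, 0 < q.1 :=
    tendsto_fst.eventually self_mem_nhdsWithin
  filter_upwards [hpos] with q hq
  exact (congrArg conjRotation (integral_sub (hint 0 q.1 q.2 hq) (hint 1 q.1 q.2 hq)).symm).trans
    (conjRotation.integral_comp_comm ((hint 0 q.1 q.2 hq).sub (hint 1 q.1 q.2 hq))).symm

end IsTwoFluidSolution

end TwoFluid

open TwoFluid in
theorem proposition2p1 (T σ g : ℝ) (ρ : Fin 2 → ℝ) (hT : 0 < T) (hσ : 0 ≤ σ) (hg : 0 ≤ g)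
    (hρ : ∀ j, 0 < ρ j) (z : ℝ → ℝ → Plane) (Ω : Fin 2 → ℝ → Set Plane)
    (u : Fin 2 → Plane → ℝ → Plane) (P : Fin 2 → Plane → ℝ → ℝ)
    (h : IsTwoFluidSolution T σ g ρ z Ω u P) :
    ∃ (ω : ℝ → ℝ → ℝ) (BR : ℝ → ℝ → Plane),
      ContDiffOn ℝ 2 (fun p : ℝ × ℝ => ω p.1 p.2) (Set.univ ×ˢ Set.Icc 0 T) ∧
      ∀ t ∈ Set.Icc 0 T, ∀ α,
        ω (α + 2 * Real.pi) t = ω α t ∧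
        IsBirkhoffRott z ω α t (BR α t) ∧
        trace z (u 0) α t
          = BR α t + (ω α t / 2) • (1 / ‖dAlpha z α t‖ ^ 2) • dAlpha z α t ∧
        trace z (u 1) α t
          = BR α t - (ω α t / 2) • (1 / ‖dAlpha z α t‖ ^ 2) • dAlpha z α t ∧
        inner ℝ (dTime T z α t - BR α t) (perp (dAlpha z α t)) = 0 ∧
        ∀ j, TangentialEuler T g (ρ j) z (trace z (u j)) (trace z (P j)) α t := by
  refine ⟨vortexStrength z u, fun α t => (1 / 2 : ℝ) • (trace z (u 0) α t + trace z (u 1) α t),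
    h.contDiffOn_vortexStrength hT, fun t ht α => ⟨h.vortexStrength_periodic ht α,
      h.isBirkhoffRott hT ht α, ?_, ?_, ?_, fun j => h.tangentialEuler hT hρ ht α j⟩⟩
  · rw [div_eq_inv_mul (vortexStrength z u α t), mul_smul, ← h.velocity_jump ht α]
    module
  · rw [div_eq_inv_mul (vortexStrength z u α t), mul_smul, ← h.velocity_jump ht α]
    module
  · have h0 := h.kinematic t ht 0 α
    have h1 := h.kinematic t ht 1 α
    rw [inner_sub_left] at h0 h1 ⊢
    rw [inner_smul_left, inner_add_left]
    simp only [trace, conj_trivial]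
    linarith
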